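/- **Setting.** A ZX-diagram $D:k\to l$ is an open multigraph, considered up to deformation, with $k$ inputs and $l$ outputs, whose vertices are green dots $Z(\alpha)$ and red dots $X(\alpha)$ of arbitrary degree, with angle $\alpha\in\mathbb R/2\pi\mathbb Z$, and Hadamard boxes $H$ of degree $2$. Its wires join vertices, inputs and outputs (parallel wires and loops are allowed, and so are closed circles); exactly one wire ends at each input and each output. Diagrams compose spatially ($\otimes$) and sequentially ($\circ$). For a set $E$ of equations between diagrams, $ZX+E\vdash D_1=D_2$ means that $(D_1,D_2)$ belongs to the smallest equivalence relation (relating diagrams of the same type) that is invariant under deformation, is compatible with $\otimes$ and $\circ$, and contains $E$ and all colour-swapped and upside-down versions of the following rules. Here $s$ is the scalar diagram $Z(0)\!-\!X(0)$ (one wire), $s'$ is $Z(0)\!\equiv\! X(0)$ (three parallel wires), and composites along a line are read from input to output. * (S1) $Z(\alpha)$ and $Z(\beta)$ joined by at least one wire $=Z(\alpha+\beta)$ with the remaining legs. * (S2), (S3) $Z(0):1\to1$ is the plain wire; $Z(0):0\to 2$ is the plain bent wire. * (B1) $s\otimes\bigl(X(0):0\to1 \text{ followed by } Z(0):1\to 2\bigr)=\bigl(X(0):0\to1\bigr)\otimes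 \bigl(X(0):0\to1\bigr)$. * (B2) $s\otimes K=\bigl(X(0):2\to1 \text{ followed by } Z(0):1\to2\bigr)$, where $K:2\to2$ is the complete bipartite diagram between two dots $Z(0)$ carrying the inputs and two dots $X(0)$ carrying the outputs. * (K1) $X(\pi):1\to1$ followed by $Z(0):1\to2$ equals $Z(0):1\to2$ followed by $X(\pi)$ on each output. * (K2) $s\otimes\bigl(\,-X(\pi)-Z(\alpha)-\,\bigr)=\bigl(Z(\alpha)\!-\!X(\pi)\bigr)\otimes\bigl(\,-Z(-\alpha)-X(\pi)-\,\bigr)$. * (EU) $H=s'\otimes Z^{(0,0)}(-\tfrac\pi2)\otimes\bigl(\,-Z(\tfrac\pi2)-X(\tfrac\pi2)-Z(\tfrac\pi2)-\,\bigr)$, where $Z^{(0,0)}(\alpha)$ denotes a dot without legs. * (H) $Z(\alpha)$ with a Hadamard box on every leg $=X(\alpha)$, for any numbers of inputs and outputs. * (IV) $s\otimes s'$ is the empty diagram. * (ZO) $Z^{(0,0)}(\pi)\otimes(\text{plain wire})=Z^{(0,0)}(\pi)\otimes\bigl(Z(0):1\to0\bigr)\otimes\bigl(X(0):0\to1\bigr)$.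 **Supplementarity** for the angle $\alpha$ is the following equation between diagrams $0\to1$: the diagram made of two green dots of degree one, with angles $\alpha$ and $\alpha+\pi$, both attached to a red dot of angle $0$ that carries the output, equals the diagram made of a green dot of angle $2\alpha+\pi$ attached by two parallel wires to a red dot of angle $0$ that carries the output. **Antiphase twins** in a diagram are two dots $u,v$ of the same colour whose angles differ by $\pi$ and such that every other vertex (green dot, red dot or Hadamard box), every input and every output is joined to $u$ and to $v$ by the same number of wires; $u$ and $v$ may also be joined to each other. *Merging* $u$ and $v$, of angles $\alpha$ and $\beta$, means to replace them by a single dot of the same colour and of angle $\alpha+\beta$, deleting the wires between $u$ and $v$ and attaching to the new dot all other wire ends that were at $u$ or $v$. **Theorem (Antiphase twins and supplementarity).** Let $E$ be any set of additional equations between diagrams (for instance $E=\emptyset$, or the supplementarity equations). The following are equivalent: 1. in $ZX+E$ antiphase twins can be merged: for every diagram $D$ and all antiphase twins $u,v$ in $D$, $ZX+E\vdash D=D'$, where $D'$ is obtained from $D$ by merging $u$ and $v$; 2. supplementarity holds for all angles: for every $\alpha$, $ZX+E\vdash$ supplementarity for $\alpha$. -/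

import Mathlib

open scoped Real

namespace ZX

/-! ### Diagrams

A ZX-diagram is treated up to deformation ("only topology matters"): it is an open multigraph whose
vertices are green dots, red dots and Hadamard boxes, and whose wires join vertices and
inputs/outputs. A marked point may be put anywhere on a wire (`Node.joint`); it carries no meaning,
and marked points are inserted and removed freely in `Derivable`. Marked points make sequential
composition a plain gluing of graphs, and represent a closed circle (a marked point joined to
itself). -/

/-- The two colours of dots: `Z` is green and `X` is red. -/
inductive Colour where
  | Z
  | X

/-- Exchange of the two colours. -/
def Colour.swap : Colour → Colour
  | Z => X
  | X => Z

/-- What a node of a diagram can be. Angles are real numbers modulo `2π`. -/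
inductive Node where
  /-- a green or red dot with an angle -/
  | dot (c : Colour) (α : Real.Angle)
  /-- a Hadamard box -/
  | had
  /-- a marked point on a wire -/
  | joint

/-- Colour exchange on nodes: dots change colour and keep their angle. -/
def Node.swap : Node → Node
  | dot c α => dot c.swap α
  | had => had
  | joint => joint

/-- Hadamard boxes and marked points have exactly two legs; dots have any number of legs. -/
def Node.IsBinary : Node → Prop
  | dot _ _ => False
  | had => True
  | joint => True

/-- The number of wire ends at `x`, for a multiset `W` of wires; a wire from `x` to itself has two
ends at `x`. -/
noncomputable def degree {P : Type} (W : Multiset (Sym2 P)) (x : P) : ℕ := by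
  classical exact (W.bind Sym2.toMultiset).count x

/-- The number of wires between `x` and `y`. -/
noncomputable def wireCount {P : Type} (W : Multiset (Sym2 P)) (x y : P) : ℕ := by
  classical exact W.count s(x, y)

/-- ZX-diagrams with inputs labelled by `I` and outputs labelled by `O`; a diagram `k → l` is the
case `I = Fin k`, `O = Fin l`. A wire is an unordered pair of end points, each of which is a node,
an input or an output; parallel wires and wires from a node to itself are allowed. Exactly one wire
ends at each input and at each output. -/
structure Diagram (I O : Type) where
  /-- the nodes -/
  V : Type
  finite : Finite V
  /-- the kind of each node -/
  label : V → Node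
  /-- the wires, with multiplicity -/
  wires : Multiset (Sym2 (V ⊕ (I ⊕ O)))
  degree_binary : ∀ v, (label v).IsBinary → degree wires (.inl v) = 2
  degree_port : ∀ p, degree wires (.inr p) = 1

/-! ### Counting wire ends -/

theorem degree_add {P : Type} (W W' : Multiset (Sym2 P)) (x : P) :
    degree (W + W') x = degree W x + degree W' x := by
  classical
  simp [degree, Multiset.add_bind]

theorem toMultiset_map {P Q : Type} (f : P → Q) (e : Sym2 P) :
    (e.map f).toMultiset = e.toMultiset.map f := by
  induction e with
  | _ a b => simp [Sym2.toMultiset]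

theorem degree_map_eq {P Q : Type} (f : P → Q) (W : Multiset (Sym2 P)) (x : P)
    (hf : ∀ y, f y = f x → y = x) :
    degree (W.map (Sym2.map f)) (f x) = degree W x := by
  classical
  have h : (W.map (Sym2.map f)).bind Sym2.toMultiset = (W.bind Sym2.toMultiset).map f := by
    rw [Multiset.bind_map, Multiset.map_bind]
    exact Multiset.bind_congr fun e _ => toMultiset_map f e
  simp only [degree, h, Multiset.count_map]
  rw [Multiset.count_eq_card_filter_eq]
  congr 1
  refine Multiset.filter_congr fun y _ => ⟨fun hy => (hf y hy.symm).symm, fun hy => by rw [hy]⟩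

theorem degree_map_eq_zero {P Q : Type} (f : P → Q) (W : Multiset (Sym2 P)) (x : Q)
    (hf : ∀ y, f y ≠ x) : degree (W.map (Sym2.map f)) x = 0 := by
  classical
  simp only [degree]
  rw [Multiset.count_eq_zero, Multiset.mem_bind]
  rintro ⟨e, he, hx⟩
  obtain ⟨e', -, rfl⟩ := Multiset.mem_map.1 he
  rw [Sym2.mem_toMultiset, Sym2.mem_map] at hx
  obtain ⟨y, -, hy⟩ := hx
  exact hf y hy

theorem degree_pairs {P ι : Type} [Fintype ι] [inst : DecidableEq P] (f g : ι → P) (x : P) :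
    degree ((Finset.univ : Finset ι).val.map fun i => s(f i, g i)) x =
      ∑ i, ((if x = f i then 1 else 0) + if x = g i then 1 else 0) := by
  obtain rfl : inst = fun a b => Classical.propDecidable (a = b) := Subsingleton.elim _ _
  classical
  simp only [degree, Multiset.count_bind, Multiset.map_map, Finset.sum]
  congr 1
  refine Multiset.map_congr rfl fun i _ => ?_
  rw [Function.comp_apply]
  have h : (s(f i, g i) : Sym2 P).toMultiset = f i ::ₘ {g i} := rfl
  rw [h, Multiset.count_cons, Multiset.count_singleton, add_comm]

theorem degree_filter_ne {P : Type} (W : Multiset (Sym2 P)) (e : Sym2 P) (x : P) (hx : x ∉ e) :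
    degree (by classical exact W.filter (· ≠ e)) x = degree W x := by
  classical
  simp only [degree, Multiset.count_bind]
  induction W using Multiset.induction_on with
  | empty => simp
  | cons a W ih =>
    by_cases h : a = e
    · subst h
      have : Multiset.count x a.toMultiset = 0 := by
        rw [Multiset.count_eq_zero, Sym2.mem_toMultiset]; exact hx
      simpa [this] using ih
    · simpa [h] using ih

namespace Diagram

variable {I O : Type}

/-! ### Spatial and sequential composition -/

/-- Renaming of end points when the first diagram is put on the left of the second one. -/
def tensorLeft {V₁ V₂ I₁ O₁ I₂ O₂ : Type} :
    V₁ ⊕ (I₁ ⊕ O₁) → (V₁ ⊕ V₂) ⊕ ((I₁ ⊕ I₂) ⊕ (O₁ ⊕ O₂)) :=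
  Sum.map Sum.inl (Sum.map Sum.inl Sum.inl)

/-- Renaming of end points when the second diagram is put on the right of the first one. -/
def tensorRight {V₁ V₂ I₁ O₁ I₂ O₂ : Type} :
    V₂ ⊕ (I₂ ⊕ O₂) → (V₁ ⊕ V₂) ⊕ ((I₁ ⊕ I₂) ⊕ (O₁ ⊕ O₂)) :=
  Sum.map Sum.inr (Sum.map Sum.inr Sum.inr)

/-- Spatial composition: the two diagrams side by side. -/
def tensor {I₁ O₁ I₂ O₂ : Type} (D₁ : Diagram I₁ O₁) (D₂ : Diagram I₂ O₂) :
    Diagram (I₁ ⊕ I₂) (O₁ ⊕ O₂) where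
  V := D₁.V ⊕ D₂.V
  finite := by have := D₁.finite; have := D₂.finite; infer_instance
  label := Sum.elim D₁.label D₂.label
  wires := D₁.wires.map (Sym2.map tensorLeft) + D₂.wires.map (Sym2.map tensorRight)
  degree_binary := by
    rintro (v | v) hv
    · have h₁ := degree_map_eq (tensorLeft (V₂ := D₂.V) (I₂ := I₂) (O₂ := O₂)) D₁.wires (.inl v)
        (by rintro (y | y | y) <;> simp [tensorLeft])
      have h₂ := degree_map_eq_zero (tensorRight (V₁ := D₁.V) (I₁ := I₁) (O₁ := O₁)) D₂.wires
        (.inl (.inl v)) (by rintro (y | y | y) <;> simp [tensorRight])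
      rw [degree_add, h₂, add_zero, ← D₁.degree_binary v hv, ← h₁]
      rfl
    · have h₁ := degree_map_eq (tensorRight (V₁ := D₁.V) (I₁ := I₁) (O₁ := O₁)) D₂.wires (.inl v)
        (by rintro (y | y | y) <;> simp [tensorRight])
      have h₂ := degree_map_eq_zero (tensorLeft (V₂ := D₂.V) (I₂ := I₂) (O₂ := O₂)) D₁.wires
        (.inl (.inr v)) (by rintro (y | y | y) <;> simp [tensorLeft])
      rw [degree_add, h₂, zero_add, ← D₂.degree_binary v hv, ← h₁]
      rfl
  degree_port := by
    have hl : ∀ p, degree (D₁.wires.map (Sym2.map (tensorLeft (V₂ := D₂.V) (I₂ := I₂) (O₂ := O₂))))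
        (tensorLeft (.inr p)) = 1 := fun p => by
      rw [degree_map_eq _ _ _ (by
        rcases p with p | p <;> rintro (y | y | y) <;> simp [tensorLeft]), D₁.degree_port]
    have hr : ∀ p, degree (D₂.wires.map (Sym2.map (tensorRight (V₁ := D₁.V) (I₁ := I₁) (O₁ := O₁))))
        (tensorRight (.inr p)) = 1 := fun p => by
      rw [degree_map_eq _ _ _ (by
        rcases p with p | p <;> rintro (y | y | y) <;> simp [tensorRight]), D₂.degree_port]
    rintro ((i | i) | (o | o))
    · rw [degree_add, degree_map_eq_zero tensorRight, add_zero]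
      · exact hl (.inl i)
      · rintro (y | y | y) <;> simp [tensorRight]
    · rw [degree_add, degree_map_eq_zero tensorLeft, zero_add]
      · exact hr (.inl i)
      · rintro (y | y | y) <;> simp [tensorLeft]
    · rw [degree_add, degree_map_eq_zero tensorRight, add_zero]
      · exact hl (.inr o)
      · rintro (y | y | y) <;> simp [tensorRight]
    · rw [degree_add, degree_map_eq_zero tensorLeft, zero_add]
      · exact hr (.inr o)
      · rintro (y | y | y) <;> simp [tensorLeft]

/-- Renaming of end points of the first diagram in a sequential composition: the output `m` becomes
the marked point `m`. -/
def compFirst {V₁ V₂ M : Type} : V₁ ⊕ (I ⊕ M) → ((V₁ ⊕ V₂) ⊕ M) ⊕ (I ⊕ O)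
  | .inl v => .inl (.inl (.inl v))
  | .inr (.inl i) => .inr (.inl i)
  | .inr (.inr m) => .inl (.inr m)

/-- Renaming of end points of the second diagram in a sequential composition: the input `m` becomes
the marked point `m`. -/
def compSecond {V₁ V₂ M : Type} : V₂ ⊕ (M ⊕ O) → ((V₁ ⊕ V₂) ⊕ M) ⊕ (I ⊕ O)
  | .inl v => .inl (.inl (.inr v))
  | .inr (.inl m) => .inl (.inr m)
  | .inr (.inr o) => .inr (.inr o)

/-- Sequential composition (first `D₁`, then `D₂`): each output of `D₁` is connected to the
corresponding input of `D₂`, the junction being a marked point on the resulting wire. -/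
def comp {M : Type} [Finite M] (D₁ : Diagram I M) (D₂ : Diagram M O) : Diagram I O where
  V := (D₁.V ⊕ D₂.V) ⊕ M
  finite := by have := D₁.finite; have := D₂.finite; infer_instance
  label := Sum.elim (Sum.elim D₁.label D₂.label) fun _ => .joint
  wires := D₁.wires.map (Sym2.map compFirst) + D₂.wires.map (Sym2.map compSecond)
  degree_binary := by
    have h₁ : ∀ x, degree (D₁.wires.map (Sym2.map (compFirst (V₂ := D₂.V) (O := O))))
        (compFirst x) = degree D₁.wires x := fun x => degree_map_eq _ _ _ (by
          rcases x with x | x | x <;> rintro (y | y | y) <;> simp [compFirst])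
    have h₂ : ∀ x, degree (D₂.wires.map (Sym2.map (compSecond (V₁ := D₁.V) (I := I))))
        (compSecond x) = degree D₂.wires x := fun x => degree_map_eq _ _ _ (by
          rcases x with x | x | x <;> rintro (y | y | y) <;> simp [compSecond])
    rintro ((v | v) | m) hv
    · rw [degree_add, degree_map_eq_zero compSecond, add_zero]
      · exact (h₁ (.inl v)).trans (D₁.degree_binary v hv)
      · rintro (y | y | y) <;> simp [compSecond]
    · rw [degree_add, degree_map_eq_zero compFirst, zero_add]
      · exact (h₂ (.inl v)).trans (D₂.degree_binary v hv)
      · rintro (y | y | y) <;> simp [compFirst]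
    · rw [degree_add]
      exact congrArg₂ (· + ·) ((h₁ (.inr (.inr m))).trans (D₁.degree_port _))
        ((h₂ (.inr (.inl m))).trans (D₂.degree_port _))
  degree_port := by
    have h₁ : ∀ x, degree (D₁.wires.map (Sym2.map (compFirst (V₂ := D₂.V) (O := O))))
        (compFirst x) = degree D₁.wires x := fun x => degree_map_eq _ _ _ (by
          rcases x with x | x | x <;> rintro (y | y | y) <;> simp [compFirst])
    have h₂ : ∀ x, degree (D₂.wires.map (Sym2.map (compSecond (V₁ := D₁.V) (I := I))))
        (compSecond x) = degree D₂.wires x := fun x => degree_map_eq _ _ _ (by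
          rcases x with x | x | x <;> rintro (y | y | y) <;> simp [compSecond])
    rintro (i | o)
    · rw [degree_add, degree_map_eq_zero compSecond, add_zero]
      · exact (h₁ (.inr (.inl i))).trans (D₁.degree_port _)
      · rintro (y | y | y) <;> simp [compSecond]
    · rw [degree_add, degree_map_eq_zero compFirst, zero_add]
      · exact (h₂ (.inr (.inr o))).trans (D₂.degree_port _)
      · rintro (y | y | y) <;> simp [compFirst]

/-! ### Colour exchange and turning upside down -/

/-- The colour-swapped diagram. -/
def colourSwap (D : Diagram I O) : Diagram I O where
  V := D.V
  finite := D.finite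
  label v := (D.label v).swap
  wires := D.wires
  degree_binary v hv := D.degree_binary v (by
    revert hv; cases D.label v <;> exact id)
  degree_port := D.degree_port

/-- The upside-down diagram: inputs become outputs and vice versa, angles are unchanged. -/
def upsideDown (D : Diagram I O) : Diagram O I where
  V := D.V
  finite := D.finite
  label := D.label
  wires := D.wires.map (Sym2.map (Sum.map id Sum.swap))
  degree_binary v hv := by
    rw [← D.degree_binary v hv]
    exact degree_map_eq (Sum.map id Sum.swap) D.wires (.inl v) (by
      rintro (y | y | y) <;> simp)
  degree_port p := by
    rw [← D.degree_port p.swap]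
    have := degree_map_eq (Sum.map id Sum.swap : D.V ⊕ (I ⊕ O) → _) D.wires (.inr p.swap) (by
      rcases p with p | p <;> rintro (y | y | y) <;> simp)
    rw [← this]
    simp

/-! ### Diagrams without vertices, and Hadamard boxes -/

/-- Parallel plain wires, from input `i` to output `i` for each `i`. -/
def identity (I : Type) [Fintype I] : Diagram I I where
  V := Empty
  finite := inferInstance
  label := Empty.elim
  wires := (Finset.univ : Finset I).val.map fun i => s(.inr (.inl i), .inr (.inr i))
  degree_binary v := v.elim
  degree_port p := by
    classical
    rw [degree_pairs]
    rcases p with p | p <;> simp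

/-- The diagram with no input and two outputs that are joined by a plain wire. -/
def cap : Diagram (Fin 0) (Fin 2) where
  V := Empty
  finite := inferInstance
  label := Empty.elim
  wires := {s(.inr (.inr 0), .inr (.inr 1))}
  degree_binary v := v.elim
  degree_port p := by
    rcases p with p | p
    · exact p.elim0
    · have h : (s(.inr (.inr 0), .inr (.inr 1)) : Sym2 (Empty ⊕ (Fin 0 ⊕ Fin 2))).toMultiset =
        .inr (.inr 0) ::ₘ {.inr (.inr 1)} := rfl
      classical
      simp only [degree, Multiset.singleton_bind, h, Multiset.count_cons, Multiset.count_singleton]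
      fin_cases p <;> simp

/-- Parallel wires, each of which carries a Hadamard box. -/
def hadamards (I : Type) [Fintype I] : Diagram I I where
  V := I
  finite := inferInstance
  label _ := .had
  wires := ((Finset.univ : Finset I).val.map fun i => s(.inr (.inl i), .inl i)) +
    (Finset.univ : Finset I).val.map fun i => s(.inl i, .inr (.inr i))
  degree_binary v _ := by
    classical
    rw [degree_add, degree_pairs, degree_pairs]
    simp
  degree_port p := by
    classical
    rw [degree_add, degree_pairs, degree_pairs]
    rcases p with p | p <;> simp

/-! ### Diagrams of dots -/

/-- The diagram with green and red dots `dots`, wires `W` between dots, one more wire from input `i`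
to the dot `inp i` for each input, and one more wire from the dot `out o` to output `o` for each
output. -/
def ofDots {V : Type} [Finite V] [Fintype I] [Fintype O] (dots : V → Colour × Real.Angle)
    (inp : I → V) (out : O → V) (W : Multiset (Sym2 V)) : Diagram I O where
  V := V
  finite := inferInstance
  label v := .dot (dots v).1 (dots v).2
  wires := W.map (Sym2.map Sum.inl) +
    (((Finset.univ : Finset I).val.map fun i => s(.inr (.inl i), .inl (inp i))) +
      (Finset.univ : Finset O).val.map fun o => s(.inl (out o), .inr (.inr o)))
  degree_binary v hv := hv.elim
  degree_port p := by
    classical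
    rw [degree_add, degree_add, degree_pairs, degree_pairs, degree_map_eq_zero]
    · rcases p with p | p <;> simp
    · simp

/-- A single dot with inputs `I` and outputs `O`. -/
def spider (I O : Type) [Fintype I] [Fintype O] (c : Colour) (α : Real.Angle) : Diagram I O :=
  ofDots (V := Unit) (fun _ => (c, α)) (fun _ => ()) (fun _ => ()) 0

/-! ### Deformation -/

/-- Isomorphism of diagrams: a bijection of the nodes that preserves their kinds and the wires, and
fixes inputs and outputs. -/
def Iso (D D' : Diagram I O) : Prop :=
  ∃ f : D.V ≃ D'.V, (∀ v, D'.label (f v) = D.label v) ∧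
    D'.wires = D.wires.map (Sym2.map (Sum.map f id))

/-- `D'` arises from `D` by putting a marked point on a wire: the wire from `x` to `y` is replaced
by a wire from `x` to a new marked point and a wire from this point to `y`. -/
def Subdivides (D D' : Diagram I O) : Prop :=
  ∃ (f : Option D.V ≃ D'.V) (x y : D.V ⊕ (I ⊕ O)) (W : Multiset (Sym2 (D.V ⊕ (I ⊕ O)))),
    D'.label (f none) = .joint ∧ (∀ v, D'.label (f (some v)) = D.label v) ∧
    D.wires = s(x, y) ::ₘ W ∧
    D'.wires = s(Sum.map (fun v => f (some v)) id x, .inl (f none)) ::ₘ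
      s(.inl (f none), Sum.map (fun v => f (some v)) id y) ::ₘ
        W.map (Sym2.map (Sum.map (fun v => f (some v)) id))

end Diagram

open Diagram Colour

/-! ### The rules of the calculus

In `ofDots ![(Z, α), (X, β), …] ![…] ![…] {…}` the dots are numbered from `0`; the two middle vectors
list the dots to which the inputs and the outputs are attached, and the last multiset lists the wires
between dots. -/

/-- The rules of the ZX-calculus, with their colour-swapped and upside-down versions. -/
inductive Rule : ∀ {I O : Type}, Diagram I O → Diagram I O → Prop
  /-- Two dots of the same colour joined by `k ≥ 1` wires are fused and their angles added. -/
  | S1 {I₁ O₁ I₂ O₂ : Type} [Fintype I₁] [Fintype O₁] [Fintype I₂] [Fintype O₂]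
      (α β : Real.Angle) (k : ℕ) (hk : 1 ≤ k) :
      Rule
        (ofDots ![(Z, α), (Z, β)] (Sum.elim (fun _ : I₁ => 0) (fun _ : I₂ => 1))
          (Sum.elim (fun _ : O₁ => 0) (fun _ : O₂ => 1)) (Multiset.replicate k s(0, 1)))
        (spider (I₁ ⊕ I₂) (O₁ ⊕ O₂) Z (α + β))
  /-- A dot with one input, one output and angle `0` is a plain wire. -/
  | S2 : Rule (spider (Fin 1) (Fin 1) Z 0) (identity (Fin 1))
  /-- A dot with no input, two outputs and angle `0` is a bent plain wire. -/
  | S3 : Rule (spider (Fin 0) (Fin 2) Z 0) cap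
  /-- Copy rule. -/
  | B1 : Rule (I := Fin 0) (O := Fin 2)
      (ofDots ![(Z, 0), (X, 0), (X, 0), (Z, 0)] ![] ![3, 3] {s(0, 1), s(2, 3)})
      (ofDots ![(X, 0), (X, 0)] ![] ![0, 1] 0)
  /-- Bialgebra rule. -/
  | B2 : Rule (I := Fin 2) (O := Fin 2)
      (ofDots ![(Z, 0), (X, 0), (Z, 0), (Z, 0), (X, 0), (X, 0)] ![2, 3] ![4, 5]
        {s(0, 1), s(2, 4), s(2, 5), s(3, 4), s(3, 5)})
      (ofDots ![(X, 0), (Z, 0)] ![0, 0] ![1, 1] {s(0, 1)})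
  /-- `π`-copy rule. -/
  | K1 : Rule (I := Fin 1) (O := Fin 2)
      (ofDots ![(X, (π : ℝ)), (Z, 0)] ![0] ![1, 1] {s(0, 1)})
      (ofDots ![(Z, 0), (X, (π : ℝ)), (X, (π : ℝ))] ![0] ![1, 2] {s(0, 1), s(0, 2)})
  /-- `π`-commutation rule. -/
  | K2 (α : Real.Angle) : Rule (I := Fin 1) (O := Fin 1)
      (ofDots ![(Z, 0), (X, 0), (X, (π : ℝ)), (Z, α)] ![2] ![3] {s(0, 1), s(2, 3)})
      (ofDots ![(Z, α), (X, (π : ℝ)), (Z, -α), (X, (π : ℝ))] ![2] ![3] {s(0, 1), s(2, 3)})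
  /-- Euler decomposition of the Hadamard box. -/
  | EU : Rule (hadamards (Fin 1))
      (ofDots ![(Z, 0), (X, 0), (Z, (-(π / 2) : ℝ)), (Z, (π / 2 : ℝ)), (X, (π / 2 : ℝ)),
          (Z, (π / 2 : ℝ))] ![3] ![5]
        {s(0, 1), s(0, 1), s(0, 1), s(3, 4), s(4, 5)})
  /-- Colour change: Hadamard boxes on all legs of a dot. -/
  | H {I O : Type} [Fintype I] [Fintype O] (α : Real.Angle) :
      Rule (((hadamards I).comp (spider I O Z α)).comp (hadamards O)) (spider I O X α)
  /-- Inverse rule for scalars. -/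
  | IV : Rule (I := Fin 0) (O := Fin 0)
      (ofDots ![(Z, 0), (X, 0), (Z, 0), (X, 0)] ![] ![] {s(0, 1), s(2, 3), s(2, 3), s(2, 3)})
      (identity (Fin 0))
  /-- Zero rule: in the presence of an isolated dot of angle `π`, a wire can be cut. -/
  | ZO : Rule ((spider (Fin 0) (Fin 0) Z (π : ℝ)).tensor (identity (Fin 1)))
      (ofDots ![(Z, ((π : ℝ) : Real.Angle)), (Z, 0), (X, 0)] (fun _ => 1) (fun _ => 2) 0)
  | colourSwap {I O : Type} {L R : Diagram I O} : Rule L R → Rule L.colourSwap R.colourSwap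
  | upsideDown {I O : Type} {L R : Diagram I O} : Rule L R → Rule L.upsideDown R.upsideDown

/-- A collection of additional equations between diagrams. -/
abbrev Equations : Type 1 := ∀ I O : Type, Diagram I O → Diagram I O → Prop

/-- `Derivable E D D'`: the equation `D = D'` can be derived in the ZX-calculus augmented with the
equations `E`, that is, `ZX + E ⊢ D = D'`. Only topology matters, and equations can be applied in
any context. -/
inductive Derivable (E : Equations) : ∀ {I O : Type}, Diagram I O → Diagram I O → Prop
  | rule {I O : Type} {D D' : Diagram I O} : Rule D D' → Derivable E D D'
  | extra {I O : Type} {D D' : Diagram I O} : E I O D D' → Derivable E D D'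
  | iso {I O : Type} {D D' : Diagram I O} : D.Iso D' → Derivable E D D'
  | subdivides {I O : Type} {D D' : Diagram I O} : D.Subdivides D' → Derivable E D D'
  | refl {I O : Type} (D : Diagram I O) : Derivable E D D
  | symm {I O : Type} {D D' : Diagram I O} : Derivable E D D' → Derivable E D' D
  | trans {I O : Type} {D D' D'' : Diagram I O} :
      Derivable E D D' → Derivable E D' D'' → Derivable E D D''
  | tensor {I₁ O₁ I₂ O₂ : Type} {D₁ D₁' : Diagram I₁ O₁} {D₂ D₂' : Diagram I₂ O₂} :
      Derivable E D₁ D₁' → Derivable E D₂ D₂' → Derivable E (D₁.tensor D₂) (D₁'.tensor D₂')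
  | comp {I M O : Type} [Finite M] {D₁ D₁' : Diagram I M} {D₂ D₂' : Diagram M O} :
      Derivable E D₁ D₁' → Derivable E D₂ D₂' → Derivable E (D₁.comp D₂) (D₁'.comp D₂')

/-! ### Supplementarity and antiphase twins -/

/-- Left-hand side of supplementarity: two green dots of angles `α` and `α + π`, each with a single
leg, both attached to a red dot which carries the output. -/
noncomputable def suppLeft (α : Real.Angle) : Diagram (Fin 0) (Fin 1) :=
  ofDots ![(Z, α), (Z, α + (π : ℝ)), (X, 0)] ![] ![2] {s(0, 2), s(1, 2)}

/-- Right-hand side of supplementarity: a green dot of angle `2α + π`, attached by two parallel wires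
to a red dot which carries the output. -/
noncomputable def suppRight (α : Real.Angle) : Diagram (Fin 0) (Fin 1) :=
  ofDots ![(Z, α + α + (π : ℝ)), (X, 0)] ![] ![1] {s(0, 1), s(0, 1)}

/-- The dots `u` and `v` of `D`, of angles `α` and `β`, are antiphase twins: they have the same
colour `c`, their angles differ by `π`, and every other vertex, input or output is joined to `u` and
to `v` by the same number of wires. Wires between `u` and `v` are allowed. The condition refers to
the diagram as drawn, so a marked point on a wire at `u` or `v` counts as a vertex here; nothing is
lost, since marked points can be removed from `D` beforehand. -/
structure AntiphaseTwins {I O : Type} (D : Diagram I O) (u v : D.V) (c : Colour)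
    (α β : Real.Angle) : Prop where
  label_left : D.label u = .dot c α
  label_right : D.label v = .dot c β
  antiphase : β - α = (π : ℝ)
  same_neighbourhood : ∀ w : D.V ⊕ (I ⊕ O), w ≠ .inl u → w ≠ .inl v →
    wireCount D.wires (.inl u) w = wireCount D.wires (.inl v) w

theorem AntiphaseTwins.ne {I O : Type} {D : Diagram I O} {u v : D.V} {c : Colour}
    {α β : Real.Angle} (h : AntiphaseTwins D u v c α β) : u ≠ v := by
  rintro rfl
  have hαβ : α = β := by
    have := h.label_left.symm.trans h.label_right
    injection this
  have := h.antiphase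
  rw [hαβ, sub_self] at this
  exact Real.Angle.pi_ne_zero this.symm

namespace Diagram

/-- The end points after the merge of the nodes `u` and `v`: the node `v` is identified with `u`. -/
noncomputable def mergePoint {V P : Type} {u v : V} (h : u ≠ v) : V ⊕ P → {w : V // w ≠ v} ⊕ P
  | .inl w => by classical exact if hw : w = v then .inl ⟨u, h⟩ else .inl ⟨w, hw⟩
  | .inr p => .inr p

/-- The diagram in which the nodes `u` and `v` have been merged into one dot of colour `c` and angle
`γ`: the wires between `u` and `v` disappear, and all other wires are kept, those that ended at `u`
or `v` now ending at the new dot. -/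
noncomputable def merge {I O : Type} (D : Diagram I O) {u v : D.V} (h : u ≠ v) (c : Colour)
    (γ : Real.Angle) : Diagram I O where
  V := {w : D.V // w ≠ v}
  finite := by have := D.finite; infer_instance
  label w := by classical exact if (w : D.V) = u then .dot c γ else D.label w
  wires := (by classical exact D.wires.filter (· ≠ s(.inl u, .inl v)) :
    Multiset (Sym2 (D.V ⊕ (I ⊕ O)))).map (Sym2.map (mergePoint h))
  degree_binary := by
    classical
    rintro ⟨w, hwv⟩ hw
    by_cases hwu : w = u
    · simp [hwu, Node.IsBinary] at hw
    · rw [if_neg hwu] at hw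
      have h₁ : (.inl ⟨w, hwv⟩ : {w : D.V // w ≠ v} ⊕ (I ⊕ O)) = mergePoint h (.inl w) := by
        simp [mergePoint, hwv]
      rw [h₁, degree_map_eq, ← D.degree_binary w hw]
      · convert degree_filter_ne D.wires s(.inl u, .inl v) (.inl w) ?_
        simp [hwu, hwv]
      · rintro (y | y)
        · simp only [mergePoint, dif_neg hwv]
          split_ifs with hy
          · simp [Ne.symm hwu]
          · simp
        · simp [mergePoint, hwv]
  degree_port p := by
    classical
    have h₁ : (.inr p : {w : D.V // w ≠ v} ⊕ (I ⊕ O)) = mergePoint h (.inr p) := rfl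
    rw [h₁, degree_map_eq, ← D.degree_port p]
    · convert degree_filter_ne D.wires s(.inl u, .inl v) (.inr p) ?_
      simp
    · rintro (y | y)
      · simp only [mergePoint]
        split_ifs <;> simp
      · simp [mergePoint]

end Diagram

/-- In the ZX-calculus augmented with the equations `E`, supplementarity holds for all angles. -/
def Supplementarity (E : Equations) : Prop :=
  ∀ α : Real.Angle, Derivable E (suppLeft α) (suppRight α)

/-- In the ZX-calculus augmented with the equations `E`, antiphase twins can be merged: any two
antiphase twins in any diagram can be replaced by a single dot of the same colour with the sum of
the two angles. -/
def AntiphaseTwinsMerge (E : Equations) : Prop :=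
  ∀ (I O : Type) (D : Diagram I O) (u v : D.V) (c : Colour) (α β : Real.Angle)
    (h : AntiphaseTwins D u v c α β), Derivable E D (D.merge h.ne c (α + β))

end ZX

namespace ZX

open Diagram Colour

/-! ### Multisets of wires -/

/-! From merging to supplementarity: the two green dots on the left of supplementarity are antiphase
twins, and merging them gives the right-hand side up to isomorphism
(`AntiphaseTwinsMerge.supplementarity`).

Conversely, let `x` and `y` be twins of colour `c`. If some wire joins them, fusion (S1) merges
them. Otherwise loops are removed, and `x` and `y` have the same multiset `C` of neighbours.
Supplementarity handles only the case where the sole common neighbour is a dot of the other colour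
with angle `0`, so the situation has to be reduced to that one. The copy rule creates such a dot,
the hub, joined to `x`, to `y` and to an auxiliary dot of colour `c` and angle `0`
(`Eqv.start_hub`). The members of `C` are then dealt with by induction on their number
(`Eqv.hub_merge`): * a dot of colour `c.swap` forms, with the hub and with pieces of `x` and `y`, a
complete bipartite graph; the bialgebra rule replaces it by a new hub and hangs the neighbour on the
auxiliary dot instead (`Eqv.hub_dot_swap`); * a Hadamard box is split by the Euler rule; the outer
dots add `π/2` to each twin, which keeps their difference, and the middle dot falls under the
previous case (`Eqv.hub_hadamard`); * a dot of colour `c` absorbs both twins, and likewise absorbs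
the merged dot; * a marked point is a wire between the twins, so fusion applies; * an input or
output carries only one wire, so it cannot be a neighbour of both.

When `C` is empty, supplementarity merges `x` and `y`, and the moves are undone around the merged
dot. For this reason the hub is set up for end points `x`, `y` that may coincide. Red twins need
supplementarity with the colours exchanged, which follows from (H) (`supplementarity_red`). Besides
(H), only S1, B1, B2, EU and IV are used.

Derivability is closed under `⊗` and `∘` only, while the argument rewrites inside arbitrary graphs.
Bending the inputs of a subdiagram and erasing the marked points left by composition shows that
equations apply in every graph context (`Eqv.plug_of_derivable`). Graphs are handled as nets,
without degree conditions; `Eqv` records that both sides are well-formed or neither is, so that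
intermediate nets can be written down without checking degrees. -/

theorem univ_val_map {ι A : Type} [Fintype ι] (f : ι → A) :
    (Finset.univ : Finset ι).val.map f = ∑ i, ({f i} : Multiset A) := by
  change _ = (Finset.univ.val.map fun i => ({f i} : Multiset A)).sum
  rw [← Multiset.sum_map_singleton (Finset.univ.val.map f), Multiset.map_map]
  rfl

theorem map_fsum {ι A B : Type} [Fintype ι] (f : A → B) (m : ι → Multiset A) :
    (∑ i, m i).map f = ∑ i, (m i).map f :=
  map_sum (Multiset.mapAddMonoidHom f) m Finset.univ

theorem degree_zero {P : Type} (x : P) : degree (0 : Multiset (Sym2 P)) x = 0 := by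
  simp [degree]

open Classical in
/-- The number `1` if `p` holds and `0` otherwise. -/
noncomputable def ind (p : Prop) : ℕ := if p then 1 else 0

@[simp] theorem ind_true : ind True = 1 := if_pos trivial

@[simp] theorem ind_false : ind False = 0 := if_neg id

theorem ind_pos {p : Prop} (h : p) : ind p = 1 := if_pos h

theorem ind_neg {p : Prop} (h : ¬p) : ind p = 0 := if_neg h

@[simp] theorem sum_ind_eq {ι : Type} [Fintype ι] (i : ι) : ∑ j, ind (i = j) = 1 := by
  classical
  simp [ind]

theorem degree_singleton {P : Type} (a b x : P) : degree {s(a, b)} x = ind (x = a) + ind (x = b) := by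
  classical
  have h : (s(a, b) : Sym2 P).toMultiset = a ::ₘ {b} := rfl
  simp only [degree, Multiset.singleton_bind, h, Multiset.count_cons, Multiset.count_singleton]
  rw [add_comm]
  rfl

theorem degree_fsum {P ι : Type} [Fintype ι] (m : ι → Multiset (Sym2 P)) (x : P) :
    degree (∑ i, m i) x = ∑ i, degree (m i) x := by
  classical
  have key : ∀ s : Finset ι, degree (∑ i ∈ s, m i) x = ∑ i ∈ s, degree (m i) x := by
    intro s
    induction s using Finset.induction_on with
    | empty => simp [degree_zero]
    | insert a s ha ih => rw [Finset.sum_insert ha, Finset.sum_insert ha, degree_add, ih]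
  exact key _

theorem degree_eq_zero_iff {P : Type} {W : Multiset (Sym2 P)} {x : P} :
    degree W x = 0 ↔ ∀ e ∈ W, x ∉ e := by
  classical
  simp only [degree, Multiset.count_eq_zero, Multiset.mem_bind, Sym2.mem_toMultiset]
  push Not
  rfl

/-- The multiset of wire ends. -/
def ends {P : Type} (W : Multiset (Sym2 P)) : Multiset P := W.bind Sym2.toMultiset

theorem degree_eq_count {P : Type} [inst : DecidableEq P] (W : Multiset (Sym2 P)) (x : P) :
    degree W x = (ends W).count x := by
  obtain rfl : inst = fun a b => Classical.propDecidable (a = b) := Subsingleton.elim _ _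
  rfl

theorem mem_ends_of_degree_ne_zero {P : Type} {W : Multiset (Sym2 P)} {x : P}
    (h : degree W x ≠ 0) : x ∈ ends W := by
  classical
  by_contra hn
  exact h (by rw [degree_eq_count, Multiset.count_eq_zero]; exact hn)

theorem ends_map {P Q : Type} (f : P → Q) (W : Multiset (Sym2 P)) :
    ends (W.map (Sym2.map f)) = (ends W).map f := by
  rw [ends, ends, Multiset.bind_map, Multiset.map_bind]
  exact Multiset.bind_congr fun e _ => toMultiset_map f e

theorem exists_sum_split {A B : Type} (m : Multiset (A ⊕ B)) :
    ∃ (a : Multiset A) (b : Multiset B), m = a.map .inl + b.map .inr := by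
  induction m using Multiset.induction_on with
  | empty => exact ⟨0, 0, rfl⟩
  | cons x m ih =>
    obtain ⟨a, b, rfl⟩ := ih
    rcases x with x | x
    · exact ⟨x ::ₘ a, b, by simp⟩
    · exact ⟨a, x ::ₘ b, by simp⟩

/-- Used to drop a node from the type of end points once its wires have been accounted for. -/
theorem exists_eq_map_of_degree_eq_zero {P Q : Type} (f : Q → P) (W : Multiset (Sym2 P))
    (h : ∀ x, (∀ y, f y ≠ x) → degree W x = 0) :
    ∃ W' : Multiset (Sym2 Q), W = W'.map (Sym2.map f) := by
  have h' : ∀ e ∈ W, ∃ e' : Sym2 Q, Sym2.map f e' = e := by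
    intro e he
    have hx : ∀ x ∈ e, ∃ y, f y = x := by
      intro x hx
      by_contra! hn
      exact degree_eq_zero_iff.1 (h x hn) e he hx
    induction e with
    | _ a b =>
      obtain ⟨a', ha⟩ := hx a (by simp)
      obtain ⟨b', hb⟩ := hx b (by simp)
      exact ⟨s(a', b'), by simp [ha, hb]⟩
  clear h
  induction W using Multiset.induction_on with
  | empty => exact ⟨0, rfl⟩
  | cons e W ih =>
    obtain ⟨W', hW'⟩ := ih fun e he => h' e (Multiset.mem_cons_of_mem he)
    obtain ⟨e', he'⟩ := h' e (Multiset.mem_cons_self _ _)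
    exact ⟨e' ::ₘ W', by rw [Multiset.map_cons, he', ← hW']⟩

/-! ### Nets -/

/-- A diagram without the conditions on the degrees. -/
structure Net (P : Type) where
  /-- the nodes -/
  V : Type
  /-- the kind of each node -/
  label : V → Node
  /-- the wires, with multiplicity -/
  wires : Multiset (Sym2 (V ⊕ P))

/-- The conditions on the degrees that make a net a diagram. -/
structure Net.WF {P : Type} (N : Net P) : Prop where
  finite : Finite N.V
  degree_binary : ∀ v, (N.label v).IsBinary → degree N.wires (.inl v) = 2
  degree_port : ∀ p, degree N.wires (.inr p) = 1

/-- Every port has degree one, hence occurs among the ends of a finite multiset of wires. Thus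
finiteness of the sets of inputs and outputs need not be assumed anywhere. -/
theorem Net.WF.finite_port {P : Type} {N : Net P} (h : N.WF) : Finite P := by
  classical
  have hmem : ∀ p : P, (.inr p : N.V ⊕ P) ∈ ends N.wires := fun p =>
    mem_ends_of_degree_ne_zero (by rw [h.degree_port p]; exact one_ne_zero)
  refine Finite.of_injective (β := (ends N.wires).toFinset)
    (fun p => ⟨.inr p, Multiset.mem_toFinset.2 (hmem p)⟩) ?_
  intro p q hpq
  simpa using hpq

/-- A net with the right degrees is a diagram. -/
def Net.toDiagram {I O : Type} (N : Net (I ⊕ O)) (h : N.WF) : Diagram I O :=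
  ⟨N.V, h.finite, N.label, N.wires, h.degree_binary, h.degree_port⟩

/-- The net underlying a diagram. -/
def Diagram.net {I O : Type} (D : Diagram I O) : Net (I ⊕ O) := ⟨D.V, D.label, D.wires⟩

theorem Diagram.net_wf {I O : Type} (D : Diagram I O) : D.net.WF :=
  ⟨D.finite, D.degree_binary, D.degree_port⟩

/-- Two nets are both diagrams or both not, and in the former case their equality is derivable. -/
def Eqv (E : Equations) {I O : Type} (N N' : Net (I ⊕ O)) : Prop :=
  (N.WF ↔ N'.WF) ∧ ∀ h h', Derivable E (N.toDiagram h) (N'.toDiagram h')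

variable {E : Equations} {I O : Type}

theorem Eqv.refl (N : Net (I ⊕ O)) : Eqv E N N := ⟨Iff.rfl, fun _ _ => .refl _⟩

theorem Eqv.symm {N N' : Net (I ⊕ O)} (h : Eqv E N N') : Eqv E N' N :=
  ⟨h.1.symm, fun a b => (h.2 b a).symm⟩

theorem Eqv.trans {N N' N'' : Net (I ⊕ O)} (h : Eqv E N N') (h' : Eqv E N' N'') : Eqv E N N'' :=
  ⟨h.1.trans h'.1, fun a b => (h.2 a (h.1.1 a)).trans (h'.2 _ b)⟩

theorem Eqv.of_derivable {D D' : Diagram I O} (h : Derivable E D D') : Eqv E D.net D'.net :=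
  ⟨⟨fun _ => D'.net_wf, fun _ => D.net_wf⟩, fun _ _ => h⟩

theorem Eqv.derivable {D D' : Diagram I O} (h : Eqv E D.net D'.net) : Derivable E D D' :=
  h.2 D.net_wf D'.net_wf

theorem degree_map_injective {P Q : Type} {f : P → Q} (hf : f.Injective) (W : Multiset (Sym2 P))
    (x : P) : degree (W.map (Sym2.map f)) (f x) = degree W x :=
  degree_map_eq f W x fun _ h => hf h

theorem Net.WF.map {P : Type} {N N' : Net P} (h : N.WF) (f : N.V ≃ N'.V)
    (hl : ∀ v, N'.label (f v) = N.label v)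
    (hW : N'.wires = N.wires.map (Sym2.map (Sum.map f id))) : N'.WF := by
  have hinj : (Sum.map f (id : P → P)).Injective := f.injective.sumMap Function.injective_id
  refine ⟨have := h.finite; Finite.of_equiv _ f, fun v hv => ?_, fun p => ?_⟩
  · obtain ⟨v, rfl⟩ := f.surjective v
    rw [hl] at hv
    rw [hW, ← h.degree_binary v hv]
    exact degree_map_injective hinj N.wires (.inl v)
  · rw [hW, ← h.degree_port p]
    exact degree_map_injective hinj N.wires (.inr p)

theorem sumMap_symm {V V' P : Type} (f : V ≃ V') :
    Sum.map f.symm (id : P → P) ∘ Sum.map f id = id := by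
  funext x; rcases x with x | x <;> simp

theorem Eqv.iso {N N' : Net (I ⊕ O)} (f : N.V ≃ N'.V) (hl : ∀ v, N'.label (f v) = N.label v)
    (hW : N'.wires = N.wires.map (Sym2.map (Sum.map f id))) : Eqv E N N' := by
  refine ⟨⟨fun h => h.map f hl hW, fun h => h.map f.symm (fun v => ?_) ?_⟩, fun _ _ =>
    .iso ⟨f, hl, hW⟩⟩
  · rw [← hl, f.apply_symm_apply]
  · rw [hW, Multiset.map_map, ← Sym2.map_comp, sumMap_symm]
    simp

/-! ### Contraction of marked points -/

/-- The map on end points that replaces each node in `J` by the end point `g`. -/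
def replaceBy {V J P : Type} (g : J → V ⊕ P) : (V ⊕ J) ⊕ P → V ⊕ P :=
  Sum.elim (Sum.elim Sum.inl g) Sum.inr

/-- The inclusion of end points for an inclusion of nodes. -/
def leftPt {V J P : Type} : V ⊕ P → (V ⊕ J) ⊕ P := Sum.map Sum.inl id

theorem leftPt_injective {V J P : Type} : (leftPt : V ⊕ P → (V ⊕ J) ⊕ P).Injective :=
  Sum.inl_injective.sumMap Function.injective_id

@[simp] theorem replaceBy_leftPt {V J P : Type} (g : J → V ⊕ P) (x : V ⊕ P) :
    replaceBy g (leftPt x) = x := by rcases x with x | x <;> rfl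

theorem replaceBy_comp_leftPt {V J P : Type} (g : J → V ⊕ P) :
    replaceBy g ∘ leftPt = id := by funext x; simp

/-- A type with one more element, as a disjoint union. -/
def optionEquiv (V : Type) : Option V ≃ V ⊕ Unit where
  toFun v := v.elim (.inr ()) .inl
  invFun := Sum.elim some fun _ => none
  left_inv v := by cases v <;> rfl
  right_inv v := by rcases v with v | v <;> rfl

/-- Since `z` is not the marked point itself, degree two leaves exactly one more wire there, with
its other end elsewhere. The left-hand net is therefore a subdivision of the right-hand one. -/
theorem Eqv.contract_one {V : Type} {l : V → Node} {W : Multiset (Sym2 ((V ⊕ Unit) ⊕ (I ⊕ O)))}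
    (z : V ⊕ (I ⊕ O))
    (hWF : Net.WF ⟨V ⊕ Unit, Sum.elim l fun _ => .joint,
      s(.inl (.inr ()), leftPt z) ::ₘ W⟩) :
    Eqv E ⟨V ⊕ Unit, Sum.elim l fun _ => .joint, s(.inl (.inr ()), leftPt z) ::ₘ W⟩
      ⟨V, l, W.map (Sym2.map (replaceBy fun _ => z))⟩ := by
  classical
  have hz : leftPt z ≠ (.inl (.inr ()) : (V ⊕ Unit) ⊕ (I ⊕ O)) := by
    rcases z with z | z <;> simp [leftPt]
  have h2 := hWF.degree_binary (.inr ()) trivial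
  simp only [← Multiset.singleton_add, degree_add, degree_singleton, ind_neg hz.symm, ind_true] at h2
  have h1 : degree W (.inl (.inr ())) = 1 := by
    omega
  obtain ⟨e, he, hje⟩ : ∃ e ∈ W, (.inl (.inr ()) : (V ⊕ Unit) ⊕ (I ⊕ O)) ∈ e := by
    by_contra! hn
    rw [degree_eq_zero_iff.2 hn] at h1
    simp at h1
  obtain ⟨W, rfl⟩ := Multiset.exists_cons_of_mem he
  obtain ⟨x, rfl⟩ := hje
  simp only [← Multiset.singleton_add, degree_add, degree_singleton] at h1
  have hx : x ≠ .inl (.inr ()) := by rintro rfl; simp at h1; omega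
  obtain ⟨x, rfl⟩ : ∃ x', leftPt x' = x := by
    rcases x with (x | x) | x
    · exact ⟨.inl x, rfl⟩
    · exact absurd rfl hx
    · exact ⟨.inr x, rfl⟩
  have h0 : degree W (.inl (.inr ())) = 0 := by
    simpa [ind_neg hx.symm] using h1
  obtain ⟨W, rfl⟩ := exists_eq_map_of_degree_eq_zero leftPt W (by
    rintro ((y | y) | y) hy
    · exact absurd rfl (hy (.inl y))
    · exact h0
    · exact absurd rfl (hy (.inr y)))
  have hN : (s(.inl (.inr ()), leftPt x) ::ₘ W.map (Sym2.map leftPt)).map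
      (Sym2.map (replaceBy fun _ => z)) = s(x, z) ::ₘ W := by
    rw [Multiset.map_cons, Multiset.map_map, ← Sym2.map_comp, replaceBy_comp_leftPt]
    rw [Sym2.map_mk, replaceBy_leftPt, Sym2.eq_swap]
    simp [replaceBy]
  rw [hN]
  have hsub : (s(.inl (.inr ()), leftPt z) ::ₘ s(.inl (.inr ()), leftPt x) ::ₘ
      W.map (Sym2.map leftPt) : Multiset (Sym2 ((V ⊕ Unit) ⊕ (I ⊕ O)))) =
      s(leftPt x, .inl (.inr ())) ::ₘ s(.inl (.inr ()), leftPt z) ::ₘ W.map (Sym2.map leftPt) := by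
    rw [Multiset.cons_swap, Sym2.eq_swap]
  refine ⟨⟨fun h => ?_, fun _ => hWF⟩, fun h h' => .symm (.subdivides
    ⟨optionEquiv V, x, z, W, rfl, fun _ => rfl, rfl, hsub⟩)⟩
  · have key : ∀ y : V ⊕ (I ⊕ O), degree (s(x, z) ::ₘ W) y = degree (s(.inl (.inr ()), leftPt z) ::ₘ
        s(.inl (.inr ()), leftPt x) ::ₘ W.map (Sym2.map leftPt)) (leftPt y) := by
      intro y
      have hy : leftPt y ≠ (.inl (.inr ()) : (V ⊕ Unit) ⊕ (I ⊕ O)) := by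
        rcases y with y | y <;> simp [leftPt]
      simp only [← Multiset.singleton_add, degree_add, degree_singleton, ind_neg hy,
        degree_map_injective leftPt_injective, leftPt_injective.eq_iff]
      omega
    refine ⟨have := h.finite; Finite.of_injective (Sum.inl : V → V ⊕ Unit) Sum.inl_injective,
      fun v hv => ?_, fun p => ?_⟩
    · exact (key _).trans (h.degree_binary (.inl v) hv)
    · exact (key _).trans (h.degree_port p)

theorem map_sym2_comp {A B C : Type} (g : B → C) (f : A → B) (W : Multiset (Sym2 A)) :
    (W.map (Sym2.map f)).map (Sym2.map g) = W.map (Sym2.map fun x => g (f x)) := by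
  rw [Multiset.map_map, ← Sym2.map_comp]; rfl

theorem map_sym2_congr {A B : Type} {f g : A → B} (h : ∀ x, f x = g x) (W : Multiset (Sym2 A)) :
    W.map (Sym2.map f) = W.map (Sym2.map g) := by
  rw [funext h]

/-- The net on `V` and a family `J` of marked points, with a wire from each `j` to `z j`. -/
abbrev jointNet {V J P : Type} [Fintype J] (l : V → Node) (z : J → (V ⊕ J) ⊕ P)
    (W : Multiset (Sym2 ((V ⊕ J) ⊕ P))) : Net P :=
  ⟨V ⊕ J, Sum.elim l fun _ => .joint, ∑ j, {s(.inl (.inr j), z j)} + W⟩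

/-- A family `J` of marked points, each of which has a wire to `z j`, where `z` is acyclic, can be
removed. -/
def Contractible (E : Equations) (I O J : Type) [Fintype J] : Prop :=
  ∀ {V : Type} {l : V → Node} (z : J → (V ⊕ J) ⊕ (I ⊕ O)) (rank : J → ℕ) (g : J → V ⊕ (I ⊕ O))
    (W : Multiset (Sym2 ((V ⊕ J) ⊕ (I ⊕ O)))),
    (∀ j j', z j = .inl (.inr j') → rank j' < rank j) → (∀ j, replaceBy g (z j) = g j) →
    (jointNet l z W).WF → Eqv E (jointNet l z W) ⟨V, l, W.map (Sym2.map (replaceBy g))⟩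

/-- Induction on the number of marked points. The rank excludes cycles of designated wires, which
would be closed circles and could not be contracted away. -/
theorem Eqv.contract (J : Type) [Fintype J] : Contractible E I O J := by
  refine Fintype.induction_empty_option (P := fun J _ => Contractible E I O J) ?_ ?_ ?_ J
  · intro α β _ e ih V l z rank g W hrank hg hWF
    let := Fintype.ofEquiv β e.symm
    let r : (V ⊕ β) ⊕ (I ⊕ O) → (V ⊕ α) ⊕ (I ⊕ O) := Sum.map (Sum.map id e.symm) id
    have hr : ∀ x, replaceBy (fun j => g (e j)) (r x) = replaceBy g x := by
      rintro ((x | x) | x) <;> simp [replaceBy, r]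
    have h1 : Eqv E (jointNet l z W)
        (jointNet l (fun j => r (z (e j))) (W.map (Sym2.map r))) := by
      refine Eqv.iso (Equiv.sumCongr (Equiv.refl V) e.symm) ?_ ?_
      · rintro (v | v) <;> rfl
      · have hs : (∑ j, {s(.inl (.inr j), z j)} : Multiset (Sym2 ((V ⊕ β) ⊕ (I ⊕ O)))) =
            ∑ j, {s(.inl (.inr (e j)), z (e j))} := (Equiv.sum_comp e _).symm
        change _ = (∑ j, {s(.inl (.inr j), z j)} + W).map (Sym2.map r)
        rw [hs, Multiset.map_add, map_fsum]
        refine congrArg (· + W.map (Sym2.map r)) ?_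
        refine Finset.sum_congr rfl fun j _ => ?_
        simp [r]
    have h2 := ih (l := l) (fun j => r (z (e j))) (fun j => rank (e j)) (fun j => g (e j))
      (W.map (Sym2.map r)) (fun j j' hj => hrank _ _ ?_) (fun j => (hr _).trans (hg _)) (h1.1.1 hWF)
    · rw [map_sym2_comp, map_sym2_congr hr] at h2
      exact h1.trans h2
    · rcases hz : z (e j) with (x | x) | x <;> simp [hz, r] at hj
      simp [← hj]
  · intro V l z rank g W hrank hg hWF
    refine Eqv.iso (Equiv.sumEmpty V _) ?_ ?_
    · rintro (v | v)
      · rfl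
      · exact v.elim
    · simp only [Finset.univ_eq_empty, Finset.sum_empty, zero_add]
      exact map_sym2_congr (by
        rintro ((x | x) | x)
        · rfl
        · exact x.elim
        · rfl) W
  -- The point `none` is contracted first. Its designated wire does not lead back to itself, because
  -- the rank would have to drop, so its target lies in the smaller net.
  · intro J _ ih V l z rank g W hrank hg hWF
    let κ : (V ⊕ Option J) ≃ (V ⊕ J) ⊕ Unit :=
      (Equiv.sumCongr (Equiv.refl V) (optionEquiv J)).trans (Equiv.sumAssoc V J Unit).symm
    let κ' : (V ⊕ Option J) ⊕ (I ⊕ O) → ((V ⊕ J) ⊕ Unit) ⊕ (I ⊕ O) := Sum.map κ id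
    obtain ⟨z₀, hz₀⟩ : ∃ z₀, κ' (z none) = leftPt z₀ := by
      rcases hz : z none with (x | x) | x
      · exact ⟨.inl (.inl x), rfl⟩
      · cases x with
        | none => exact absurd (hrank _ _ hz) (lt_irrefl _)
        | some x => exact ⟨.inl (.inr x), rfl⟩
      · exact ⟨.inr x, rfl⟩
    have hz₁ : replaceBy (fun j => g (some j)) z₀ = g none := by
      rw [← hg none]
      revert hz₀
      rcases z none with (x | _ | x) | x <;> rcases z₀ with (y | y) | y <;> intro h <;> cases h <;>
        rfl
    have h1 : Eqv E (jointNet l z W) ⟨(V ⊕ J) ⊕ Unit, Sum.elim (Sum.elim l fun _ => .joint)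
        fun _ => .joint, s(.inl (.inr ()), leftPt z₀) ::ₘ
          (∑ j, {s(.inl (.inr (some j)), z (some j))} + W).map (Sym2.map κ')⟩ := by
      refine Eqv.iso κ ?_ ?_
      · rintro (v | _ | v) <;> rfl
      · change _ = (∑ j, {s(.inl (.inr j), z j)} + W).map (Sym2.map κ')
        rw [Fintype.sum_option, add_assoc, Multiset.singleton_add, Multiset.map_cons, ← hz₀]
        rfl
    have h2 := h1.trans (Eqv.contract_one z₀ (h1.1.1 hWF))
    let τ : (V ⊕ Option J) ⊕ (I ⊕ O) → (V ⊕ J) ⊕ (I ⊕ O) := fun x => replaceBy (fun _ => z₀) (κ' x)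
    have hτ : ∀ x, replaceBy (fun j => g (some j)) (τ x) = replaceBy g x := by
      rintro ((x | _ | x) | x)
      · rfl
      · exact hz₁
      · rfl
      · rfl
    rw [map_sym2_comp, Multiset.map_add, map_fsum] at h2
    have h3 := ih (l := l) (fun j => τ (z (some j))) (fun j => rank (some j)) (fun j => g (some j))
      (W.map (Sym2.map τ)) ?_ (fun j => (hτ _).trans (hg _)) (h2.1.1 hWF)
    · rw [map_sym2_comp, map_sym2_congr hτ] at h3
      exact h2.trans h3
    · intro j j' hj
      rcases hz : z (some j) with (x | _ | x) | x <;> rw [hz] at hj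
      · cases hj
      -- A point that led to `none` now leads where `none` led, and the rank has dropped twice.
      · have hz' : z none = .inl (.inr (some j')) := by
          change z₀ = _ at hj
          rw [hj] at hz₀
          rcases hz : z none with (x | _ | x) | x <;> rw [hz] at hz₀ <;> cases hz₀
          rfl
        exact (hrank _ _ hz').trans (hrank _ _ hz)
      · cases hj
        exact hrank _ _ hz
      · cases hj

/-! ### Diagrams in a context -/

/-- The inclusion of end points of a context. -/
def rightPt {V J P : Type} : J ⊕ P → (V ⊕ J) ⊕ P := Sum.map Sum.inr id

theorem rightPt_injective {V J P : Type} : (rightPt : J ⊕ P → (V ⊕ J) ⊕ P).Injective :=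
  Sum.inr_injective.sumMap Function.injective_id

/-- The map on end points of a net, when its ports are attached to the end points `a` of a
context. -/
def plugPt {V J P Q : Type} (a : Q → J ⊕ P) : V ⊕ Q → (V ⊕ J) ⊕ P :=
  Sum.elim (fun v => .inl (.inl v)) fun q => rightPt (a q)

/-- The net `L` in a context with nodes `J` and wires `W`, in which the port `q` of `L` is attached
to `a q`. -/
abbrev plug {P Q : Type} (L : Net Q) {J : Type} (l : J → Node) (a : Q → J ⊕ P)
    (W : Multiset (Sym2 (J ⊕ P))) : Net P :=
  ⟨L.V ⊕ J, Sum.elim L.label l,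
    L.wires.map (Sym2.map (plugPt a)) + W.map (Sym2.map rightPt)⟩

/-- Each port of a well-formed net is the end of exactly one wire, so the wires of `L` contribute to
the outside only through the attachment map `a`, whatever `L` is inside. -/
theorem degree_map_ports {P Q : Type} [Fintype Q] {L : Net Q} (hL : L.WF) (F : L.V → P) (a : Q → P)
    (x : P) (hx : ∀ v, F v ≠ x) :
    degree (L.wires.map (Sym2.map (Sum.elim F a))) x = ∑ q, ind (x = a q) := by
  classical
  obtain ⟨A, B, hAB⟩ := exists_sum_split (ends L.wires)
  have hB : B = Finset.univ.val := by
    ext q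
    have h1 := hL.degree_port q
    rw [degree_eq_count, hAB, Multiset.count_add, Multiset.count_map_eq_count' _ _ Sum.inr_injective,
      Multiset.count_eq_zero_of_notMem (by simp), zero_add] at h1
    rw [h1, Multiset.count_eq_one_of_mem Finset.univ.nodup (Finset.mem_univ_val q)]
  rw [degree_eq_count, ends_map, hAB, hB, Multiset.map_add, Multiset.count_add,
    Multiset.map_map, Multiset.map_map, Multiset.count_eq_zero_of_notMem (by simpa using fun v _ => hx v),
    zero_add, univ_val_map, Multiset.count_sum']
  simp [Multiset.count_singleton, ind]

theorem degree_plug {P Q : Type} [Fintype Q] {L : Net Q} (hL : L.WF) {J : Type} (l : J → Node)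
    (a : Q → J ⊕ P) (W : Multiset (Sym2 (J ⊕ P))) (x : J ⊕ P) :
    degree (plug L l a W).wires (rightPt x) = (∑ q, ind (x = a q)) + degree W x := by
  have h1 := degree_map_ports hL (fun v => (.inl (.inl v) : (L.V ⊕ J) ⊕ P)) (fun q => rightPt (a q))
    (rightPt x) (by rcases x with x | x <;> simp [rightPt])
  simp only [rightPt_injective.eq_iff] at h1
  rw [← h1, ← degree_map_injective (rightPt_injective (V := L.V)) W x, ← degree_add]
  rfl

/-- The degrees at the nodes of the context depend on the plugged net only through its ports, each
of degree one, and the degrees at its own nodes are unchanged by plugging. -/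
theorem plug_wf {P Q : Type} {L R : Net Q} (hL : L.WF) (hR : R.WF) {J : Type} {l : J → Node}
    {a : Q → J ⊕ P} {W : Multiset (Sym2 (J ⊕ P))} (h : (plug L l a W).WF) : (plug R l a W).WF := by
  have := hL.finite_port
  have := Fintype.ofFinite Q
  have key : ∀ x, degree (plug R l a W).wires (rightPt x) =
      degree (plug L l a W).wires (rightPt x) := fun x => by
    rw [degree_plug hL, degree_plug hR]
  refine ⟨?_, ?_, fun p => ?_⟩
  · have := hR.finite
    have : Finite (L.V ⊕ J) := h.finite
    have : Finite J := Finite.of_injective (Sum.inr : J → L.V ⊕ J) Sum.inr_injective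
    exact inferInstanceAs (Finite (R.V ⊕ J))
  · rintro (v | v) hv
    · have h1 : degree (R.wires.map (Sym2.map (plugPt a))) (plugPt (P := P) a (.inl v)) =
          degree R.wires (.inl v) := degree_map_eq _ _ _ (by
        rintro (y | y)
        · simp [plugPt]
        · rcases ha : a y <;> simp [plugPt, rightPt, ha])
      have h2 : degree (W.map (Sym2.map rightPt)) (plugPt (V := R.V) (P := P) a (.inl v)) = 0 :=
        degree_map_eq_zero _ _ _ (by rintro (y | y) <;> simp [plugPt, rightPt])
      have h3 := degree_add (R.wires.map (Sym2.map (plugPt a))) (W.map (Sym2.map rightPt))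
        (plugPt (P := P) a (.inl v))
      rw [h1, h2, hR.degree_binary v hv] at h3
      exact h3
    · exact (key (.inl v)).trans (h.degree_binary (.inr v) hv)
  · exact (key (.inr p)).trans (h.degree_port p)

section Context

variable {I₁ O₁ : Type}

/-- Wires that bend `I₁` and pass `I`. -/
def cups (I₁ I : Type) [Fintype I₁] [Fintype I] : Diagram I (I₁ ⊕ (I₁ ⊕ I)) where
  V := Empty
  finite := inferInstance
  label := Empty.elim
  wires := ∑ q, {s(.inr (.inr (.inl q)), .inr (.inr (.inr (.inl q))))} +
    ∑ i, {s(.inr (.inl i), .inr (.inr (.inr (.inr i))))}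
  degree_binary v := v.elim
  degree_port p := by
    classical
    simp only [degree_add, degree_fsum, degree_singleton]
    rcases p with p | p | p | p <;> simp

/-- End points of a context, seen in the diagram of the context. -/
def contextPt {J : Type} : J ⊕ (I ⊕ O) → (J ⊕ I) ⊕ ((O₁ ⊕ (I₁ ⊕ I)) ⊕ O)
  | .inl v => .inl (.inl v)
  | .inr (.inl i) => .inl (.inr i)
  | .inr (.inr o) => .inr (.inr o)

theorem contextPt_injective {J : Type} :
    (contextPt : J ⊕ (I ⊕ O) → (J ⊕ I) ⊕ ((O₁ ⊕ (I₁ ⊕ I)) ⊕ O)).Injective := by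
  rintro (x | x | x) (y | y | y) <;> simp [contextPt]

/-- The wires of the diagram of a context. -/
abbrev contextWires [Fintype I] [Fintype I₁] [Fintype O₁] {J : Type} (a : I₁ ⊕ O₁ → J ⊕ (I ⊕ O))
    (W : Multiset (Sym2 (J ⊕ (I ⊕ O)))) :
    Multiset (Sym2 ((J ⊕ I) ⊕ ((O₁ ⊕ (I₁ ⊕ I)) ⊕ O))) :=
  ∑ q, {s(.inr (.inl (.inl q)), contextPt (a (.inr q)))} +
    ∑ q, {s(.inr (.inl (.inr (.inl q))), contextPt (a (.inl q)))} +
    ∑ i, {s(.inr (.inl (.inr (.inr i))), .inl (.inr i))} + W.map (Sym2.map contextPt)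

/-- The last term is the additional wire of the marked point that stands for an input in the diagram
of the context. -/
theorem degree_contextWires [Fintype I] [Fintype I₁] [Fintype O₁] {J : Type}
    (a : I₁ ⊕ O₁ → J ⊕ (I ⊕ O)) (W : Multiset (Sym2 (J ⊕ (I ⊕ O)))) (x : J ⊕ (I ⊕ O)) :
    degree (contextWires a W) (contextPt x) = (∑ q, ind (x = a q)) + degree W x +
      ind (∃ i, x = .inr (.inl i)) := by
  have h1 : ∀ p, (contextPt x : (J ⊕ I) ⊕ ((O₁ ⊕ (I₁ ⊕ I)) ⊕ O)) ≠ .inr (.inl p) := by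
    rcases x with x | x | x <;> simp [contextPt]
  have h2 : (∑ i : I, ind ((contextPt x : (J ⊕ I) ⊕ ((O₁ ⊕ (I₁ ⊕ I)) ⊕ O)) = .inl (.inr i)))
      = ind (∃ i, x = .inr (.inl i)) := by
    rcases x with x | x | x <;> simp [contextPt]
  simp only [degree_add, degree_fsum, degree_singleton, h1, degree_map_injective contextPt_injective,
    contextPt_injective.eq_iff, Fintype.sum_sum_type, ind_false, zero_add, h2]
  ring

/-- A context as a diagram. -/
def contextDiagram [Fintype I] [Fintype I₁] [Fintype O₁] {J : Type} (l : J → Node)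
    (a : I₁ ⊕ O₁ → J ⊕ (I ⊕ O)) (W : Multiset (Sym2 (J ⊕ (I ⊕ O)))) (L : Diagram I₁ O₁)
    (h : (plug L.net l a W).WF) : Diagram (O₁ ⊕ (I₁ ⊕ I)) O where
  V := J ⊕ I
  finite := by
    have : Finite (L.V ⊕ J) := h.finite
    have : Finite J := Finite.of_injective (Sum.inr : J → L.V ⊕ J) Sum.inr_injective
    infer_instance
  label := Sum.elim l fun _ => .joint
  wires := contextWires a W
  degree_binary := by
    classical
    rintro (v | i) hv
    · have h1 := h.degree_binary (.inr v) hv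
      have h2 := degree_plug L.net_wf l a W (.inl v)
      have h3 := degree_contextWires a W (.inl v)
      simp only [reduceCtorEq, exists_false, ind_false, add_zero] at h3
      exact h3.trans (h2.symm.trans h1)
    -- One wire end here is inherited from the input `i`; the other belongs to the wire that leads
    -- to the context's own port for `i`. Together they give a marked point its degree two.
    · have h1 := h.degree_port (.inl i)
      have h2 := degree_plug L.net_wf l a W (.inr (.inl i))
      have h3 := degree_contextWires a W (.inr (.inl i))
      rw [ind_pos ⟨i, rfl⟩, ← h2] at h3
      exact h3.trans (congrArg (· + 1) h1)
  degree_port := by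
    classical
    have h1 : ∀ p, ∀ x : J ⊕ (I ⊕ O), .inr (.inl p) ≠
        (contextPt x : (J ⊕ I) ⊕ ((O₁ ⊕ (I₁ ⊕ I)) ⊕ O)) := by
      rintro p (x | x | x) <;> simp [contextPt]
    rintro (p | o)
    · simp only [contextWires, degree_add, degree_fsum, degree_singleton, h1]
      rw [degree_map_eq_zero _ _ _ fun y => (h1 p y).symm]
      rcases p with p | p | p <;> simp
    · have h1 := h.degree_port (.inr o)
      have h2 := degree_plug L.net_wf l a W (.inr (.inr o))
      have h3 := degree_contextWires a W (.inr (.inr o))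
      simp only [Sum.inr.injEq, reduceCtorEq, exists_false, ind_false, add_zero] at h3
      exact h3.trans (h2.symm.trans h1)

end Context

section Context

variable {I₁ O₁ : Type}

/-- The types of marked points in the composite of a diagram and its context. -/
abbrev ContextJoints (I O₁ I₁ : Type) : Type := ((I₁ ⊕ (I₁ ⊕ I)) ⊕ (O₁ ⊕ (I₁ ⊕ I))) ⊕ I

/-- The nodes of the composite of a diagram and its context. -/
def contextEquiv (U J : Type) :
    (((Empty ⊕ (U ⊕ Empty)) ⊕ (I₁ ⊕ (I₁ ⊕ I))) ⊕ (J ⊕ I)) ⊕ (O₁ ⊕ (I₁ ⊕ I)) ≃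
      (U ⊕ J) ⊕ ContextJoints I O₁ I₁ where
  toFun
    | .inl (.inl (.inl (.inr (.inl u)))) => .inl (.inl u)
    | .inl (.inl (.inr j)) => .inr (.inl (.inl j))
    | .inl (.inr (.inl v)) => .inl (.inr v)
    | .inl (.inr (.inr i)) => .inr (.inr i)
    | .inr j => .inr (.inl (.inr j))
  invFun
    | .inl (.inl u) => .inl (.inl (.inl (.inr (.inl u))))
    | .inr (.inl (.inl j)) => .inl (.inl (.inr j))
    | .inl (.inr v) => .inl (.inr (.inl v))
    | .inr (.inr i) => .inl (.inr (.inr i))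
    | .inr (.inl (.inr j)) => .inr j
  left_inv := by rintro ((((x | x | x) | x) | x | x) | x) <;> first | rfl | exact x.elim
  right_inv := by rintro ((x | x) | (x | x) | x) <;> rfl

/-- End points of a context in the composite. -/
def outerPt {U J : Type} : J ⊕ (I ⊕ O) → ((U ⊕ J) ⊕ ContextJoints I O₁ I₁) ⊕ (I ⊕ O)
  | .inl v => .inl (.inl (.inr v))
  | .inr (.inl i) => .inl (.inr (.inr i))
  | .inr (.inr o) => .inr (.inr o)

/-- End points of a diagram in the composite with its context. -/
def innerPt {U J : Type} : U ⊕ (I₁ ⊕ O₁) → ((U ⊕ J) ⊕ ContextJoints I O₁ I₁) ⊕ (I ⊕ O)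
  | .inl v => .inl (.inl (.inl v))
  | .inr (.inl i) => .inl (.inr (.inl (.inl (.inl i))))
  | .inr (.inr o) => .inl (.inr (.inl (.inr (.inl o))))

/-- The other end of one of the two wires at each marked point of the composite. -/
def contextNext {U J : Type} (a : I₁ ⊕ O₁ → J ⊕ (I ⊕ O)) :
    ContextJoints I O₁ I₁ → ((U ⊕ J) ⊕ ContextJoints I O₁ I₁) ⊕ (I ⊕ O)
  | .inl (.inl (.inl q)) => .inl (.inr (.inl (.inl (.inr (.inl q)))))
  | .inl (.inl (.inr (.inl q))) => .inl (.inr (.inl (.inr (.inr (.inl q)))))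
  | .inl (.inl (.inr (.inr i))) => .inr (.inl i)
  | .inl (.inr (.inl q)) => outerPt (a (.inr q))
  | .inl (.inr (.inr (.inl q))) => outerPt (a (.inl q))
  | .inl (.inr (.inr (.inr i))) => .inl (.inr (.inl (.inl (.inr (.inr i)))))
  | .inr i => .inl (.inr (.inl (.inr (.inr (.inr i)))))

/-- A rank function that shows that `contextNext` is acyclic. -/
def contextRank : ContextJoints I O₁ I₁ → ℕ
  | .inl (.inl (.inl _)) => 5
  | .inl (.inl (.inr (.inl _))) => 4
  | .inl (.inl (.inr (.inr _))) => 0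
  | .inl (.inr (.inl _)) => 3
  | .inl (.inr (.inr (.inl _))) => 3
  | .inl (.inr (.inr (.inr _))) => 1
  | .inr _ => 2

/-- The end point to which each marked point of the composite leads. -/
def contextTarget {U J : Type} (a : I₁ ⊕ O₁ → J ⊕ (I ⊕ O)) :
    ContextJoints I O₁ I₁ → (U ⊕ J) ⊕ (I ⊕ O)
  | .inl (.inl (.inl q)) => rightPt (a (.inl q))
  | .inl (.inl (.inr (.inl q))) => rightPt (a (.inl q))
  | .inl (.inl (.inr (.inr i))) => .inr (.inl i)
  | .inl (.inr (.inl q)) => rightPt (a (.inr q))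
  | .inl (.inr (.inr (.inl q))) => rightPt (a (.inl q))
  | .inl (.inr (.inr (.inr i))) => .inr (.inl i)
  | .inr i => .inr (.inl i)

theorem replaceBy_outerPt {U J : Type} (a : I₁ ⊕ O₁ → J ⊕ (I ⊕ O)) (x : J ⊕ (I ⊕ O)) :
    replaceBy (contextTarget a) (outerPt x) = (rightPt x : (U ⊕ J) ⊕ (I ⊕ O)) := by
  rcases x with x | x | x <;> rfl

/-- On the left the seven kinds of marked points come first, in the order of `ContextJoints`; on the
right the wires are grouped by the three factors of the composite. -/
theorem reorder {A : Type} (s₁ s₂ s₃ s₄ s₅ s₆ s₇ u w : Multiset A) :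
    s₁ + (s₂ + s₃) + (s₄ + (s₅ + s₆)) + s₇ + (u + w) =
      s₁ + s₃ + (u + (s₂ + s₆)) + (s₄ + s₅ + s₇ + w) := by abel

variable [Fintype I] [Fintype I₁] [Fintype O₁]

/-- The cups bend the inputs of `L` round to its output side, where the context can take hold of all
legs at once; what then separates the composite from the plugged net is an acyclic family of marked
points. The context is built from `D` but composed with `L`, so that both sides of an equation can
share one context diagram. -/
theorem composite_eqv_plug {J : Type} (l : J → Node) (a : I₁ ⊕ O₁ → J ⊕ (I ⊕ O))
    (W : Multiset (Sym2 (J ⊕ (I ⊕ O)))) (D L : Diagram I₁ O₁) (h : (plug D.net l a W).WF) :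
    Eqv E (((cups I₁ I).comp (L.tensor (identity (I₁ ⊕ I)))).comp
      (contextDiagram l a W D h)).net (plug L.net l a W) := by
  have h1 : Eqv E (((cups I₁ I).comp (L.tensor (identity (I₁ ⊕ I)))).comp
      (contextDiagram l a W D h)).net
      (jointNet (Sum.elim L.label l) (contextNext a)
        (L.wires.map (Sym2.map innerPt) + W.map (Sym2.map outerPt))) := by
    refine Eqv.iso (contextEquiv L.V J) ?_ ?_
    · rintro ((((x | x | x) | x) | x | x) | x) <;> first | rfl | exact x.elim
    · have e1 : ∀ x : L.V ⊕ (I₁ ⊕ O₁), (innerPt x :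
          ((L.V ⊕ J) ⊕ ContextJoints I O₁ I₁) ⊕ (I ⊕ O)) = Sum.map (contextEquiv L.V J) id
          (compFirst (compSecond (tensorLeft x))) := by
        rintro (x | x | x) <;> rfl
      have e2 : ∀ x : J ⊕ (I ⊕ O), (outerPt x :
          ((L.V ⊕ J) ⊕ ContextJoints I O₁ I₁) ⊕ (I ⊕ O)) = Sum.map (contextEquiv L.V J) id
          (compSecond (contextPt x)) := by
        rintro (x | x | x) <;> rfl
      simp only [Diagram.net, Diagram.comp, Diagram.tensor, cups, contextDiagram, identity,
        univ_val_map, Multiset.map_add, map_fsum, map_sym2_comp, Multiset.map_singleton,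
        Sym2.map_mk, Fintype.sum_sum_type, map_sym2_congr e1, map_sym2_congr e2]
      refine (reorder _ _ _ _ _ _ _ _ _).trans (congrArg₂ (· + ·)
        (congrArg₂ (· + ·) (congrArg₂ (· + ·) rfl ?_) (congrArg₂ (· + ·) rfl
          (congrArg₂ (· + ·) rfl ?_))) (congrArg₂ (· + ·)
          (congrArg₂ (· + ·) (congrArg₂ (· + ·) (Finset.sum_congr rfl fun q _ => ?_)
            (Finset.sum_congr rfl fun q _ => ?_)) ?_) rfl))
      case refine_3 => exact congrArg (fun x => ({s(_, x)} : Multiset _)) (e2 _)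
      case refine_4 => exact congrArg (fun x => ({s(_, x)} : Multiset _)) (e2 _)
      all_goals exact Finset.sum_congr rfl fun _ _ => congrArg _ Sym2.eq_swap
  refine h1.trans ?_
  have h2 := Eqv.contract (E := E) (I := I) (O := O) (ContextJoints I O₁ I₁)
    (l := Sum.elim L.label l) (contextNext a)
    contextRank (contextTarget a) (L.wires.map (Sym2.map innerPt) + W.map (Sym2.map outerPt)) ?_ ?_
    (h1.1.1 (net_wf _))
  · rw [Multiset.map_add, map_sym2_comp, map_sym2_comp, map_sym2_congr (replaceBy_outerPt a)] at h2
    have e3 : ∀ x : L.V ⊕ (I₁ ⊕ O₁), replaceBy (contextTarget a) (innerPt x :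
        ((L.V ⊕ J) ⊕ ContextJoints I O₁ I₁) ⊕ (I ⊕ O)) = plugPt a x := by
      rintro (x | x | x) <;> rfl
    rw [map_sym2_congr e3] at h2
    exact h2
  -- The longest chain follows an input of `L` through the cup and the context to an outer input,
  -- with ranks 5, 4, 3, 2, 1, 0 along the way.
  · rintro (((q | q | i) | q | q | i) | i) j hj <;> simp only [contextNext] at hj
    · cases hj; simp [contextRank]
    · cases hj; simp [contextRank]
    · cases hj
    · rcases ha : a (.inr q) with x | x | x <;> rw [ha] at hj <;> cases hj; simp [contextRank]
    · rcases ha : a (.inl q) with x | x | x <;> rw [ha] at hj <;> cases hj; simp [contextRank]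
    · cases hj; simp [contextRank]
    · cases hj; simp [contextRank]
  · rintro (((q | q | i) | q | q | i) | i) <;>
      first | rfl | exact replaceBy_outerPt a _

end Context

/-- This turns compatibility with `⊗` and `∘` into compatibility with arbitrary graph contexts: only
the middle factor of the composite changes. -/
theorem Eqv.plug_of_derivable {I₁ O₁ : Type} {L R : Diagram I₁ O₁} (h : Derivable E L R) {J : Type}
    (l : J → Node) (a : I₁ ⊕ O₁ → J ⊕ (I ⊕ O)) (W : Multiset (Sym2 (J ⊕ (I ⊕ O)))) :
    Eqv E (plug L.net l a W) (plug R.net l a W) := by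
  by_cases hL : (plug L.net l a W).WF
  · have := hL.finite_port
    have := L.net_wf.finite_port
    have : Finite I := Finite.of_injective (Sum.inl : I → I ⊕ O) Sum.inl_injective
    have : Finite I₁ := Finite.of_injective (Sum.inl : I₁ → I₁ ⊕ O₁) Sum.inl_injective
    have : Finite O₁ := Finite.of_injective (Sum.inr : O₁ → I₁ ⊕ O₁) Sum.inr_injective
    have := Fintype.ofFinite I
    have := Fintype.ofFinite I₁
    have := Fintype.ofFinite O₁
    exact ((composite_eqv_plug l a W L L hL).symm.trans (.of_derivable
      (.comp (.comp (.refl _) (.tensor h (.refl _))) (.refl _)))).trans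
      (composite_eqv_plug l a W L R hL)
  -- If one side is not a diagram, neither is the other, and there is nothing to derive.
  · have hR : ¬(plug R.net l a W).WF := fun hR => hL (plug_wf R.net_wf L.net_wf hR)
    exact ⟨⟨fun h => absurd h hL, fun h => absurd h hR⟩, fun h => absurd h hL⟩

theorem Eqv.in_context {I₁ O₁ : Type} {L R : Net (I₁ ⊕ O₁)} (hL : L.WF) (h : Eqv E L R) {J : Type}
    (l : J → Node) (a : I₁ ⊕ O₁ → J ⊕ (I ⊕ O)) (W : Multiset (Sym2 (J ⊕ (I ⊕ O)))) :
    Eqv E (plug L l a W) (plug R l a W) :=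
  Eqv.plug_of_derivable (h.2 hL (h.1.1 hL)) l a W

/-- Replacement of a subdiagram. -/
theorem Eqv.rewrite {I₁ O₁ : Type} {L R : Net (I₁ ⊕ O₁)} (h : Eqv E L R) (hL : L.WF)
    {N N' : Net (I ⊕ O)} {J : Type} (e : L.V ⊕ J ≃ N.V) (e' : R.V ⊕ J ≃ N'.V) (l : J → Node)
    (a : I₁ ⊕ O₁ → J ⊕ (I ⊕ O)) (W : Multiset (Sym2 (J ⊕ (I ⊕ O))))
    (hl : ∀ v, N.label (e v) = Sum.elim L.label l v)
    (hl' : ∀ v, N'.label (e' v) = Sum.elim R.label l v)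
    (hW : N.wires = L.wires.map (Sym2.map fun x => Sum.map e id (plugPt a x)) +
      W.map (Sym2.map fun x => Sum.map e id (rightPt x)))
    (hW' : N'.wires = R.wires.map (Sym2.map fun x => Sum.map e' id (plugPt a x)) +
      W.map (Sym2.map fun x => Sum.map e' id (rightPt x))) : Eqv E N N' := by
  have h1 : Eqv E (plug L l a W) N := Eqv.iso e hl (by
    rw [hW]
    rw [Multiset.map_add, map_sym2_comp, map_sym2_comp])
  have h2 : Eqv E (plug R l a W) N' := Eqv.iso e' hl' (by
    rw [hW']
    rw [Multiset.map_add, map_sym2_comp, map_sym2_comp])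
  exact h1.symm.trans ((h.in_context hL l a W).trans h2)

/-- Contraction read backwards. The rank can be constant, because no new marked point leads to
another one. -/
theorem Eqv.subdivide {ι : Type} [Fintype ι] {V : Type} (l : V → Node) (x y : ι → V ⊕ (I ⊕ O))
    (W : Multiset (Sym2 (V ⊕ (I ⊕ O)))) :
    Eqv E ⟨V, l, W + ∑ i, {s(x i, y i)}⟩ (jointNet l (fun i : ι => leftPt (y i))
      (W.map (Sym2.map leftPt) + ∑ i, {s(leftPt (x i), .inl (.inr i))})) := by
  classical
  by_cases h : (jointNet l (fun i : ι => leftPt (y i))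
      (W.map (Sym2.map leftPt) + ∑ i, {s(leftPt (x i), .inl (.inr i))})).WF
  · have h1 := Eqv.contract (E := E) ι (l := l) (fun i => leftPt (y i)) (fun _ => 0) y
      (W.map (Sym2.map leftPt) + ∑ i, {s(leftPt (x i), .inl (.inr i))})
      (fun i j hj => by rcases hy : y i <;> simp [hy, leftPt] at hj)
      (fun i => replaceBy_leftPt _ _) h
    convert h1.symm using 2
    rw [Multiset.map_add, map_sym2_comp, map_fsum, map_sym2_congr (replaceBy_leftPt y)]
    simp only [Multiset.map_singleton, Sym2.map_mk, replaceBy_leftPt]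
    simp [replaceBy]
  -- Midpoints preserve the degrees of old end points and themselves have degree two, so the two
  -- nets are ill-formed together.
  · have h' : ¬Net.WF ⟨V, l, W + ∑ i, {s(x i, y i)}⟩ := fun h' => h <| by
      have h0 : ∀ z i, leftPt z ≠ (.inl (.inr i) : (V ⊕ ι) ⊕ (I ⊕ O)) := by
        rintro (z | z) <;> simp [leftPt]
      have key : ∀ z, degree (jointNet l (fun i : ι => leftPt (y i))
          (W.map (Sym2.map leftPt) + ∑ i, {s(leftPt (x i), .inl (.inr i))})).wires (leftPt z) =
          degree (W + ∑ i, {s(x i, y i)}) z := fun z => by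
        simp only [degree_add, degree_fsum, degree_singleton, ind_neg (h0 z _),
          leftPt_injective.eq_iff, degree_map_injective leftPt_injective, Finset.sum_add_distrib]
        simp
        ring
      refine ⟨have : Finite V := h'.finite; inferInstanceAs (Finite (V ⊕ ι)), ?_,
        fun p => (key (.inr p)).trans (h'.degree_port p)⟩
      rintro (v | i) hv
      · exact (key (.inl v)).trans (h'.degree_binary v hv)
      · simp only [degree_add, degree_fsum, degree_singleton, ind_neg (h0 _ _).symm]
        rw [degree_map_eq_zero _ _ _ fun z => h0 z i]
        simp
    exact ⟨⟨fun h'' => absurd h'' h', fun h'' => absurd h'' h⟩, fun h'' => absurd h'' h'⟩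

/-! ### Fusion of dots in arbitrary graphs, and loops. -/

theorem Derivable.fusion (c : Colour) {I₁ O₁ I₂ O₂ : Type} [Fintype I₁] [Fintype O₁] [Fintype I₂]
    [Fintype O₂] (α β : Real.Angle) (k : ℕ) (hk : 1 ≤ k) :
    Derivable E
      (ofDots ![(c, α), (c, β)] (Sum.elim (fun _ : I₁ => 0) (fun _ : I₂ => 1))
        (Sum.elim (fun _ : O₁ => 0) (fun _ : O₂ => 1)) (Multiset.replicate k s(0, 1)))
      (spider (I₁ ⊕ I₂) (O₁ ⊕ O₂) c (α + β)) := by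
  cases c with
  | Z => exact .rule (.S1 α β k hk)
  | X =>
    have e : ![(X, α), (X, β)] = fun v => ((![(Z, α), (Z, β)] v).1.swap, (![(Z, α), (Z, β)] v).2) := by
      funext v; fin_cases v <;> rfl
    rw [e]
    exact .rule (.colourSwap (.S1 α β k hk))

theorem sum_ite_subtype {ι A : Type} [Fintype ι] (p : ι → Prop) [DecidablePred p]
    (f : ι → Multiset A) : ∑ i : {i // p i}, f i = ∑ i, if p i then f i else 0 := by
  rw [← Finset.sum_filter]
  exact (Finset.sum_subtype (p := p) _ (by simp) f).symm

/-- The net of a diagram of dots. -/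
abbrev dotNet {V : Type} [Fintype I] [Fintype O] (dots : V → Colour × Real.Angle) (inp : I → V)
    (out : O → V) (W : Multiset (Sym2 V)) : Net (I ⊕ O) where
  V := V
  label v := .dot (dots v).1 (dots v).2
  wires := W.map (Sym2.map Sum.inl) + (∑ i, {s(.inr (.inl i), .inl (inp i))} +
    ∑ o, {s(.inl (out o), .inr (.inr o))})

theorem ofDots_net {V : Type} [Finite V] [Fintype I] [Fintype O] (dots : V → Colour × Real.Angle)
    (inp : I → V) (out : O → V) (W : Multiset (Sym2 V)) :
    (ofDots dots inp out W).net = dotNet dots inp out W := by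
  simp only [Diagram.net, ofDots, univ_val_map]

theorem dotNet_wf {V : Type} [Finite V] [Fintype I] [Fintype O] (dots : V → Colour × Real.Angle)
    (inp : I → V) (out : O → V) (W : Multiset (Sym2 V)) : (dotNet dots inp out W).WF :=
  ofDots_net dots inp out W ▸ net_wf _

theorem reorder_legs {A : Type} (a₁ a₂ a₃ b₁ b₂ b₃ r : Multiset A) :
    a₁ + a₂ + a₃ + (r + (b₁ + b₂ + b₃)) = r + (0 + (b₁ + a₁ + (b₂ + a₂))) + (b₃ + a₃) := by
  rw [zero_add]
  abel

/-- The identification of two nodes. -/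
def collapse {J P : Type} : (Bool ⊕ J) ⊕ P → (Unit ⊕ J) ⊕ P :=
  Sum.map (Sum.map (fun _ => ()) id) id

/-- The numbering of two dots. -/
def twoDots : Fin 2 ≃ Bool where
  toFun := ![true, false]
  invFun b := bif b then 0 else 1
  left_inv := by decide
  right_inv := by decide

/-- The wire from an end point of the context to the marked point `i`. -/
def contextWire {J ι P : Type} (i : ι) : (Bool ⊕ J) ⊕ P → Multiset (Sym2 ((J ⊕ ι) ⊕ P))
  | .inl (.inl _) => 0
  | .inl (.inr v) => {s(.inl (.inl v), .inl (.inr i))}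
  | .inr p => {s(.inr p, .inl (.inr i))}

/-- S1 speaks of dots whose other legs are free. A midpoint on each remaining wire makes them free,
even for loops and for additional wires between the two dots: every such wire falls into two legs.
S1 is applied to the legs, and the midpoints are erased. -/
theorem Eqv.fuse_family {ι J : Type} [Fintype ι] (l : J → Node) (c : Colour) (α β : Real.Angle)
    (k : ℕ) (hk : 1 ≤ k) (x y : ι → (Bool ⊕ J) ⊕ (I ⊕ O)) :
    Eqv E ⟨Bool ⊕ J, Sum.elim (fun b => .dot c (bif b then α else β)) l,
        Multiset.replicate k s(.inl (.inl true), .inl (.inl false)) + ∑ i, {s(x i, y i)}⟩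
      ⟨Unit ⊕ J, Sum.elim (fun _ => .dot c (α + β)) l,
        ∑ i, {s(collapse (x i), collapse (y i))}⟩ := by
  classical
  have h2 := (Eqv.subdivide (E := E) (Sum.elim (fun _ : Unit => .dot c (α + β)) l)
    (fun i => collapse (x i)) (fun i => collapse (y i)) 0).symm
  rw [zero_add] at h2
  refine (Eqv.subdivide _ x y _).trans (Eqv.trans ?_ h2)
  -- Half-wires are indexed by `ι ⊕ ι`: `z` gives the outer end, `j` the midpoint. Those with outer
  -- end at a fused dot become its legs, and the others belong to the context.
  let z : ι ⊕ ι → (Bool ⊕ J) ⊕ (I ⊕ O) := Sum.elim x y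
  let j : ι ⊕ ι → ι := Sum.elim id id
  let Leg (b : Bool) : Type := {h : ι ⊕ ι // z h = .inl (.inl b)}
  -- All legs can be taken as outputs, since a context attaches inputs and outputs alike.
  have hf := Derivable.fusion (E := E) c (I₁ := Empty) (O₁ := Leg true) (I₂ := Empty)
    (O₂ := Leg false) α β k hk
  have hf := Eqv.of_derivable hf
  rw [spider, ofDots_net, ofDots_net] at hf
  refine hf.rewrite (dotNet_wf _ _ _ _) (J := J ⊕ ι)
    ((Equiv.sumAssoc _ _ _).symm.trans
      (Equiv.sumCongr (Equiv.sumCongr twoDots (Equiv.refl J)) (Equiv.refl ι)))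
    (Equiv.sumAssoc _ _ _).symm (Sum.elim l fun _ => .joint)
    (Sum.elim (Sum.elim Empty.elim Empty.elim)
      (Sum.elim (fun h => .inl (.inr (j h.1))) fun h => .inl (.inr (j h.1))))
    (∑ h, contextWire (j h) (z h)) ?_ ?_ ?_ ?_
  · rintro (v | v | v)
    · fin_cases v <;> rfl
    · rfl
    · rfl
  · rintro (v | v | v) <;> rfl
  · have key : ∀ (w : (Bool ⊕ J) ⊕ (I ⊕ O)) (i : ι), ({s(leftPt w, .inl (.inr i))} : Multiset _) =
        ((if w = .inl (.inl true) then {s(.inl (.inl (.inl true)), .inl (.inr i))} else 0) +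
        if w = .inl (.inl false) then {s(.inl (.inl (.inl false)), .inl (.inr i))} else 0) +
        (contextWire i w).map (Sym2.map fun x => Sum.map ((Equiv.sumAssoc _ _ _).symm.trans
      (Equiv.sumCongr (Equiv.sumCongr twoDots (Equiv.refl J)) (Equiv.refl ι))) id (rightPt x)) := by
      rintro (((_ | _) | w) | w) i <;> simp [contextWire, leftPt, rightPt]
    have h3 := sum_ite_subtype (fun h => z h = .inl (.inl true)) fun h => 
      ({s(.inl (.inl (.inl true)), .inl (.inr (j h)))} : Multiset (Sym2 (((Bool ⊕ J) ⊕ ι) ⊕ (I ⊕ O))))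
    have h4 := sum_ite_subtype (fun h => z h = .inl (.inl false)) fun h => 
      ({s(.inl (.inl (.inl false)), .inl (.inr (j h)))} : Multiset (Sym2 (((Bool ⊕ J) ⊕ ι) ⊕ (I ⊕ O))))
    rw [Fintype.sum_sum_type] at h3 h4
    simp only [Multiset.map_add, map_fsum, Fintype.sum_sum_type, Multiset.map_singleton,
      Sym2.map_mk, Multiset.map_replicate, Finset.univ_eq_empty, Finset.sum_empty,
      Sym2.eq_swap (a := Sum.inl (Sum.inr _)), key, Finset.sum_add_distrib]
    exact (reorder_legs _ _ _ _ _ _ _).trans (congrArg₂ (· + ·) (congrArg₂ (· + ·) rfl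
      (congrArg₂ (· + ·) rfl (congrArg₂ (· + ·) h3.symm h4.symm))) rfl)
  · have key : ∀ (w : (Bool ⊕ J) ⊕ (I ⊕ O)) (i : ι), ({s(leftPt (collapse w), .inl (.inr i))} :
        Multiset _) =
        ((if w = .inl (.inl true) then {s(.inl (.inl (.inl ())), .inl (.inr i))} else 0) +
        if w = .inl (.inl false) then {s(.inl (.inl (.inl ())), .inl (.inr i))} else 0) +
        (contextWire i w).map (Sym2.map fun x => Sum.map
          (Equiv.sumAssoc Unit _ _).symm id (rightPt x)) := by
      rintro (((_ | _) | w) | w) i <;> simp [contextWire, collapse, leftPt, rightPt]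
    have h3 : ∀ b, _ := fun b => sum_ite_subtype (fun h => z h = .inl (.inl b)) fun h =>
      ({s(.inl (.inl (.inl ())), .inl (.inr (j h)))} :
        Multiset (Sym2 (((Unit ⊕ J) ⊕ ι) ⊕ (I ⊕ O))))
    simp only [Fintype.sum_sum_type] at h3
    simp only [Multiset.map_add, map_fsum, Fintype.sum_sum_type, Multiset.map_singleton,
      Sym2.map_mk, Finset.univ_eq_empty, Finset.sum_empty,
      Sym2.eq_swap (a := Sum.inl (Sum.inr _)), key, Finset.sum_add_distrib]
    exact (reorder_legs _ _ _ _ _ _ _).trans (congrArg₂ (· + ·) (congrArg₂ (· + ·) rfl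
      (congrArg₂ (· + ·) rfl (congrArg₂ (· + ·) (h3 true).symm (h3 false).symm))) rfl)

theorem exists_family {A : Type} (W : Multiset (Sym2 A)) :
    ∃ (n : ℕ) (x y : Fin n → A), W = ∑ i, {s(x i, y i)} := by
  induction W using Multiset.induction_on with
  | empty => exact ⟨0, Fin.elim0, Fin.elim0, by simp⟩
  | cons e W ih =>
    obtain ⟨n, x, y, rfl⟩ := ih
    induction e with
    | _ a b => exact ⟨n + 1, Fin.cons a x, Fin.cons b y, by simp [Fin.sum_univ_succ]⟩

/-- Fusion of two dots `u` and `v` of the same colour that are joined by at least one wire. -/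
theorem Eqv.fuse {N N' : Net (I ⊕ O)} {c : Colour} {α β : Real.Angle} (f : N.V → N'.V) (u v : N.V)
    (k : ℕ) (W : Multiset (Sym2 (N.V ⊕ (I ⊕ O)))) (hk : 1 ≤ k) (huv : u ≠ v)
    (hlu : N.label u = .dot c α) (hlv : N.label v = .dot c β) (hfv : f v = f u)
    (hsurj : f.Surjective) (hinj : ∀ x y, x ≠ v → y ≠ v → f x = f y → x = y)
    (hl' : N'.label (f u) = .dot c (α + β))
    (hl : ∀ w, w ≠ u → w ≠ v → N'.label (f w) = N.label w)
    (hW : N.wires = Multiset.replicate k s(.inl u, .inl v) + W)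
    (hW' : N'.wires = W.map (Sym2.map (Sum.map f id))) : Eqv E N N' := by
  classical
  let J := {w // w ≠ u ∧ w ≠ v}
  let e : Bool ⊕ J ≃ N.V := Equiv.ofBijective
      (Sum.elim (fun b => bif b then u else v) Subtype.val) (by
    constructor
    · rintro ((_ | _) | ⟨x, hx⟩) ((_ | _) | ⟨y, hy⟩) h
      · rfl
      · exact absurd h.symm huv
      · exact absurd h.symm hy.2
      · exact absurd h huv
      · rfl
      · exact absurd h.symm hy.1
      · exact absurd h hx.2
      · exact absurd h hx.1
      · exact congrArg Sum.inr (Subtype.ext h)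
    · intro w
      by_cases h1 : w = u
      · exact ⟨.inl true, h1.symm⟩
      by_cases h2 : w = v
      · exact ⟨.inl false, h2.symm⟩
      · exact ⟨.inr ⟨w, h1, h2⟩, rfl⟩)
  let e' : Unit ⊕ J ≃ N'.V := Equiv.ofBijective (Sum.elim (fun _ => f u) fun w => f w) (by
    constructor
    · rintro (_ | ⟨x, hx⟩) (_ | ⟨y, hy⟩) h
      · rfl
      · exact absurd (hinj _ _ huv hy.2 h).symm hy.1
      · exact absurd (hinj _ _ hx.2 huv h) hx.1
      · exact congrArg Sum.inr (Subtype.ext (hinj _ _ hx.2 hy.2 h))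
    · intro w
      obtain ⟨w, rfl⟩ := hsurj w
      by_cases h1 : w = u
      · exact ⟨.inl (), by rw [h1]; rfl⟩
      by_cases h2 : w = v
      · exact ⟨.inl (), by rw [h2, hfv]; rfl⟩
      · exact ⟨.inr ⟨w, h1, h2⟩, rfl⟩)
  obtain ⟨n, x, y, hxy⟩ := exists_family (W.map (Sym2.map (Sum.map e.symm id)))
  have hWe : W = ∑ i, {s(Sum.map e id (x i), Sum.map e id (y i))} := by
    have h := congrArg (Multiset.map (Sym2.map (Sum.map e id))) hxy
    rw [map_sym2_comp, map_sym2_congr (g := id) (by rintro (z | z) <;> simp), map_fsum] at h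
    simpa using h
  have h1 := Eqv.fuse_family (E := E) (fun w : J => N.label w) c α β k hk x y
  have h2 : Eqv E ⟨Bool ⊕ J, Sum.elim (fun b => .dot c (bif b then α else β)) fun w => N.label w,
      Multiset.replicate k s(.inl (.inl true), .inl (.inl false)) + ∑ i, {s(x i, y i)}⟩ N := by
    refine Eqv.iso e ?_ ?_
    · rintro ((_ | _) | w)
      · exact hlv
      · exact hlu
      · rfl
    · rw [hW, Multiset.map_add, map_fsum, Multiset.map_replicate, hWe]
      rfl
  have h3 : Eqv E ⟨Unit ⊕ J, Sum.elim (fun _ => .dot c (α + β)) fun w => N.label w,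
      ∑ i, {s(collapse (x i), collapse (y i))}⟩ N' := by
    refine Eqv.iso e' ?_ ?_
    · rintro (_ | w)
      · exact hl'
      · exact hl _ w.2.1 w.2.2
    · have hc : ∀ z, Sum.map f (id : I ⊕ O → I ⊕ O) (Sum.map e id z) =
          Sum.map e' id (collapse z) := by
        rintro (((_ | _) | z) | z)
        · exact congrArg Sum.inl hfv
        · rfl
        · rfl
        · rfl
      rw [hW', hWe, map_fsum, map_fsum]
      refine Finset.sum_congr rfl fun i _ => ?_
      simp only [Multiset.map_singleton, Sym2.map_mk, hc]
  exact h2.symm.trans (h1.trans h3)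

/-- A dot of angle `0` is absorbed by a dot to which it is joined. -/
theorem Eqv.absorb_one {V : Type} {l : V → Node} {u : V} {c : Colour} {α : Real.Angle}
    (hu : l u = .dot c α) (k : ℕ) (hk : 1 ≤ k) (W : Multiset (Sym2 ((V ⊕ Unit) ⊕ (I ⊕ O)))) :
    Eqv E ⟨V ⊕ Unit, Sum.elim l fun _ => .dot c 0,
        Multiset.replicate k s(.inl (.inl u), .inl (.inr ())) + W⟩
      ⟨V, l, W.map (Sym2.map (replaceBy fun _ => .inl u))⟩ := by
  refine Eqv.fuse (c := c) (α := α) (β := 0) (Sum.elim id fun _ => u) (.inl u) (.inr ()) k W hk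
    (by simp) hu rfl rfl (fun w => ⟨.inl w, rfl⟩) ?_ ?_ ?_ rfl ?_
  · rintro (x | x) (y | y) hx hy h
    · exact congrArg _ h
    · exact absurd rfl hy
    · exact absurd rfl hx
    · rfl
  · rw [add_zero]; exact hu
  · rintro (w | w) _ hw
    · rfl
    · exact absurd rfl hw
  · exact map_sym2_congr (by rintro ((x | x) | x) <;> rfl) W

/-- A loop on a dot can be removed. -/
theorem Eqv.remove_loop {V : Type} {l : V → Node} {u : V} {c : Colour} {α : Real.Angle}
    (hu : l u = .dot c α) (W : Multiset (Sym2 (V ⊕ (I ⊕ O)))) :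
    Eqv E ⟨V, l, s(.inl u, .inl u) ::ₘ W⟩ ⟨V, l, W⟩ := by
  -- A dot of angle `0` joined to `u` by two wires is absorbed in two ways: along one wire, when the
  -- other becomes a loop, or along both, when no loop remains.
  have h1 := Eqv.absorb_one (E := E) hu 1 le_rfl
    (s(.inl (.inl u), .inl (.inr ())) ::ₘ W.map (Sym2.map leftPt))
  have h2 := Eqv.absorb_one (E := E) hu 2 one_le_two (W.map (Sym2.map leftPt))
  rw [Multiset.map_cons, map_sym2_comp, map_sym2_congr (g := id) (replaceBy_leftPt _)] at h1
  rw [map_sym2_comp, map_sym2_congr (g := id) (replaceBy_leftPt _)] at h2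
  simp only [Sym2.map_id, Multiset.map_id, Sym2.map_mk] at h1 h2
  refine h1.symm.trans (Eqv.trans ?_ h2)
  rw [← Multiset.singleton_add, ← add_assoc]
  exact Eqv.refl _

theorem Eqv.remove_loops {V : Type} {l : V → Node} {u : V} {c : Colour} {α : Real.Angle}
    (hu : l u = .dot c α) (n : ℕ) (W : Multiset (Sym2 (V ⊕ (I ⊕ O)))) :
    Eqv E ⟨V, l, Multiset.replicate n s(.inl u, .inl u) + W⟩ ⟨V, l, W⟩ := by
  induction n with
  | zero => rw [Multiset.replicate_zero, zero_add]; exact .refl _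
  | succ n ih =>
    rw [Multiset.replicate_succ, Multiset.cons_add]
    exact (Eqv.remove_loop hu _).trans ih

/-! ### Wires in contexts -/

/-- Wires from the node `a` to the end points in `C`, which are embedded by `g`. -/
def star {V J P : Type} (a : V) (g : J → V) (C : Multiset (J ⊕ P)) : Multiset (Sym2 (V ⊕ P)) :=
  C.map fun w => s(.inl a, Sum.map g id w)

/-- The wires `W`, embedded by `g`. -/
def embed {V J P : Type} (g : J → V) (W : Multiset (Sym2 (J ⊕ P))) : Multiset (Sym2 (V ⊕ P)) :=
  W.map (Sym2.map (Sum.map g id))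

theorem map_star {V V' J P : Type} (f : V → V') (a : V) (g : J → V) (C : Multiset (J ⊕ P)) :
    (star a g C).map (Sym2.map (Sum.map f id)) = star (f a) (fun j => f (g j)) C := by
  rw [star, star, Multiset.map_map]
  refine Multiset.map_congr rfl fun w _ => ?_
  rcases w with w | w <;> rfl

theorem map_embed {V V' J P : Type} (f : V → V') (g : J → V) (W : Multiset (Sym2 (J ⊕ P))) :
    (embed g W).map (Sym2.map (Sum.map f id)) = embed (fun j => f (g j)) W := by
  rw [embed, map_sym2_comp]
  exact map_sym2_congr (by rintro (w | w) <;> rfl) W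

theorem embed_star {V J K P : Type} (f : K → V) (a : K) (g : J → K) (C : Multiset (J ⊕ P)) :
    embed f (star a g C) = star (f a) (fun j => f (g j)) C := map_star f a g C

theorem embed_embed {V J K P : Type} (f : K → V) (g : J → K) (W : Multiset (Sym2 (J ⊕ P))) :
    embed f (embed g W) = embed (fun j => f (g j)) W := map_embed f g W

theorem embed_add {V J P : Type} (g : J → V) (W W' : Multiset (Sym2 (J ⊕ P))) :
    embed g (W + W') = embed g W + embed g W' := Multiset.map_add _ _ _

theorem embed_singleton {V J P : Type} (g : J → V) (a b : J ⊕ P) :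
    embed g {s(a, b)} = {s(Sum.map g id a, Sum.map g id b)} := rfl

theorem star_cons {V J P : Type} (a : V) (g : J → V) (w : J ⊕ P) (C : Multiset (J ⊕ P)) :
    star a g (w ::ₘ C) = {s(.inl a, Sum.map g id w)} + star a g C := by
  rw [star, Multiset.map_cons, Multiset.singleton_add]; rfl

theorem star_zero {V J P : Type} (a : V) (g : J → V) :
    star a g (0 : Multiset (J ⊕ P)) = 0 := rfl

theorem star_map {V J K P : Type} (a : V) (g : J → V) (f : K → J) (C : Multiset (K ⊕ P)) :
    star a g (C.map (Sum.map f id)) = star a (fun k => g (f k)) C := by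
  rw [star, star, Multiset.map_map]
  refine Multiset.map_congr rfl fun w _ => ?_
  rcases w with w | w <;> rfl

/-- Replacement of a subdiagram. -/
theorem Eqv.replace {I₁ O₁ : Type} {L R : Net (I₁ ⊕ O₁)} (h : Eqv E L R) (hL : L.WF)
    {N N' : Net (I ⊕ O)} {J : Type} (e : L.V ⊕ J ≃ N.V) (e' : R.V ⊕ J ≃ N'.V) (l : J → Node)
    (a : I₁ ⊕ O₁ → J ⊕ (I ⊕ O)) (W : Multiset (Sym2 (J ⊕ (I ⊕ O))))
    (hl : ∀ v, N.label (e v) = Sum.elim L.label l v)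
    (hl' : ∀ v, N'.label (e' v) = Sum.elim R.label l v)
    (hW : N.wires = L.wires.map (Sym2.map (Sum.elim (fun v => .inl (e (.inl v)))
      fun q => Sum.map (fun j => e (.inr j)) id (a q))) + embed (fun j => e (.inr j)) W)
    (hW' : N'.wires = R.wires.map (Sym2.map (Sum.elim (fun v => .inl (e' (.inl v)))
      fun q => Sum.map (fun j => e' (.inr j)) id (a q))) + embed (fun j => e' (.inr j)) W) :
    Eqv E N N' := by
  refine h.rewrite hL e e' l a W hl hl' ?_ ?_
  · rw [hW]
    refine congrArg₂ (· + ·) (map_sym2_congr ?_ _) (map_sym2_congr ?_ _)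
    · rintro (x | x)
      · rfl
      · rcases ha : a x with y | y <;> simp [plugPt, rightPt, ha]
    · rintro (x | x) <;> rfl
  · rw [hW']
    refine congrArg₂ (· + ·) (map_sym2_congr ?_ _) (map_sym2_congr ?_ _)
    · rintro (x | x)
      · rfl
      · rcases ha : a x with y | y <;> simp [plugPt, rightPt, ha]
    · rintro (x | x) <;> rfl

/-- A dot is absorbed by a dot to which it is joined. -/
theorem Eqv.absorb {V : Type} {l l' : V → Node} {u : V} {c : Colour} {α β : Real.Angle}
    (hu : l u = .dot c α) (hu' : l' u = .dot c (α + β)) (hl : ∀ w, w ≠ u → l' w = l w) (k : ℕ)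
    (hk : 1 ≤ k) (W : Multiset (Sym2 ((V ⊕ Unit) ⊕ (I ⊕ O)))) :
    Eqv E ⟨V ⊕ Unit, Sum.elim l fun _ => .dot c β,
        Multiset.replicate k s(.inl (.inl u), .inl (.inr ())) + W⟩
      ⟨V, l', W.map (Sym2.map (Sum.map (Sum.elim id fun _ => u) id))⟩ := by
  refine Eqv.fuse (c := c) (α := α) (β := β) (Sum.elim id fun _ => u) (.inl u) (.inr ()) k W hk
    (by simp) hu rfl rfl (fun w => ⟨.inl w, rfl⟩) ?_ hu' ?_ rfl rfl
  · rintro (x | x) (y | y) hx hy h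
    · exact congrArg _ h
    · exact absurd rfl hy
    · exact absurd rfl hx
    · rfl
  · rintro (w | w) hw hw'
    · exact hl w fun h => hw (congrArg _ h)
    · exact absurd rfl hw'

/-- A dot of angle `0` is absorbed by a dot to which it is joined. -/
theorem Eqv.absorb_zero {V : Type} {l : V → Node} {u : V} {c : Colour} {α : Real.Angle}
    (hu : l u = .dot c α) (W : Multiset (Sym2 ((V ⊕ Unit) ⊕ (I ⊕ O)))) :
    Eqv E ⟨V ⊕ Unit, Sum.elim l fun _ => .dot c 0, {s(.inl (.inl u), .inl (.inr ()))} + W⟩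
      ⟨V, l, W.map (Sym2.map (Sum.map (Sum.elim id fun _ => u) id))⟩ :=
  Eqv.absorb hu (by rw [hu, add_zero]) (fun _ _ => rfl) 1 le_rfl W

/-! ### The rules for both colours -/

theorem ofDots_swap {V : Type} [Finite V] [Fintype I] [Fintype O]
    {dots dots' : V → Colour × Real.Angle} {inp : I → V} {out : O → V} {W : Multiset (Sym2 V)}
    (h : ∀ v, dots' v = ((dots v).1.swap, (dots v).2)) :
    (ofDots dots inp out W).colourSwap = ofDots dots' inp out W := by
  rw [funext h]
  rfl

theorem Eqv.of_derivable_dots {V V' : Type} [Finite V] [Finite V'] [Fintype I] [Fintype O]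
    {dots : V → Colour × Real.Angle} {inp : I → V} {out : O → V} {W : Multiset (Sym2 V)}
    {dots' : V' → Colour × Real.Angle} {inp' : I → V'} {out' : O → V'} {W' : Multiset (Sym2 V')}
    (h : Derivable E (ofDots dots inp out W) (ofDots dots' inp' out' W')) :
    Eqv E (dotNet dots inp out W) (dotNet dots' inp' out' W') := by
  have := Eqv.of_derivable h
  rwa [ofDots_net, ofDots_net] at this

theorem Eqv.copy (c : Colour) : Eqv E (I := Fin 0) (O := Fin 2)
    (dotNet ![(c.swap, 0), (c, 0), (c, 0), (c.swap, 0)] ![] ![3, 3] {s(0, 1), s(2, 3)})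
    (dotNet ![(c, 0), (c, 0)] ![] ![0, 1] 0) := by
  refine Eqv.of_derivable_dots ?_
  cases c with
  | X => exact .rule .B1
  | Z =>
    convert Derivable.rule (E := E) (Rule.colourSwap Rule.B1) using 1 <;>
      exact (ofDots_swap fun v => by fin_cases v <;> rfl).symm

theorem Eqv.bialgebra (c : Colour) : Eqv E (I := Fin 2) (O := Fin 2)
    (dotNet ![(c, 0), (c.swap, 0), (c, 0), (c, 0), (c.swap, 0), (c.swap, 0)] ![2, 3] ![4, 5]
      {s(0, 1), s(2, 4), s(2, 5), s(3, 4), s(3, 5)})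
    (dotNet ![(c.swap, 0), (c, 0)] ![0, 0] ![1, 1] {s(0, 1)}) := by
  refine Eqv.of_derivable_dots ?_
  cases c with
  | Z => exact .rule .B2
  | X =>
    convert Derivable.rule (E := E) (Rule.colourSwap Rule.B2) using 1 <;>
      exact (ofDots_swap fun v => by fin_cases v <;> rfl).symm

theorem Eqv.inverse (c : Colour) : Eqv E (I := Fin 0) (O := Fin 0)
    (dotNet ![(c, 0), (c.swap, 0), (c, 0), (c.swap, 0)] ![] ![]
      {s(0, 1), s(2, 3), s(2, 3), s(2, 3)}) ⟨Empty, Empty.elim, 0⟩ := by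
  rw [← ofDots_net]
  change Eqv E _ (identity (Fin 0)).net
  refine Eqv.of_derivable ?_
  cases c with
  | Z => exact .rule .IV
  | X =>
    have h := Derivable.rule (E := E) (Rule.colourSwap Rule.IV)
    convert h using 1
    · exact (ofDots_swap fun v => by fin_cases v <;> rfl).symm
    · simp only [colourSwap, identity]
      congr
      funext x; exact x.elim

/-- The net of a Hadamard box. -/
abbrev hadamardNet : Net (Fin 1 ⊕ Fin 1) :=
  ⟨Fin 1, fun _ => .had, {s(.inr (.inl 0), .inl 0)} + {s(.inl 0, .inr (.inr 0))}⟩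

theorem hadamards_net : (hadamards (Fin 1)).net = hadamardNet := by
  simp only [Diagram.net, hadamards, univ_val_map]
  simp [hadamardNet]

theorem Eqv.euler (c : Colour) : Eqv E hadamardNet
    (dotNet ![(c, 0), (c.swap, 0), (c, (-(π / 2) : ℝ)), (c, (π / 2 : ℝ)), (c.swap, (π / 2 : ℝ)),
      (c, (π / 2 : ℝ))] ![3] ![5] {s(0, 1), s(0, 1), s(0, 1), s(3, 4), s(4, 5)}) := by
  rw [← ofDots_net, ← hadamards_net]
  refine Eqv.of_derivable ?_
  cases c with
  | Z => exact .rule .EU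
  | X =>
    have h := Derivable.rule (E := E) (Rule.colourSwap Rule.EU)
    convert h using 1
    · rfl
    · exact (ofDots_swap fun v => by fin_cases v <;> rfl).symm

theorem embed_cons {V J P : Type} (g : J → V) (a b : J ⊕ P) (W : Multiset (Sym2 (J ⊕ P))) :
    embed g (s(a, b) ::ₘ W) = s(Sum.map g id a, Sum.map g id b) ::ₘ embed g W :=
  Multiset.map_cons _ _ _

/-- Dots of angle `0` are absorbed by dots to which they are joined. -/
theorem Eqv.absorb_zeros (n : ℕ) {V : Type} {l : V → Node} {u : Fin n → V} {c : Fin n → Colour}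
    {α : Fin n → Real.Angle} (hu : ∀ i, l (u i) = .dot (c i) (α i))
    (W : Multiset (Sym2 ((V ⊕ Fin n) ⊕ (I ⊕ O)))) :
    Eqv E ⟨V ⊕ Fin n, Sum.elim l fun i => .dot (c i) 0,
        (∑ i, {s(.inl (.inl (u i)), .inl (.inr i))}) + W⟩
      ⟨V, l, W.map (Sym2.map (Sum.map (Sum.elim id u) id))⟩ := by
  induction n with
  | zero =>
    refine .iso (Equiv.sumEmpty V (Fin 0)).symm.symm (by rintro (v | v); exacts [rfl, v.elim0]) ?_
    rw [Fin.sum_univ_zero, zero_add]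
    exact map_sym2_congr (by rintro ((v | v) | v); exacts [rfl, v.elim0, rfl]) W
  | succ n ih =>
    let e : V ⊕ Fin (n + 1) ≃ (V ⊕ Fin n) ⊕ Unit :=
      { toFun := Sum.elim (fun v => .inl (.inl v)) (Fin.lastCases (.inr ()) fun i => .inl (.inr i))
        invFun := Sum.elim (Sum.elim .inl fun i => .inr i.castSucc) fun _ => .inr (Fin.last n)
        left_inv := by
          rintro (v | v)
          · rfl
          · cases v using Fin.lastCases <;> simp
        right_inv := by rintro ((v | v) | v) <;> simp }
    refine (Eqv.iso (N' := ⟨(V ⊕ Fin n) ⊕ Unit, Sum.elim (Sum.elim l fun i => .dot (c i.castSucc) 0)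
      fun _ => .dot (c (Fin.last n)) 0, {s(.inl (.inl (.inl (u (Fin.last n)))), .inl (.inr ()))} +
        ((∑ i : Fin n, {s(.inl (.inl (.inl (u i.castSucc))), .inl (.inl (.inr i)))}) +
          W.map (Sym2.map (Sum.map e id)))⟩) e ?_ ?_).trans ?_
    · rintro (v | v)
      · rfl
      · cases v using Fin.lastCases <;> simp [e]
    · rw [Multiset.map_add, map_fsum, Fin.sum_univ_castSucc, add_comm (∑ i : Fin n, _), add_assoc]
      simp [e, add_comm]
    · refine (Eqv.absorb_zero (u := Sum.inl (u (Fin.last n))) (hu _) _).trans ?_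
      rw [Multiset.map_add, map_fsum]
      refine (ih (fun i => hu i.castSucc) _).trans ?_
      rw [map_sym2_comp, map_sym2_comp]
      refine (map_sym2_congr ?_ W) ▸ Eqv.refl _
      rintro ((v | v) | v)
      · rfl
      · cases v using Fin.lastCases <;> simp [e]
      · rfl

/-- As `Eqv.absorb_zeros`, with wires `R` that do not touch the absorbed dots. -/
theorem Eqv.absorb_zeros_embed (n : ℕ) {V : Type} {l : V → Node} {u : Fin n → V}
    {c : Fin n → Colour} {α : Fin n → Real.Angle} (hu : ∀ i, l (u i) = .dot (c i) (α i))
    (W : Multiset (Sym2 ((V ⊕ Fin n) ⊕ (I ⊕ O)))) (R : Multiset (Sym2 (V ⊕ (I ⊕ O)))) :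
    Eqv E ⟨V ⊕ Fin n, Sum.elim l fun i => .dot (c i) 0,
        (∑ i, {s(.inl (.inl (u i)), .inl (.inr i))}) + (W + embed .inl R)⟩
      ⟨V, l, W.map (Sym2.map (Sum.map (Sum.elim id u) id)) + R⟩ := by
  have h := Eqv.absorb_zeros (E := E) n hu (W + embed .inl R)
  rw [Multiset.map_add, map_embed] at h
  have hR : embed (fun v => v) R = R := by
    refine (map_sym2_congr (g := id) (by rintro (v | v) <;> rfl) R).trans ?_
    rw [Sym2.map_id, Multiset.map_id]
  rwa [show embed (fun v => Sum.elim id u (.inl v)) R = R from hR] at h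

/-! ### The hub and the moves on common neighbours. -/

/-- Dots `d` of colour `c` in a context with nodes `l`, and wires `W`; the dots `x` and `y` have a
wire to each member of `C`. -/
noncomputable abbrev pairNet {V₀ J P : Type} (c : Colour) (d : V₀ → Real.Angle) (x y : V₀)
    (l : J → Node) (C : Multiset (J ⊕ P)) (W : Multiset (Sym2 (J ⊕ P))) : Net P where
  V := V₀ ⊕ J
  label := Sum.elim (fun v => .dot c (d v)) l
  wires := star (.inl x) Sum.inr C + star (.inl y) Sum.inr C + embed Sum.inr W

/-- The nodes of `hubNet`. -/
noncomputable abbrev hubLabel {V₀ J : Type} (c : Colour) (d : V₀ → Real.Angle) (l : J → Node) :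
    V₀ ⊕ (Fin 2 ⊕ J) → Node :=
  Sum.elim (fun v => .dot c (d v)) (Sum.elim ![.dot c.swap 0, .dot c 0] l)

/-- The wires of `hubNet`, except for two. -/
abbrev hubWires {V₀ J P : Type} (x y : V₀) (C Y : Multiset (J ⊕ P)) (W : Multiset (Sym2 (J ⊕ P))) :
    Multiset (Sym2 ((V₀ ⊕ (Fin 2 ⊕ J)) ⊕ P)) :=
  {s(Sum.inl (Sum.inr (Sum.inl 0)), Sum.inl (Sum.inr (Sum.inl 1)))} +
    star (Sum.inr (Sum.inl 1)) (fun j => Sum.inr (Sum.inr j)) Y +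
    star (Sum.inl x) (fun j => Sum.inr (Sum.inr j)) C +
    star (Sum.inl y) (fun j => Sum.inr (Sum.inr j)) C + embed (fun j => Sum.inr (Sum.inr j)) W

/-- As `pairNet`, with a dot of the other colour joined to `x`, to `y` and to a second dot of colour
`c`, which has a wire to each member of `Y`. -/
noncomputable abbrev hubNet {V₀ J P : Type} (c : Colour) (d : V₀ → Real.Angle) (x y : V₀)
    (l : J → Node) (C Y : Multiset (J ⊕ P)) (W : Multiset (Sym2 (J ⊕ P))) : Net P where
  V := V₀ ⊕ (Fin 2 ⊕ J)
  label := hubLabel c d l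
  wires := {s(.inl (.inl x), .inl (.inr (.inl 0))), s(.inl (.inl y), .inl (.inr (.inl 0)))} +
    hubWires x y C Y W

theorem Eqv.of_wires_eq {V P Q : Type} {l : V → Node} {W W' : Multiset (Sym2 (V ⊕ (P ⊕ Q)))}
    (h : W = W') : Eqv E ⟨V, l, W⟩ ⟨V, l, W'⟩ := h ▸ Eqv.refl _

/-- Leaves of angle `0` are drawn out of `x` and `y`, and the copy rule, read backwards, joins the
two leaves into the hub with its auxiliary dot. The scalar of that rule becomes part of the context.
The case `x = y` is included and serves for the merged dot. -/
theorem Eqv.start_hub {V₀ J : Type} (c : Colour) (d : V₀ → Real.Angle) (x y : V₀) (l : J → Node)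
    (C : Multiset (J ⊕ (I ⊕ O))) (W : Multiset (Sym2 (J ⊕ (I ⊕ O)))) :
    Eqv E (pairNet c d x y l C W)
      (hubNet c d x y (Sum.elim l ![.dot c.swap 0, .dot c 0]) (C.map (Sum.map .inl id)) 0
        (embed .inl W + {s(.inl (.inr 0), .inl (.inr 1))})) := by
  have h := Eqv.absorb_zeros_embed (E := E) 2 (l := (Sum.elim (fun v => .dot c (d v)) l : V₀ ⊕ J → Node))
    (u := ![.inl x, .inl y]) (c := ![c, c]) (α := ![d x, d y]) (by intro i; fin_cases i <;> rfl)
    0 (pairNet c d x y l C W).wires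
  refine (Eqv.of_wires_eq (zero_add _).symm).trans (h.symm.trans ?_)
  let e : Fin 2 ⊕ (V₀ ⊕ J) ≃ (V₀ ⊕ J) ⊕ Fin 2 := Equiv.sumComm _ _
  let e' : Fin 4 ⊕ (V₀ ⊕ J) ≃ V₀ ⊕ (Fin 2 ⊕ (J ⊕ Fin 2)) :=
    { toFun := Sum.elim ![.inr (.inr (.inr 0)), .inr (.inr (.inr 1)), .inr (.inl 1), .inr (.inl 0)]
        (Sum.elim .inl fun j => .inr (.inr (.inl j)))
      invFun := Sum.elim (fun v => .inr (.inl v)) (Sum.elim (fun i => .inl (![3, 2] i))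
        (Sum.elim (fun j => .inr (.inr j)) fun i => .inl (![0, 1] i)))
      left_inv := by rintro (v | v | v) <;> (try fin_cases v) <;> rfl
      right_inv := by rintro (v | v | v | v) <;> (try fin_cases v) <;> rfl }
  refine (Eqv.copy c).symm.replace (dotNet_wf _ _ _ _) e e' (Sum.elim (fun v => .dot c (d v)) l)
    (Sum.elim ![] ![.inl (.inl x), .inl (.inl y)]) (pairNet c d x y l C W).wires ?_ ?_ ?_ ?_
  · rintro (v | v | v) <;> (try fin_cases v) <;> rfl
  · rintro (v | v | v) <;> (try fin_cases v) <;> rfl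
  · simp [e, embed_add, embed_star, embed_embed]
    simp only [Sym2.eq_swap]
  · simp [e', hubWires, embed_add, embed_star, embed_embed, embed_singleton, star_map, star_zero]
    simp only [Sym2.eq_swap, ← Multiset.singleton_add]
    abel

theorem empty_wf : (⟨Empty, Empty.elim, 0⟩ : Net (Fin 0 ⊕ Fin 0)).WF where
  finite := inferInstance
  degree_binary v := v.elim
  degree_port := by rintro (p | p) <;> exact p.elim0

/-- The bialgebra rule with the scalar on the other side. -/
theorem Eqv.bialgebra_inverse (c : Colour) : Eqv E (I := Fin 2) (O := Fin 2)
    (dotNet ![(c, 0), (c, 0), (c.swap, 0), (c.swap, 0)] ![0, 1] ![2, 3]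
      {s(0, 2), s(0, 3), s(1, 2), s(1, 3)})
    (dotNet ![(c.swap, 0), (c, 0), (c, 0), (c.swap, 0)] ![0, 0] ![1, 1]
      {s(0, 1), s(2, 3), s(2, 3), s(2, 3)}) := by
  let e : Fin 4 ⊕ Fin 4 ≃ Fin 8 :=
    { toFun := Sum.elim ![0, 1, 6, 7] ![2, 3, 4, 5]
      invFun := ![.inl 0, .inl 1, .inr 0, .inr 1, .inr 2, .inr 3, .inl 2, .inl 3]
      left_inv := by rintro (v | v) <;> fin_cases v <;> rfl
      right_inv := by intro v; fin_cases v <;> rfl }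
  -- The inverse rule inserts both scalars; the bialgebra rule consumes `s` and leaves `s'`.
  refine Eqv.trans (N' := dotNet ![(c, 0), (c.swap, 0), (c, 0), (c, 0), (c.swap, 0), (c.swap, 0),
    (c, 0), (c.swap, 0)] ![2, 3] ![4, 5] {s(0, 1), s(2, 4), s(2, 5), s(3, 4), s(3, 5), s(6, 7),
      s(6, 7), s(6, 7)}) ?_ ?_
  · refine (Eqv.inverse c).symm.replace empty_wf (Equiv.emptySum Empty (Fin 4)) e
      (fun v => .dot (![(c, 0), (c, 0), (c.swap, 0), (c.swap, 0)] v).1 0)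
      (Sum.elim ![] ![])
      (dotNet ![(c, 0), (c, 0), (c.swap, 0), (c.swap, 0)] ![0, 1] ![2, 3]
        {s(0, 2), s(0, 3), s(1, 2), s(1, 3)}).wires ?_ ?_ ?_ ?_
    · rintro (v | v) <;> fin_cases v <;> rfl
    · rintro (v | v) <;> fin_cases v <;> rfl
    · simp [embed]
    · simp [e, embed]
      simp only [← Multiset.singleton_add]
      abel
  · let e₁ : Fin 6 ⊕ Fin 2 ≃ Fin 8 :=
      { toFun := Sum.elim ![0, 1, 2, 3, 4, 5] ![6, 7]
        invFun := ![.inl 0, .inl 1, .inl 2, .inl 3, .inl 4, .inl 5, .inr 0, .inr 1]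
        left_inv := by rintro (v | v) <;> fin_cases v <;> rfl
        right_inv := by intro v; fin_cases v <;> rfl }
    let e₂ : Fin 2 ⊕ Fin 2 ≃ Fin 4 :=
      { toFun := Sum.elim ![0, 1] ![2, 3]
        invFun := ![.inl 0, .inl 1, .inr 0, .inr 1]
        left_inv := by rintro (v | v) <;> fin_cases v <;> rfl
        right_inv := by intro v; fin_cases v <;> rfl }
    refine (Eqv.bialgebra c).replace (dotNet_wf _ _ _ _) e₁ e₂
      (fun v => .dot (![(c, 0), (c.swap, 0)] v).1 0)
      .inr {s(.inl 0, .inl 1), s(.inl 0, .inl 1), s(.inl 0, .inl 1)} ?_ ?_ ?_ ?_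
    · rintro (v | v) <;> fin_cases v <;> rfl
    · rintro (v | v) <;> fin_cases v <;> rfl
    · simp [e₁, embed]
      simp only [Sym2.eq_swap, ← Multiset.singleton_add]
      abel
    · simp [e₂, embed]
      simp only [Sym2.eq_swap, ← Multiset.singleton_add]
      abel

/-- Both the hub and `w` are dots of the other colour joined to `x` and to `y`. The bialgebra rule
merges the two pairs of wires into a single hub, behind which the paths to `w` and to the auxiliary
dot branch. Thus `w` moves from `C` to `Y`, and its own angle plays no role. -/
theorem Eqv.hub_dot_swap {V₀ J : Type} {c : Colour} (d : V₀ → Real.Angle) (x y : V₀) {l : J → Node}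
    {w : J} {β : Real.Angle} (hw : l w = .dot c.swap β)
    (C Y : Multiset (J ⊕ (I ⊕ O))) (W : Multiset (Sym2 (J ⊕ (I ⊕ O)))) :
    Eqv E (hubNet c d x y l (Sum.inl w ::ₘ C) Y W)
      (hubNet c d x y (Sum.elim l ![.dot c 0, .dot c.swap 0]) (C.map (Sum.map Sum.inl id))
        (Sum.inl (Sum.inl w) ::ₘ Y.map (Sum.map Sum.inl id))
        (embed Sum.inl W + {s(Sum.inl (Sum.inr 0), Sum.inl (Sum.inr 1)), s(Sum.inl (Sum.inr 0), Sum.inl (Sum.inr 1)),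
          s(Sum.inl (Sum.inr 0), Sum.inl (Sum.inr 1))})) := by
  -- Dots of angle `0` split off from `x`, `y` and `w` form, together with the hub, the bipartite
  -- square of the bialgebra rule.
  have h := Eqv.absorb_zeros_embed (E := E) 3 (l := hubLabel c d l)
    (u := ![Sum.inl x, Sum.inl y, Sum.inr (Sum.inr w)]) (c := ![c, c, c.swap]) (α := ![d x, d y, β])
    (by intro i; fin_cases i; exacts [rfl, rfl, hw])
    {s(Sum.inl (Sum.inr 0), Sum.inl (Sum.inl (Sum.inr (Sum.inl 0)))), s(Sum.inl (Sum.inr 1), Sum.inl (Sum.inl (Sum.inr (Sum.inl 0)))),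
      s(Sum.inl (Sum.inr 0), Sum.inl (Sum.inr 2)), s(Sum.inl (Sum.inr 1), Sum.inl (Sum.inr 2))} (hubWires x y C Y W)
  -- The dot of colour `c` produced by the bialgebra rule is absorbed by the auxiliary dot, which
  -- thereby becomes joined to the new hub and to `w`.
  have h' := Eqv.absorb_zero (E := E) (l := hubLabel c d (Sum.elim l ![.dot c 0, .dot c.swap 0]))
    (u := Sum.inr (Sum.inl 1)) rfl
    ({s(Sum.inl (Sum.inr ()), Sum.inl (Sum.inl (Sum.inr (Sum.inl 0)))),
      s(Sum.inl (Sum.inr ()), Sum.inl (Sum.inl (Sum.inr (Sum.inr (Sum.inl w))))),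
      s(Sum.inl (Sum.inl (Sum.inl x)), Sum.inl (Sum.inl (Sum.inr (Sum.inl 0)))),
      s(Sum.inl (Sum.inl (Sum.inl y)), Sum.inl (Sum.inl (Sum.inr (Sum.inl 0)))),
      s(Sum.inl (Sum.inl (Sum.inr (Sum.inr (Sum.inr 0)))),
           Sum.inl (Sum.inl (Sum.inr (Sum.inr (Sum.inr 1))))),
      s(Sum.inl (Sum.inl (Sum.inr (Sum.inr (Sum.inr 0)))),
           Sum.inl (Sum.inl (Sum.inr (Sum.inr (Sum.inr 1))))),
      s(Sum.inl (Sum.inl (Sum.inr (Sum.inr (Sum.inr 0)))),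
           Sum.inl (Sum.inl (Sum.inr (Sum.inr (Sum.inr 1)))))} +
      (star (Sum.inl (Sum.inr (Sum.inl 1))) (fun j => Sum.inl (Sum.inr (Sum.inr (Sum.inl j)))) Y +
      star (Sum.inl (Sum.inl x)) (fun j => Sum.inl (Sum.inr (Sum.inr (Sum.inl j)))) C +
      star (Sum.inl (Sum.inl y)) (fun j => Sum.inl (Sum.inr (Sum.inr (Sum.inl j)))) C +
      embed (fun j => Sum.inl (Sum.inr (Sum.inr (Sum.inl j)))) W))
  refine ((h.trans (Eqv.of_wires_eq ?_)).symm.trans ?_).trans (h'.trans (Eqv.of_wires_eq ?_))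
  · simp [hubWires, star_cons]
    simp only [← Multiset.singleton_add]
    abel
  rotate_left
  · simp [hubWires, star_cons, map_star, map_embed, star_map, embed_add, embed_cons,
      embed_singleton, embed_embed]
    simp only [Sym2.eq_swap, ← Multiset.singleton_add]
    abel
  clear h h'
  let e : Fin 4 ⊕ ((V₀ ⊕ Unit) ⊕ J) ≃ (V₀ ⊕ (Fin 2 ⊕ J)) ⊕ Fin 3 :=
    { toFun := Sum.elim ![.inr 0, .inr 1, .inr 2, .inl (.inr (.inl 0))]
        (Sum.elim (Sum.elim (fun v => .inl (.inl v)) fun _ => .inl (.inr (.inl 1)))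
          fun j => .inl (.inr (.inr j)))
      invFun := Sum.elim (Sum.elim (fun v => .inr (.inl (.inl v)))
        (Sum.elim ![.inl 3, .inr (.inl (.inr ()))] (fun j => .inr (.inr j)))) ![.inl 0, .inl 1, .inl 2]
      left_inv := by rintro (v | (v | v) | v) <;> (try fin_cases v) <;> rfl
      right_inv := by rintro ((v | v | v) | v) <;> (try fin_cases v) <;> rfl }
  let e' : Fin 4 ⊕ ((V₀ ⊕ Unit) ⊕ J) ≃ (V₀ ⊕ (Fin 2 ⊕ (J ⊕ Fin 2))) ⊕ Unit :=
    { toFun := Sum.elim ![.inl (.inr (.inl 0)), .inr (), .inl (.inr (.inr (.inr 0))),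
          .inl (.inr (.inr (.inr 1)))]
        (Sum.elim (Sum.elim (fun v => .inl (.inl v)) fun _ => .inl (.inr (.inl 1)))
          fun j => .inl (.inr (.inr (.inl j))))
      invFun := Sum.elim (Sum.elim (fun v => .inr (.inl (.inl v)))
        (Sum.elim ![.inl 0, .inr (.inl (.inr ()))]
          (Sum.elim (fun j => .inr (.inr j)) ![.inl 2, .inl 3]))) fun _ => .inl 1
      left_inv := by rintro (v | (v | v) | v) <;> (try fin_cases v) <;> rfl
      right_inv := by rintro ((v | v | v | v) | v) <;> (try fin_cases v) <;> rfl }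
  refine (Eqv.bialgebra_inverse c).replace (dotNet_wf _ _ _ _) e e'
    (Sum.elim (Sum.elim (fun v => .dot c (d v)) fun _ => .dot c 0) l)
    (Sum.elim ![.inl (.inl (.inl x)), .inl (.inl (.inl y))] ![.inl (.inr w), .inl (.inl (.inr ()))])
    (star (.inl (.inr ())) .inr Y + star (.inl (.inl x)) .inr C + star (.inl (.inl y)) .inr C +
      embed .inr W) ?_ ?_ ?_ ?_
  · rintro (v | (v | v) | v) <;> (try fin_cases v) <;> rfl
  · rintro (v | (v | v) | v) <;> (try fin_cases v) <;> rfl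
  · simp [e, hubWires, embed_add, embed_star, embed_embed, embed_cons, Fin.sum_univ_succ]
    simp only [Sym2.eq_swap, ← Multiset.singleton_add]
    abel
  · simp [e', embed_add, embed_star, embed_embed]
    simp only [Sym2.eq_swap, ← Multiset.singleton_add]
    abel

theorem map_embed_inl {V U P : Type} (f : U → V) (R : Multiset (Sym2 (V ⊕ P))) :
    (embed .inl R).map (Sym2.map (Sum.map (Sum.elim id f) id)) = R := by
  rw [embed, map_sym2_comp]
  refine (map_sym2_congr (g := id) (by rintro (v | v) <;> rfl) R).trans ?_
  rw [Sym2.map_id, Multiset.map_id]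

/-- A dot is absorbed; the wires `R` do not touch it. -/
theorem Eqv.absorb_embed {V : Type} {l l' : V → Node} {u : V} {c : Colour} {α β : Real.Angle}
    (hu : l u = .dot c α) (hu' : l' u = .dot c (α + β)) (hl : ∀ w, w ≠ u → l' w = l w) {k : ℕ}
    (hk : 1 ≤ k) (W : Multiset (Sym2 ((V ⊕ Unit) ⊕ (I ⊕ O)))) (R : Multiset (Sym2 (V ⊕ (I ⊕ O)))) :
    Eqv E ⟨V ⊕ Unit, Sum.elim l fun _ => .dot c β,
        Multiset.replicate k s(.inl (.inl u), .inl (.inr ())) + (W + embed .inl R)⟩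
      ⟨V, l', W.map (Sym2.map (Sum.map (Sum.elim id fun _ => u) id)) + R⟩ := by
  have h := Eqv.absorb (E := E) hu hu' hl k hk (W + embed .inl R)
  rwa [Multiset.map_add, map_embed_inl] at h

theorem hubLabel_update {V₀ J : Type} [DecidableEq V₀] {c : Colour} {d : V₀ → Real.Angle}
    {l : J → Node} {x : V₀} {α : Real.Angle} (v : V₀ ⊕ (Fin 2 ⊕ J)) (hv : v ≠ .inl x) :
    hubLabel c (Function.update d x α) l v = hubLabel c d l v := by
  rcases v with v | v
  · have : v ≠ x := fun h => hv (congrArg _ h)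
    simp [hubLabel, this]
  · rfl

/-- The Hadamard box in the common neighbourhood becomes a dot of the other colour. -/
theorem Eqv.hub_hadamard {V₀ J : Type} [DecidableEq V₀] (c : Colour) (d d' : V₀ → Real.Angle)
    (x y : V₀) (l : J → Node)
    (hd : d' = Function.update (Function.update d y (d y + (π / 2 : ℝ))) x
      (Function.update d y (d y + (π / 2 : ℝ)) x + (π / 2 : ℝ)))
    (C Y : Multiset (J ⊕ (I ⊕ O))) (W : Multiset (Sym2 (J ⊕ (I ⊕ O)))) :
    Eqv E (hubNet c d x y (Sum.elim l fun _ : Unit => .had)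
        (.inl (.inr ()) ::ₘ C.map (Sum.map .inl id)) (Y.map (Sum.map .inl id)) (embed .inl W))
      (hubNet c d' x y (Sum.elim l ![.dot c.swap (π / 2 : ℝ), .dot c 0, .dot c.swap 0,
          .dot c (-(π / 2) : ℝ)])
        (.inl (.inr 0) ::ₘ C.map (Sum.map .inl id)) (Y.map (Sum.map .inl id))
        (embed .inl W + {s(Sum.inl (Sum.inr 1), Sum.inl (Sum.inr 2)),
          s(Sum.inl (Sum.inr 1), Sum.inl (Sum.inr 2)),
          s(Sum.inl (Sum.inr 1), Sum.inl (Sum.inr 2))})) := by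
  -- The outer dots of the Euler decomposition are absorbed one after the other; for `x = y` the
  -- single dot thus receives `π/2` twice.
  set d₁ := Function.update d y (d y + (π / 2 : ℝ)) with hd₁
  let l' : J ⊕ Fin 4 → Node := Sum.elim l ![.dot c.swap (π / 2 : ℝ), .dot c 0, .dot c.swap 0,
          .dot c (-(π / 2) : ℝ)]
  let R : Multiset (Sym2 ((V₀ ⊕ (Fin 2 ⊕ (J ⊕ Fin 4))) ⊕ (I ⊕ O))) :=
    {s(Sum.inl (Sum.inl x), Sum.inl (Sum.inr (Sum.inl 0))),
      s(Sum.inl (Sum.inl y), Sum.inl (Sum.inr (Sum.inl 0)))} +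
      hubWires x y (C.map (Sum.map .inl id)) (Y.map (Sum.map .inl id))
      (embed .inl W + {s(Sum.inl (Sum.inr 1), Sum.inl (Sum.inr 2)),
          s(Sum.inl (Sum.inr 1), Sum.inl (Sum.inr 2)),
          s(Sum.inl (Sum.inr 1), Sum.inl (Sum.inr 2))})
  have h1 := Eqv.absorb_embed (E := E) (l := hubLabel c d₁ l') (l' := hubLabel c d' l')
    (u := Sum.inl x) (β := (π / 2 : ℝ)) rfl (by simp [hubLabel, hd])
    (fun v hv => by rw [hd]; exact hubLabel_update v hv) le_rfl
    {s(Sum.inl (Sum.inr ()), Sum.inl (Sum.inl (Sum.inr (Sum.inr (Sum.inr 0))))),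
      s(Sum.inl (Sum.inl (Sum.inl y)), Sum.inl (Sum.inl (Sum.inr (Sum.inr (Sum.inr 0)))))} R
  have h2 := Eqv.absorb_embed (E := E)
    (l := Sum.elim (hubLabel c d l') fun _ => .dot c (π / 2 : ℝ))
    (l' := Sum.elim (hubLabel c d₁ l') fun _ => .dot c (π / 2 : ℝ))
    (u := Sum.inl (Sum.inl y)) (β := (π / 2 : ℝ)) rfl (by simp [hubLabel, hd₁])
    (by
      rintro (v | v) hv
      · exact hubLabel_update v fun h => hv (congrArg _ h)
      · rfl) le_rfl
    {s(Sum.inl (Sum.inr ()), Sum.inl (Sum.inl (Sum.inl (Sum.inr (Sum.inr (Sum.inr 0))))))}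
    ({s(Sum.inl (Sum.inl (Sum.inl x)), Sum.inl (Sum.inr ())),
      s(Sum.inl (Sum.inr ()), Sum.inl (Sum.inl (Sum.inr (Sum.inr (Sum.inr 0)))))} + embed .inl R)
  refine Eqv.trans ?_ (h2.trans ((Eqv.of_wires_eq ?_).trans (h1.trans (Eqv.of_wires_eq ?_))))
  rotate_left
  · simp
    simp only [← Multiset.singleton_add]
    abel
  · simp [R, hubWires, star_cons]
    simp only [← Multiset.singleton_add]
    abel
  clear h1 h2
  let e : Fin 1 ⊕ (V₀ ⊕ (Fin 2 ⊕ J)) ≃ V₀ ⊕ (Fin 2 ⊕ (J ⊕ Unit)) :=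
    { toFun := Sum.elim (fun _ => .inr (.inr (.inr ())))
        (Sum.elim .inl (Sum.elim (fun i => .inr (.inl i)) fun j => .inr (.inr (.inl j))))
      invFun := Sum.elim (fun v => .inr (.inl v)) (Sum.elim (fun i => .inr (.inr (.inl i)))
        (Sum.elim (fun j => .inr (.inr (.inr j))) fun _ => .inl 0))
      left_inv := by rintro (v | v | v | v) <;> (try fin_cases v) <;> rfl
      right_inv := by rintro (v | v | v | v) <;> rfl }
  let e' : Fin 6 ⊕ (V₀ ⊕ (Fin 2 ⊕ J)) ≃ ((V₀ ⊕ (Fin 2 ⊕ (J ⊕ Fin 4))) ⊕ Unit) ⊕ Unit :=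
    { toFun := Sum.elim ![.inl (.inl (.inr (.inr (.inr 1)))), .inl (.inl (.inr (.inr (.inr 2)))),
          .inl (.inl (.inr (.inr (.inr 3)))), .inl (.inr ()), .inl (.inl (.inr (.inr (.inr 0)))),
          .inr ()]
        (Sum.elim (fun v => .inl (.inl (.inl v))) (Sum.elim (fun i => .inl (.inl (.inr (.inl i))))
          fun j => .inl (.inl (.inr (.inr (.inl j))))))
      invFun := Sum.elim (Sum.elim (Sum.elim (fun v => .inr (.inl v))
        (Sum.elim (fun i => .inr (.inr (.inl i)))
          (Sum.elim (fun j => .inr (.inr (.inr j))) ![.inl 4, .inl 0, .inl 1, .inl 2])))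
            fun _ => .inl 3) fun _ => .inl 5
      left_inv := by rintro (v | v | v | v) <;> (try fin_cases v) <;> rfl
      right_inv := by rintro (((v | v | v | v) | v) | v) <;> (try fin_cases v) <;> rfl }
  refine (Eqv.euler c).replace (hadamards (Fin 1)).net_wf e e' (hubLabel c d l)
    (Sum.elim ![.inl (.inl x)] ![.inl (.inl y)])
    ({s(Sum.inl (Sum.inl x), Sum.inl (Sum.inr (Sum.inl 0))),
      s(Sum.inl (Sum.inl y), Sum.inl (Sum.inr (Sum.inl 0)))} + hubWires x y C Y W) ?_ ?_ ?_ ?_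
  · rintro (v | v | v | v) <;> (try fin_cases v) <;> rfl
  · rintro (v | v | v | v) <;> (try fin_cases v) <;> rfl
  · simp [e, hubWires, star_cons, embed_add, embed_star, embed_embed, embed_cons,
      star_map]
    simp only [Sym2.eq_swap (a := Sum.inl (Sum.inr (Sum.inr (Sum.inr ())))),
      ← Multiset.singleton_add]
    abel
  · simp [e', R, hubWires, embed_add, embed_star, embed_embed, embed_cons, embed_singleton,
      star_map]
    simp only [Sym2.eq_swap (a := Sum.inl (Sum.inr ())), ← Multiset.singleton_add]
    abel

theorem exists_eq_map {A B : Type} (f : A → B) (m : Multiset B) (h : ∀ x ∈ m, ∃ y, f y = x) :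
    ∃ m' : Multiset A, m = m'.map f := by
  choose g hg using h
  refine ⟨m.attach.map fun x => g x.1 x.2, ?_⟩
  rw [Multiset.map_map]
  refine (Multiset.attach_map_val m).symm.trans (Multiset.map_congr rfl fun x _ => (hg _ _).symm)

theorem not_mem_of_degree_star {V J P : Type} {a : V} {g : J → V} {C : Multiset (J ⊕ P)} {j : J}
    (h : degree (star a g C) (.inl (g j)) = 0) : .inl j ∉ C := fun hj =>
  degree_eq_zero_iff.1 h s(.inl a, .inl (g j)) (Multiset.mem_map.2 ⟨_, hj, rfl⟩) (by simp)

/-- A binary node in the common neighbourhood has no other neighbours. -/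
theorem hub_split {V₀ J : Type} {c : Colour} {d : V₀ → Real.Angle} {x y : V₀} {l : J → Node} {h : J}
    (hb : (l h).IsBinary) {C Y : Multiset (J ⊕ (I ⊕ O))} {W : Multiset (Sym2 (J ⊕ (I ⊕ O)))}
    (hWF : (hubNet c d x y l (.inl h ::ₘ C) Y W).WF) :
    ∃ (K : Type) (e : K ⊕ Unit ≃ J) (C' Y' : Multiset (K ⊕ (I ⊕ O)))
      (W' : Multiset (Sym2 (K ⊕ (I ⊕ O)))), e (.inr ()) = h ∧
      C = (C'.map (Sum.map .inl id)).map (Sum.map e id) ∧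
      Y = (Y'.map (Sum.map .inl id)).map (Sum.map e id) ∧ W = embed e (embed .inl W') := by
  have h2 := hWF.degree_binary (.inr (.inr h)) hb
  simp only [hubWires, star_cons] at h2
  simp only [Multiset.insert_eq_cons, ← Multiset.singleton_add, degree_add, degree_singleton] at h2
  simp only [reduceCtorEq, ind_false, Sum.inl.injEq, Sum.inr.injEq, Sum.map_inl, ind_true] at h2
  -- The wires to `x` and `y` already exhaust the degree two of `h`, so every other contribution
  -- vanishes.
  have hC : .inl h ∉ C :=
    not_mem_of_degree_star (a := Sum.inl x) (g := fun j => Sum.inr (Sum.inr j)) (by omega)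
  have hY : .inl h ∉ Y :=
    not_mem_of_degree_star (V := V₀ ⊕ (Fin 2 ⊕ J)) (a := Sum.inr (Sum.inl 1)) (g := fun j => Sum.inr (Sum.inr j)) (by omega)
  have hW : degree W (.inl h) = 0 := by
    rw [← degree_map_injective (f := Sum.map (fun j => (Sum.inr (Sum.inr j) : V₀ ⊕ (Fin 2 ⊕ J))) id)
      (Sum.map_injective.2 ⟨fun _ _ h => by simpa using h, Function.injective_id⟩)]
    change degree (embed _ W) _ = 0
    simp only [Sum.map_inl]
    omega
  let e : {w // w ≠ h} ⊕ Unit ≃ J := Equiv.ofBijective (Sum.elim Subtype.val fun _ => h) (by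
    constructor
    · rintro (⟨x, hx⟩ | x) (⟨y, hy⟩ | y) hxy
      · simpa using hxy
      · exact absurd hxy hx
      · exact absurd hxy.symm hy
      · rfl
    · intro w
      by_cases hw : w = h
      · exact ⟨.inr (), hw.symm⟩
      · exact ⟨.inl ⟨w, hw⟩, rfl⟩)
  have key : ∀ w : J ⊕ (I ⊕ O), w ≠ .inl h →
      ∃ w' : {w // w ≠ h} ⊕ (I ⊕ O), Sum.map e id (Sum.map .inl id w') = w := by
    rintro (w | w) hw
    · exact ⟨.inl ⟨w, fun h => hw (congrArg _ h)⟩, rfl⟩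
    · exact ⟨.inr w, rfl⟩
  obtain ⟨C', hC'⟩ := exists_eq_map _ C fun w hw => key w (ne_of_mem_of_not_mem hw hC)
  obtain ⟨Y', hY'⟩ := exists_eq_map _ Y fun w hw => key w (ne_of_mem_of_not_mem hw hY)
  obtain ⟨W', hW'⟩ := exists_eq_map_of_degree_eq_zero
    (fun w : {w // w ≠ h} ⊕ (I ⊕ O) => Sum.map e id (Sum.map .inl id w)) W fun w hw => by
      by_cases hwh : w = .inl h
      · rw [hwh, hW]
      · obtain ⟨w', hw'⟩ := key w hwh
        exact absurd hw' (hw w')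
  refine ⟨_, e, C', Y', W', rfl, ?_, ?_, ?_⟩
  · rw [hC', Multiset.map_map]; rfl
  · rw [hY', Multiset.map_map]; rfl
  · rw [hW', embed, embed, map_sym2_comp]

theorem Eqv.hub_iso {V₀ J K : Type} (c : Colour) (d : V₀ → Real.Angle) (x y : V₀) (l : J → Node)
    (e : K ≃ J) (C Y : Multiset (K ⊕ (I ⊕ O))) (W : Multiset (Sym2 (K ⊕ (I ⊕ O)))) :
    Eqv E (hubNet c d x y l (C.map (Sum.map e id)) (Y.map (Sum.map e id)) (embed e W))
      (hubNet c d x y (fun k => l (e k)) C Y W) := by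
  refine (Eqv.iso ((Equiv.refl V₀).sumCongr ((Equiv.refl (Fin 2)).sumCongr e)) ?_ ?_).symm
  · rintro (v | v | v) <;> rfl
  · simp [hubWires, map_star, map_embed, star_map, embed_embed]

/-- A marked point in the common neighbourhood: the wire through it joins the two dots. -/
theorem Eqv.hub_joint {V₀ J : Type} {c : Colour} {d : V₀ → Real.Angle} {x y : V₀} {l : J → Node}
    {C Y : Multiset (J ⊕ (I ⊕ O))} {W : Multiset (Sym2 (J ⊕ (I ⊕ O)))}
    (hWF : (hubNet c d x y (Sum.elim l fun _ : Unit => .joint)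
      (.inl (.inr ()) ::ₘ C.map (Sum.map .inl id)) (Y.map (Sum.map .inl id)) (embed .inl W)).WF) :
    Eqv E (hubNet c d x y (Sum.elim l fun _ : Unit => .joint)
        (.inl (.inr ()) ::ₘ C.map (Sum.map .inl id)) (Y.map (Sum.map .inl id)) (embed .inl W))
      ⟨V₀ ⊕ (Fin 2 ⊕ J), hubLabel c d l, s(.inl (.inl x), .inl (.inl y)) ::ₘ
        (hubNet c d x y l C Y W).wires⟩ := by
  let N : Net (I ⊕ O) := ⟨(V₀ ⊕ (Fin 2 ⊕ J)) ⊕ Unit, Sum.elim (hubLabel c d l) fun _ => .joint,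
    s(.inl (.inr ()), leftPt (.inl (.inl x))) ::ₘ s(.inl (.inl (.inl y)), .inl (.inr ())) ::ₘ
      embed .inl (hubNet c d x y l C Y W).wires⟩
  let e : (V₀ ⊕ (Fin 2 ⊕ J)) ⊕ Unit ≃ V₀ ⊕ (Fin 2 ⊕ (J ⊕ Unit)) :=
    { toFun := Sum.elim (Sum.elim .inl (Sum.elim (fun i => .inr (.inl i))
        fun j => .inr (.inr (.inl j)))) fun _ => .inr (.inr (.inr ()))
      invFun := Sum.elim (fun v => .inl (.inl v)) (Sum.elim (fun i => .inl (.inr (.inl i)))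
        (Sum.elim (fun j => .inl (.inr (.inr j))) fun _ => .inr ()))
      left_inv := by rintro ((v | v | v) | v) <;> rfl
      right_inv := by rintro (v | v | v | v) <;> rfl }
  have h : Eqv E N (hubNet c d x y (Sum.elim l fun _ : Unit => .joint)
      (.inl (.inr ()) ::ₘ C.map (Sum.map .inl id)) (Y.map (Sum.map .inl id)) (embed .inl W)) := by
    refine Eqv.iso e ?_ ?_
    · rintro ((v | v | v) | v) <;> rfl
    · simp [N, e, hubWires, leftPt, star_cons, embed_add, embed_star, embed_embed, embed_cons,
        map_star, map_embed, star_map]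
      simp only [Sym2.eq_swap (a := Sum.inl (Sum.inr (Sum.inr (Sum.inr ())))),
        ← Multiset.singleton_add]
      abel
  refine h.symm.trans ((Eqv.contract_one _ (h.1.2 hWF)).trans (Eqv.of_wires_eq ?_))
  have hR : ∀ R : Multiset (Sym2 ((V₀ ⊕ (Fin 2 ⊕ J)) ⊕ (I ⊕ O))),
      (embed .inl R).map (Sym2.map (replaceBy fun _ : Unit => .inl (.inl x))) = R := by
    intro R
    rw [embed, map_sym2_comp]
    refine (map_sym2_congr (g := id) (by rintro (v | v) <;> rfl) R).trans ?_
    rw [Sym2.map_id, Multiset.map_id]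
  rw [Multiset.map_cons, hR, Sym2.map_mk, Sym2.eq_swap]
  rfl

/-- The wires of `hubNet` when the dots `x` and `y` have been merged with the node `w`. -/
abbrev mergedWires {J P : Type} (w : J) (C Y : Multiset (J ⊕ P)) (W : Multiset (Sym2 (J ⊕ P))) :
    Multiset (Sym2 ((Fin 2 ⊕ J) ⊕ P)) :=
  {s(Sum.inl (Sum.inr w), Sum.inl (Sum.inl 0)), s(Sum.inl (Sum.inr w), Sum.inl (Sum.inl 0)),
    s(Sum.inl (Sum.inl 0), Sum.inl (Sum.inl 1))} + star (Sum.inl 1) Sum.inr Y +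
    star (Sum.inr w) Sum.inr C + star (Sum.inr w) Sum.inr C + embed Sum.inr W

/-- A neighbour of the twins' own colour can absorb both by fusion. The result coincides with that
of `Eqv.hub_dot_single`, which closes this case without supplementarity. -/
theorem Eqv.hub_dot_pair {J : Type} [DecidableEq J] {c : Colour} (d : Bool → Real.Angle)
    {l : J → Node} {w : J} {β : Real.Angle} (hw : l w = .dot c β) (C Y : Multiset (J ⊕ (I ⊕ O)))
    (W : Multiset (Sym2 (J ⊕ (I ⊕ O)))) :
    Eqv E (hubNet c d true false l (.inl w ::ₘ C) Y W)
      ⟨Fin 2 ⊕ J, Sum.elim ![.dot c.swap 0, .dot c 0]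
        (Function.update l w (.dot c (β + d true + d false))), mergedWires w C Y W⟩ := by
  let l₀ : Fin 2 ⊕ J → Node := Sum.elim ![.dot c.swap 0, .dot c 0] l
  let l₁ : Fin 2 ⊕ J → Node := Sum.elim ![.dot c.swap 0, .dot c 0]
    (Function.update l w (.dot c (β + d true)))
  let l₂ : Fin 2 ⊕ J → Node := Sum.elim ![.dot c.swap 0, .dot c 0]
    (Function.update l w (.dot c (β + d true + d false)))
  let R : Multiset (Sym2 ((Fin 2 ⊕ J) ⊕ (I ⊕ O))) :=
    {s(Sum.inl (Sum.inl 0), Sum.inl (Sum.inl 1))} + star (Sum.inl 1) Sum.inr Y + embed Sum.inr W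
  have h1 := Eqv.absorb_embed (E := E) (l := l₁) (l' := l₂) (u := Sum.inr w) (α := β + d true)
    (β := d false) (Function.update_self ..) (Function.update_self ..)
    (by
      rintro (v | v) hv
      · rfl
      · have : v ≠ w := fun h => hv (congrArg _ h)
        exact (Function.update_of_ne this _ l).trans (Function.update_of_ne this _ l).symm) le_rfl
    ({s(Sum.inl (Sum.inr ()), Sum.inl (Sum.inl (Sum.inl 0)))} +
      star (Sum.inr ()) (fun j => Sum.inl (Sum.inr j)) C)
    ({s(Sum.inl (Sum.inr w), Sum.inl (Sum.inl 0))} + star (Sum.inr w) Sum.inr C + R)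
  have h2 := Eqv.absorb_embed (E := E) (l := Sum.elim l₀ fun _ => .dot c (d false))
    (l' := Sum.elim l₁ fun _ => .dot c (d false)) (u := Sum.inl (Sum.inr w)) (α := β)
    (β := d true) hw (Function.update_self ..)
    (by
      rintro ((v | v) | v) hv
      · rfl
      · have : v ≠ w := fun h => hv (congrArg (fun x => Sum.inl (Sum.inr x)) h)
        exact Function.update_of_ne this _ l
      · rfl) le_rfl
    ({s(Sum.inl (Sum.inr ()), Sum.inl (Sum.inl (Sum.inl (Sum.inl 0))))} +
      star (Sum.inr ()) (fun j => Sum.inl (Sum.inl (Sum.inr j))) C)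
    ({s(Sum.inl (Sum.inl (Sum.inr w)), Sum.inl (Sum.inr ()))} +
      {s(Sum.inl (Sum.inr ()), Sum.inl (Sum.inl (Sum.inl 0)))} +
      star (Sum.inr ()) (fun j => Sum.inl (Sum.inr j)) C + embed .inl R)
  let e : ((Fin 2 ⊕ J) ⊕ Unit) ⊕ Unit ≃ Bool ⊕ (Fin 2 ⊕ J) :=
    { toFun := Sum.elim (Sum.elim .inr fun _ => .inl false) fun _ => .inl true
      invFun := Sum.elim (fun b => bif b then .inr () else .inl (.inr ())) fun v => .inl (.inl v)
      left_inv := by rintro ((v | v) | v) <;> rfl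
      right_inv := by rintro ((v | v) | v) <;> rfl }
  refine Eqv.trans (Eqv.iso e ?_ ?_).symm
    (h2.trans ((Eqv.of_wires_eq ?_).trans (h1.trans (Eqv.of_wires_eq ?_))))
  · rintro (((v | v) | v) | v) <;> rfl
  · simp [e, R, hubWires, star_cons, embed_add, embed_star, embed_embed, embed_cons,
      map_star, map_embed]
    simp only [Sym2.eq_swap (b := Sum.inl (Sum.inl _)), ← Multiset.singleton_add]
    abel
  · simp [map_star, embed_add, embed_cons, embed_star]
    simp only [← Multiset.singleton_add]
    abel
  · simp [R, mergedWires, map_star]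
    simp only [← Multiset.singleton_add]
    abel

/-- Two parallel wires join the merged dot to `w`, and S1 fuses along both at once. The neighbours
in `C` appear twice, as they do after the absorption of a pair. -/
theorem Eqv.hub_dot_single {J : Type} [DecidableEq J] {c : Colour} (d : Unit → Real.Angle)
    {l : J → Node} {w : J} {β : Real.Angle} (hw : l w = .dot c β) (C Y : Multiset (J ⊕ (I ⊕ O)))
    (W : Multiset (Sym2 (J ⊕ (I ⊕ O)))) :
    Eqv E (hubNet c d () () l (.inl w ::ₘ C) Y W)
      ⟨Fin 2 ⊕ J, Sum.elim ![.dot c.swap 0, .dot c 0]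
        (Function.update l w (.dot c (β + d ()))), mergedWires w C Y W⟩ := by
  have h := Eqv.absorb_embed (E := E)
    (l := (Sum.elim ![.dot c.swap 0, .dot c 0] l : Fin 2 ⊕ J → Node))
    (l' := Sum.elim ![.dot c.swap 0, .dot c 0] (Function.update l w (.dot c (β + d ()))))
    (u := Sum.inr w) (α := β) (β := d ()) (k := 2) hw (Function.update_self ..)
    (by
      rintro (v | v) hv
      · rfl
      · have : v ≠ w := fun h => hv (congrArg _ h)
        exact Function.update_of_ne this _ l) one_le_two
    ({s(Sum.inl (Sum.inr ()), Sum.inl (Sum.inl (Sum.inl 0))),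
      s(Sum.inl (Sum.inr ()), Sum.inl (Sum.inl (Sum.inl 0)))} +
      star (Sum.inr ()) (fun j => Sum.inl (Sum.inr j)) C +
      star (Sum.inr ()) (fun j => Sum.inl (Sum.inr j)) C)
    ({s(Sum.inl (Sum.inl 0), Sum.inl (Sum.inl 1))} + star (Sum.inl 1) Sum.inr Y + embed Sum.inr W)
  refine Eqv.trans (Eqv.iso (Equiv.sumComm _ _) ?_ ?_).symm (h.trans (Eqv.of_wires_eq ?_))
  · rintro ((v | v) | v) <;> rfl
  · simp [hubWires, star_cons, embed_add, embed_star, embed_embed, embed_cons,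
      map_star, map_embed]
    simp only [Sym2.eq_swap (b := Sum.inl (Sum.inl _)), ← Multiset.singleton_add]
    abel
  · simp [mergedWires, map_star]
    simp only [← Multiset.singleton_add]
    abel

/-! ### Merging a pair by induction on its common neighbourhood. -/

/-- Supplementarity for dots of colour `c` as an equation between nets. -/
def SupplementarityFor (E : Equations) (c : Colour) : Prop :=
  ∀ α : Real.Angle, Eqv E (I := Fin 0) (O := Fin 1)
    (dotNet ![(c, α), (c, α + (π : ℝ)), (c.swap, 0)] ![] ![2] {s(0, 2), s(1, 2)})
    (dotNet ![(c, α + α + (π : ℝ)), (c.swap, 0)] ![] ![1] {s(0, 1), s(0, 1)})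

/-- With `C` empty, the pair and the hub form the left side of supplementarity, the auxiliary dot
sitting at its output. The angle on the right agrees because `2α + π` is the sum of the two angles.
-/
theorem Eqv.hub_supplementarity {J : Type} {c : Colour} (hE : SupplementarityFor E c)
    (d : Bool → Real.Angle) (hd : d false = d true + (π : ℝ)) (l : J → Node)
    (Y : Multiset (J ⊕ (I ⊕ O))) (W : Multiset (Sym2 (J ⊕ (I ⊕ O)))) :
    Eqv E (hubNet c d true false l 0 Y W)
      (hubNet c (fun _ => d true + d false) () () l 0 Y W) := by
  let e : Fin 3 ⊕ (Unit ⊕ J) ≃ Bool ⊕ (Fin 2 ⊕ J) :=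
    { toFun := Sum.elim ![.inl true, .inl false, .inr (.inl 0)]
        (Sum.elim (fun _ => .inr (.inl 1)) fun j => .inr (.inr j))
      invFun := Sum.elim (fun b => bif b then .inl 0 else .inl 1)
        (Sum.elim ![.inl 2, .inr (.inl ())] fun j => .inr (.inr j))
      left_inv := by rintro (v | v | v) <;> (try fin_cases v) <;> rfl
      right_inv := by rintro ((v | v) | v | v) <;> (try fin_cases v) <;> rfl }
  let e' : Fin 2 ⊕ (Unit ⊕ J) ≃ Unit ⊕ (Fin 2 ⊕ J) :=
    { toFun := Sum.elim ![.inl (), .inr (.inl 0)]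
        (Sum.elim (fun _ => .inr (.inl 1)) fun j => .inr (.inr j))
      invFun := Sum.elim (fun _ => .inl 0)
        (Sum.elim ![.inl 1, .inr (.inl ())] fun j => .inr (.inr j))
      left_inv := by rintro (v | v | v) <;> (try fin_cases v) <;> rfl
      right_inv := by rintro (v | v | v) <;> (try fin_cases v) <;> rfl }
  refine (hE (d true)).replace (dotNet_wf _ _ _ _) e e' (Sum.elim (fun _ => .dot c 0) l)
    (Sum.elim ![] ![.inl (.inl ())])
    (star (.inl ()) .inr Y + embed .inr W) ?_ ?_ ?_ ?_
  · rintro (v | v | v) <;> (try fin_cases v)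
    exacts [rfl, congrArg (Node.dot c) hd, rfl, rfl, rfl]
  · rintro (v | v | v) <;> (try fin_cases v)
    exacts [congrArg (Node.dot c) (by rw [hd]; exact (add_assoc _ _ _).symm), rfl, rfl, rfl]
  · simp [e, hubWires, star_zero, embed_add, embed_star, embed_embed]
    simp only [← Multiset.singleton_add]
    abel
  · simp [e', hubWires, star_zero, embed_add, embed_star, embed_embed]
    simp only [← Multiset.singleton_add]
    abel

theorem Colour.eq_or_eq_swap (c c' : Colour) : c' = c ∨ c' = c.swap := by
  cases c <;> cases c' <;> simp [Colour.swap]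

/-- For twins that turn out to be joined through a marked point. -/
theorem Eqv.hub_fuse {J : Type} (c : Colour) (d : Bool → Real.Angle) (l : J → Node)
    (C Y : Multiset (J ⊕ (I ⊕ O))) (W : Multiset (Sym2 (J ⊕ (I ⊕ O)))) :
    Eqv E ⟨Bool ⊕ (Fin 2 ⊕ J), hubLabel c d l, s(.inl (.inl true), .inl (.inl false)) ::ₘ
        (hubNet c d true false l C Y W).wires⟩
      (hubNet c (fun _ => d true + d false) () () l C Y W) := by
  refine Eqv.fuse (c := c) (α := d true) (β := d false) (Sum.map (fun _ => ()) id) (.inl true)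
    (.inl false) 1 (hubNet c d true false l C Y W).wires le_rfl
    (fun h => Bool.noConfusion (Sum.inl_injective h)) rfl rfl rfl ?_ ?_ rfl ?_
    (Multiset.singleton_add _ _).symm ?_
  · rintro (v | v)
    exacts [⟨.inl true, rfl⟩, ⟨.inr v, rfl⟩]
  · rintro ((_ | _) | v) ((_ | _) | v') h h' hvv'
    all_goals first | rfl | exact absurd rfl h | exact absurd rfl h' | exact (Sum.inl_ne_inr hvv').elim | exact (Sum.inr_ne_inl hvv').elim | exact congrArg _ (Sum.inr_injective hvv')
  · rintro ((_ | _) | v) h h'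
    exacts [absurd rfl h', absurd rfl h, rfl]
  · simp [hubWires, map_star, map_embed]

/-- Contracting a marked point on the merged side presupposes a well-formed net. Identifying the two
dots changes no degree at a binary node or at a port, and dots have no degree condition. -/
theorem hub_wf_merge {J P : Type} {c : Colour} {d : Bool → Real.Angle} (d' : Unit → Real.Angle)
    {l : J → Node} {C Y : Multiset (J ⊕ P)} {W : Multiset (Sym2 (J ⊕ P))}
    (h : (hubNet c d true false l C Y W).WF) : (hubNet c d' () () l C Y W).WF := by
  have hW : (hubNet c d' () () l C Y W).wires = (hubNet c d true false l C Y W).wires.map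
      (Sym2.map (Sum.map (Sum.map (fun _ => ()) id) id)) := by
    simp [hubWires, map_star, map_embed]
  refine ⟨have := h.finite; Finite.of_surjective (Sum.map (fun _ => ()) id :
    Bool ⊕ (Fin 2 ⊕ J) → Unit ⊕ (Fin 2 ⊕ J)) (by
      rintro (v | v); exacts [⟨.inl true, rfl⟩, ⟨.inr v, rfl⟩]), ?_, fun p => ?_⟩
  · rintro (v | v) hv
    · exact hv.elim
    · refine (congrArg (degree · _) hW).trans (Eq.trans ?_ (h.degree_binary (.inr v) hv))
      exact degree_map_eq (Sum.map (Sum.map (fun _ => ()) id) id) _ (.inl (.inr v))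
        (by rintro ((w | w) | w) hw <;> simp_all)
  · refine (congrArg (degree · _) hW).trans (Eq.trans ?_ (h.degree_port p))
    exact degree_map_eq (Sum.map (Sum.map (fun _ => ()) id) id) _ (.inr p)
      (by rintro ((w | w) | w) hw <;> simp_all)

/-- Every move that removes a common neighbour is performed on the pair and on the merged dot, so it
suffices to treat what remains. Node type, angles, `Y` and `W` must vary in the induction, because
the moves add scalars, shift the angles and transfer neighbours to the auxiliary dot. -/
theorem Eqv.hub_merge {c : Colour} (hE : SupplementarityFor E c) (n : ℕ) :
    ∀ {J : Type} (d : Bool → Real.Angle), d false = d true + (π : ℝ) → ∀ (l : J → Node)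
      (C Y : Multiset (J ⊕ (I ⊕ O))) (W : Multiset (Sym2 (J ⊕ (I ⊕ O)))), C.card = n →
      (hubNet c d true false l C Y W).WF →
      Eqv E (hubNet c d true false l C Y W)
        (hubNet c (fun _ => d true + d false) () () l C Y W) := by
  classical
  induction n with
  | zero =>
    intro J d hd l C Y W hC hWF
    rw [Multiset.card_eq_zero.1 hC]
    exact Eqv.hub_supplementarity hE d hd l Y W
  | succ n ih =>
    intro J d hd l C Y W hC hWF
    -- This case is isolated since a Hadamard box is first turned into such a dot, without making
    -- `C` smaller.
    have hdot : ∀ {J : Type} (d : Bool → Real.Angle), d false = d true + (π : ℝ) →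
        ∀ (l : J → Node) (w : J) (β : Real.Angle), l w = .dot c.swap β →
        ∀ (C Y : Multiset (J ⊕ (I ⊕ O))) (W : Multiset (Sym2 (J ⊕ (I ⊕ O)))), C.card = n →
        (hubNet c d true false l (.inl w ::ₘ C) Y W).WF →
        Eqv E (hubNet c d true false l (.inl w ::ₘ C) Y W)
          (hubNet c (fun _ => d true + d false) () () l (.inl w ::ₘ C) Y W) := by
      intro J d hd l w β hw C Y W hC hWF
      have h := Eqv.hub_dot_swap (E := E) d true false hw C Y W
      exact h.trans ((ih d hd _ _ _ _ (by rw [Multiset.card_map, hC]) (h.1.1 hWF)).trans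
        (Eqv.hub_dot_swap _ _ _ hw C Y W).symm)
    obtain ⟨w, hwC⟩ := Multiset.card_pos_iff_exists_mem.1 (by omega : 0 < C.card)
    obtain ⟨C, rfl⟩ := Multiset.exists_cons_of_mem hwC
    rw [Multiset.card_cons, Nat.add_right_cancel_iff] at hC
    rcases w with w | p
    · cases hw : l w with
      | dot c' β =>
        rcases Colour.eq_or_eq_swap c c' with rfl | rfl
        -- Both sides collapse to the same net, by associativity of the sum of angles.
        · refine (Eqv.hub_dot_pair d hw C Y W).trans ?_
          rw [add_assoc]
          exact (Eqv.hub_dot_single (fun _ => d true + d false) hw C Y W).symm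
        · exact hdot d hd l w β hw C Y W hC hWF
      | had =>
        obtain ⟨K, e, C, Y, W, rfl, rfl, rfl, rfl⟩ := hub_split (by rw [hw]; trivial) hWF
        obtain ⟨l₀, hl₀⟩ : ∃ l₀ : K → Node, (fun k => l (e k)) = Sum.elim l₀ fun _ => .had :=
          ⟨fun k => l (e (.inl k)), funext fun k => by rcases k with k | k; exacts [rfl, hw]⟩
        -- The Euler move is needed for the pair and, backwards, for the merged dot. In both cases
        -- the total angle grows by `π`.
        have key : ∀ {V₀ : Type} [DecidableEq V₀] (d d' : V₀ → Real.Angle) (x y : V₀),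
            d' = Function.update (Function.update d y (d y + (π / 2 : ℝ))) x
              (Function.update d y (d y + (π / 2 : ℝ)) x + (π / 2 : ℝ)) → Eqv E _ _ :=
          fun d d' x y hd => (Eqv.hub_iso (E := E) c d x y l e
            (.inl (.inr ()) ::ₘ C.map (Sum.map .inl id)) (Y.map (Sum.map .inl id))
            (embed .inl W)).trans (hl₀ ▸ Eqv.hub_hadamard c d d' x y l₀ hd C Y W)
        rw [Multiset.map_cons] at key
        have h1 := key d (fun b => d b + (π / 2 : ℝ)) true false
          (by funext b; cases b <;> simp)
        refine h1.trans ((hdot _ ?_ (Sum.elim l₀ ![.dot c.swap (π / 2 : ℝ), .dot c 0,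
          .dot c.swap 0, .dot c (-(π / 2) : ℝ)]) (.inr 0) _ rfl _ _ _ ?_ (h1.1.1 hWF)).trans
          (key (fun _ : Unit => d true + d false) _ () () ?_).symm)
        · simp only [hd]
          abel
        · simpa using hC
        · funext u
          simp only [Function.update_self]
          abel
      | joint =>
        obtain ⟨K, e, C, Y, W, rfl, rfl, rfl, rfl⟩ := hub_split (by rw [hw]; trivial) hWF
        obtain ⟨l₀, hl₀⟩ : ∃ l₀ : K → Node, (fun k => l (e k)) = Sum.elim l₀ fun _ => .joint :=
          ⟨fun k => l (e (.inl k)), funext fun k => by rcases k with k | k; exacts [rfl, hw]⟩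
        have key : ∀ {V₀ : Type} (d : V₀ → Real.Angle) (x y : V₀), Eqv E _ _ := fun d x y =>
          Eqv.hub_iso (E := E) c d x y l e (.inl (.inr ()) ::ₘ C.map (Sum.map .inl id))
            (Y.map (Sum.map .inl id)) (embed .inl W)
        rw [Multiset.map_cons, hl₀] at key
        have h1 := key d true false
        have h2 := key (fun _ : Unit => d true + d false) () ()
        -- For the pair, the wire through the marked point permits fusion; for the merged dot it is
        -- a loop, which can be removed or put in at will.
        have h3 := Eqv.hub_joint (E := E) (h1.1.1 hWF)
        have hf := Eqv.hub_fuse (E := E) c d l₀ C Y W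
        refine h1.trans (h3.trans (hf.trans (Eqv.trans ?_ h2.symm)))
        have hloop := Eqv.remove_loop (E := E) (l := hubLabel c (fun _ : Unit => d true + d false) l₀)
          (u := .inl ()) rfl (hubNet c (fun _ : Unit => d true + d false) () () l₀ C Y W).wires
        exact hloop.symm.trans (Eqv.hub_joint (hub_wf_merge _ (h1.1.1 hWF))).symm
    -- A port in `C` would carry a wire from each of the two dots.
    · have h1 := hWF.degree_port p
      simp only [hubWires, star_cons] at h1
      simp only [degree_add, degree_singleton] at h1
      simp only [Sum.map_inr, id, ind_true] at h1
      omega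

/-- The merge of two dots with angles that differ by `π` and with a common neighbourhood. -/
theorem Eqv.pair_merge {c : Colour} (hE : SupplementarityFor E c) {J : Type} (d : Bool → Real.Angle)
    (hd : d false = d true + (π : ℝ)) (l : J → Node) (C : Multiset (J ⊕ (I ⊕ O)))
    (W : Multiset (Sym2 (J ⊕ (I ⊕ O)))) (hWF : (pairNet c d true false l C W).WF) :
    Eqv E (pairNet c d true false l C W)
      (pairNet c (fun _ => d true + d false) () () l C W) := by
  have h := Eqv.start_hub (E := E) c d true false l C W
  exact h.trans ((Eqv.hub_merge hE _ d hd _ _ _ _ rfl (h.1.1 hWF)).trans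
    (Eqv.start_hub c _ () () l C W).symm)

/-! ### Supplementarity with the colours exchanged. -/

/-- A dot with a Hadamard box on every leg. -/
abbrev hadamardSpider (O : Type) [Fintype O] (c : Colour) (α : Real.Angle) : Net (Fin 0 ⊕ O) where
  V := Unit ⊕ O
  label := Sum.elim (fun _ => .dot c α) fun _ => .had
  wires := ∑ o, {s(.inl (.inr o), .inr (.inr o))} + ∑ o, {s(.inl (.inl ()), .inl (.inr o))}

/-- This is (H) without inputs. The marked points that `subdivide` places between the dot and the
boxes are those created by the sequential composition in the rule. -/
theorem Eqv.colour_change (O : Type) [Fintype O] (c : Colour) (α : Real.Angle) :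
    Eqv E (hadamardSpider O c α)
      (dotNet (fun _ : Unit => (c.swap, α)) (fun _ : Fin 0 => ()) (fun _ : O => ()) 0) := by
  have h := Eqv.subdivide (E := E) (I := Fin 0) (O := O)
    (Sum.elim (fun _ => .dot c α) fun _ => .had : Unit ⊕ O → Node)
    (fun _ : O => .inl (.inl ())) (fun o => .inl (.inr o)) (∑ o, {s(.inl (.inr o), .inr (.inr o))})
  let e : (Unit ⊕ O) ⊕ O ≃ (((Fin 0 ⊕ Unit) ⊕ Fin 0) ⊕ O) ⊕ O :=
    { toFun := Sum.elim (Sum.elim (fun _ => .inl (.inl (.inl (.inr ())))) fun o => .inl (.inr o))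
        fun o => .inr o
      invFun := Sum.elim (Sum.elim (fun _ => .inl (.inl ())) fun o => .inl (.inr o)) .inr
      left_inv := by rintro ((v | v) | v) <;> rfl
      right_inv := by
        rintro ((((v | v) | v) | v) | v)
        exacts [v.elim0, rfl, v.elim0, rfl, rfl] }
  have hW : (((hadamards (Fin 0)).comp (spider (Fin 0) O Z α)).comp (hadamards O)).wires =
      Multiset.map (Sym2.map (Sum.map e id))
        (∑ o : O, {s(Sum.inl (Sum.inr o), leftPt (Sum.inl (Sum.inr o)))} +
          (Multiset.map (Sym2.map leftPt)
            (∑ o : O, ({s(Sum.inl (Sum.inr o), Sum.inr (Sum.inr o))} :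
              Multiset (Sym2 ((Unit ⊕ O) ⊕ (Fin 0 ⊕ O))))) +
          ∑ o : O, {s(leftPt (Sum.inl (Sum.inl ())), Sum.inl (Sum.inr o))})) := by
    simp only [comp, hadamards, spider, ofDots, univ_val_map]
    simp [map_fsum, e, compFirst, compSecond, leftPt]
    abel
  refine h.trans ?_
  cases c with
  | Z =>
    have hH := Eqv.of_derivable (Derivable.rule (E := E) (Rule.H (I := Fin 0) (O := O) α))
    refine (Eqv.iso e ?_ hW).trans (hH.trans ?_)
    · rintro ((v | v) | v) <;> rfl
    · exact ofDots_net (V := Unit) (I := Fin 0) (O := O) _ _ _ _ ▸ Eqv.refl _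
  | X =>
    have hH := Eqv.of_derivable (Derivable.rule (E := E)
      (Rule.colourSwap (Rule.H (I := Fin 0) (O := O) α)))
    refine (Eqv.iso e ?_ hW).trans (hH.trans ?_)
    · rintro ((v | v) | v) <;> rfl
    · exact ofDots_net (V := Unit) (I := Fin 0) (O := O) _ _ _ _ ▸ Eqv.refl _

theorem Eqv.colour_change_wf (O : Type) [Fintype O] (c : Colour) (α : Real.Angle) :
    (hadamardSpider O c α).WF :=
  -- Any set of equations would do, as only the equivalence of well-formedness is extracted.
  (Eqv.colour_change (E := fun _ _ _ _ => False) O c α).1.2 (dotNet_wf _ _ _ _)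

/-- The green central dot is a red one with Hadamard boxes on its three legs (`N₁`). Two of the
boxes turn the red leaves green (`N₂`, `N₃`), where the given supplementarity applies (`N₄`). The
merged green dot is then rewritten as a red dot with two boxes (`N₅`), and these, with the box at
the output, turn the central dot green again. -/
theorem supplementarity_red (hE : SupplementarityFor E Z) : SupplementarityFor E X := by
  intro α
  let N₁ : Net (Fin 0 ⊕ Fin 1) := ⟨Fin 6, ![.dot X α, .dot X (α + (π : ℝ)), .dot X 0, .had, .had, .had],
    {s(.inl 0, .inl 3), s(.inl 1, .inl 4), s(.inl 3, .inl 2), s(.inl 4, .inl 2), s(.inl 2, .inl 5),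
      s(.inl 5, .inr (.inr 0))}⟩
  let N₂ : Net (Fin 0 ⊕ Fin 1) := ⟨Fin 5, ![.dot Z α, .dot X (α + (π : ℝ)), .dot X 0, .had, .had],
    {s(.inl 0, .inl 2), s(.inl 1, .inl 3), s(.inl 3, .inl 2), s(.inl 2, .inl 4),
      s(.inl 4, .inr (.inr 0))}⟩
  let N₃ : Net (Fin 0 ⊕ Fin 1) := ⟨Fin 4, ![.dot Z α, .dot Z (α + (π : ℝ)), .dot X 0, .had],
    {s(.inl 0, .inl 2), s(.inl 1, .inl 2), s(.inl 2, .inl 3), s(.inl 3, .inr (.inr 0))}⟩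
  let N₄ : Net (Fin 0 ⊕ Fin 1) := ⟨Fin 3, ![.dot Z (α + α + (π : ℝ)), .dot X 0, .had],
    {s(.inl 0, .inl 1), s(.inl 0, .inl 1), s(.inl 1, .inl 2), s(.inl 2, .inr (.inr 0))}⟩
  let N₅ : Net (Fin 0 ⊕ Fin 1) := ⟨Fin 5, ![.dot X (α + α + (π : ℝ)), .dot X 0, .had, .had, .had],
    {s(.inl 0, .inl 2), s(.inl 0, .inl 3), s(.inl 2, .inl 1), s(.inl 3, .inl 1), s(.inl 1, .inl 4),
      s(.inl 4, .inr (.inr 0))}⟩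
  refine Eqv.trans (N' := N₁) ?_ (Eqv.trans (N' := N₂) ?_ (Eqv.trans (N' := N₃) ?_
    (Eqv.trans (N' := N₄) ?_ (Eqv.trans (N' := N₅) ?_ ?_))))
  · let e : Unit ⊕ Fin 2 ≃ Fin 3 := Equiv.ofBijective (Sum.elim (fun _ => 2) ![0, 1]) (by decide)
    let e' : (Unit ⊕ Fin 3) ⊕ Fin 2 ≃ Fin 6 :=
        Equiv.ofBijective (Sum.elim (Sum.elim (fun _ => 2) ![3, 4, 5]) ![0, 1]) (by decide)
    refine (Eqv.colour_change (Fin 3) X 0).symm.replace (dotNet_wf _ _ _ _) e e'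
      ![.dot X α, .dot X (α + (π : ℝ))] (Sum.elim ![] ![.inl 0, .inl 1, .inr (.inr 0)]) 0 ?_ ?_ ?_ ?_
    · rintro (v | v) <;> (try fin_cases v) <;> rfl
    · rintro ((v | v) | v) <;> (try fin_cases v) <;> rfl
    · simp [e, embed, Fin.sum_univ_succ]
      simp only [Sym2.eq_swap, ← Multiset.singleton_add]
      abel
    · simp [N₁, e', embed, Fin.sum_univ_succ]
      simp only [Sym2.eq_swap, ← Multiset.singleton_add]
      abel
  · let e : (Unit ⊕ Fin 1) ⊕ Fin 4 ≃ Fin 6 :=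
      Equiv.ofBijective (Sum.elim (Sum.elim (fun _ => 0) ![3]) ![1, 2, 4, 5]) (by decide)
    let e' : Unit ⊕ Fin 4 ≃ Fin 5 := Equiv.ofBijective (Sum.elim (fun _ => 0) ![1, 2, 3, 4]) (by decide)
    refine (Eqv.colour_change (Fin 1) X α).replace (Eqv.colour_change_wf _ _ _) e e'
      ![.dot X (α + (π : ℝ)), .dot X 0, .had, .had] (Sum.elim ![] ![.inl 1])
          {s(.inl 0, .inl 2), s(.inl 2, .inl 1), s(.inl 1, .inl 3), s(.inl 3, .inr (.inr 0))} ?_ ?_ ?_ ?_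
    · rintro ((v | v) | v) <;> (try fin_cases v) <;> rfl
    · rintro (v | v) <;> (try fin_cases v) <;> rfl
    · simp [N₁, e, embed]
      simp only [Sym2.eq_swap, ← Multiset.singleton_add]
      abel
    · simp [N₂, e', embed]
      simp only [Sym2.eq_swap, ← Multiset.singleton_add]
      abel
  · let e : (Unit ⊕ Fin 1) ⊕ Fin 3 ≃ Fin 5 :=
      Equiv.ofBijective (Sum.elim (Sum.elim (fun _ => 1) ![3]) ![0, 2, 4]) (by decide)
    let e' : Unit ⊕ Fin 3 ≃ Fin 4 := Equiv.ofBijective (Sum.elim (fun _ => 1) ![0, 2, 3]) (by decide)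
    refine (Eqv.colour_change (Fin 1) X (α + (π : ℝ))).replace (Eqv.colour_change_wf _ _ _) e e'
      ![.dot Z α, .dot X 0, .had] (Sum.elim ![] ![.inl 1])
          {s(.inl 0, .inl 1), s(.inl 1, .inl 2), s(.inl 2, .inr (.inr 0))} ?_ ?_ ?_ ?_
    · rintro ((v | v) | v) <;> (try fin_cases v) <;> rfl
    · rintro (v | v) <;> (try fin_cases v) <;> rfl
    · simp [N₂, e, embed]
      simp only [Sym2.eq_swap, ← Multiset.singleton_add]
      abel
    · simp [N₃, e', embed]
      simp only [← Multiset.singleton_add]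
      abel
  · let e : Fin 3 ⊕ Unit ≃ Fin 4 := Equiv.ofBijective (Sum.elim ![0, 1, 2] fun _ => 3) (by decide)
    let e' : Fin 2 ⊕ Unit ≃ Fin 3 := Equiv.ofBijective (Sum.elim ![0, 1] fun _ => 2) (by decide)
    refine (hE α).replace (dotNet_wf _ _ _ _) e e'
      (fun _ => .had) (Sum.elim ![] ![.inl ()]) {s(.inl (), .inr (.inr 0))} ?_ ?_ ?_ ?_
    · rintro (v | v) <;> (try fin_cases v) <;> rfl
    · rintro (v | v) <;> (try fin_cases v) <;> rfl
    · simp [N₃, e, embed]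
    · simp [N₄, e', embed]
  · let e : Unit ⊕ Fin 2 ≃ Fin 3 := Equiv.ofBijective (Sum.elim (fun _ => 0) ![1, 2]) (by decide)
    let e' : (Unit ⊕ Fin 2) ⊕ Fin 2 ≃ Fin 5 :=
        Equiv.ofBijective (Sum.elim (Sum.elim (fun _ => 0) ![2, 3]) ![1, 4]) (by decide)
    refine (Eqv.colour_change (Fin 2) X (α + α + (π : ℝ))).symm.replace (dotNet_wf _ _ _ _) e e'
      ![.dot X 0, .had] (Sum.elim ![] ![.inl 0, .inl 0])
          {s(.inl 0, .inl 1), s(.inl 1, .inr (.inr 0))} ?_ ?_ ?_ ?_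
    · rintro (v | v) <;> (try fin_cases v) <;> rfl
    · rintro ((v | v) | v) <;> (try fin_cases v) <;> rfl
    · simp [N₄, e, embed, Fin.sum_univ_succ]
      simp only [← Multiset.singleton_add]
      abel
    · simp [N₅, e', embed, Fin.sum_univ_succ]
      simp only [Sym2.eq_swap, ← Multiset.singleton_add]
      abel
  · let e : (Unit ⊕ Fin 3) ⊕ Unit ≃ Fin 5 :=
      Equiv.ofBijective (Sum.elim (Sum.elim (fun _ => 1) ![2, 3, 4]) fun _ => 0) (by decide)
    let e' : Unit ⊕ Unit ≃ Fin 2 := Equiv.ofBijective (Sum.elim (fun _ => 1) fun _ => 0) (by decide)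
    refine (Eqv.colour_change (Fin 3) X 0).replace (Eqv.colour_change_wf _ _ _) e e'
      (fun _ => .dot X (α + α + (π : ℝ))) (Sum.elim ![] ![.inl (), .inl (), .inr (.inr 0)]) 0 ?_ ?_ ?_ ?_
    · rintro ((v | v) | v) <;> (try fin_cases v) <;> rfl
    · rintro (v | v) <;> (try fin_cases v) <;> rfl
    · simp [N₅, e, embed, Fin.sum_univ_succ]
      simp only [Sym2.eq_swap, ← Multiset.singleton_add]
      abel
    · simp [e', embed, Fin.sum_univ_succ]
      simp only [Sym2.eq_swap, ← Multiset.singleton_add]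

/-! ### From antiphase twins in a diagram to pairs with a common neighbourhood. -/

theorem wireCount_add {P : Type} (W W' : Multiset (Sym2 P)) (x y : P) :
    wireCount (W + W') x y = wireCount W x y + wireCount W' x y := by
  classical
  exact Multiset.count_add _ _ _

theorem wireCount_eq_zero {P : Type} {W : Multiset (Sym2 P)} {x y : P} (h : s(x, y) ∉ W) :
    wireCount W x y = 0 := by
  classical
  exact Multiset.count_eq_zero_of_notMem h

theorem wireCount_map {P Q : Type} {f : P → Q} (hf : f.Injective) (W : Multiset (Sym2 P))
    (x y : P) : wireCount (W.map (Sym2.map f)) (f x) (f y) = wireCount W x y := by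
  classical
  exact Multiset.count_map_eq_count' (Sym2.map f) W (Sym2.map.injective hf) s(x, y)

theorem wireCount_map_pair {A P : Type} [DecidableEq A] {f : A → P} (hf : f.Injective)
    (C : Multiset A) (x : P) (a : A) : wireCount (C.map fun b => s(x, f b)) x (f a) = C.count a := by
  classical
  exact Multiset.count_map_eq_count' _ _ (fun _ _ h => hf (Sym2.congr_right.1 h)) a

theorem exists_point {V J P : Type} (x : (V ⊕ J) ⊕ P) :
    (∃ v, x = .inl (.inl v)) ∨ ∃ q : J ⊕ P, x = Sum.map .inr id q := by
  rcases x with (x | x) | x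
  exacts [.inl ⟨x, rfl⟩, .inr ⟨.inl x, rfl⟩, .inr ⟨.inr x, rfl⟩]

/-- With no wire between the two dots, a wire is a loop at one of them, leads from one of them to
the rest, or lies in the rest. -/
theorem exists_wires_eq {J P : Type} (W : Multiset (Sym2 ((Bool ⊕ J) ⊕ P)))
    (hW : s(Sum.inl (Sum.inl true), Sum.inl (Sum.inl false)) ∉ W) :
    ∃ (n : Bool → ℕ) (C : Bool → Multiset (J ⊕ P)) (W' : Multiset (Sym2 (J ⊕ P))),
      W = Multiset.replicate (n true) s(Sum.inl (Sum.inl true), Sum.inl (Sum.inl true)) +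
        (Multiset.replicate (n false) s(Sum.inl (Sum.inl false), Sum.inl (Sum.inl false)) +
        (star (Sum.inl true) Sum.inr (C true) + star (Sum.inl false) Sum.inr (C false) + embed Sum.inr W')) := by
  induction W using Multiset.induction_on with
  | empty => exact ⟨fun _ => 0, fun _ => 0, 0, rfl⟩
  | cons e W ih =>
    obtain ⟨n, C, W', rfl⟩ := ih fun h => hW (Multiset.mem_cons_of_mem h)
    have he : e ≠ s(Sum.inl (Sum.inl true),
         Sum.inl (Sum.inl false)) := fun h => hW (h ▸ Multiset.mem_cons_self _ _)
    have hstar : ∀ (b : Bool) (q : J ⊕ P), ∃ C' : Bool → Multiset (J ⊕ P),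
        star (Sum.inl true) Sum.inr (C' true) + star (Sum.inl false) Sum.inr (C' false) =
          {s(Sum.inl (Sum.inl b), Sum.map Sum.inr id q)} +
          (star (Sum.inl true) Sum.inr (C true) + star (Sum.inl false) Sum.inr (C false)) := by
      intro b q
      refine ⟨Function.update C b (q ::ₘ C b), ?_⟩
      cases b <;> simp [star_cons]
    clear hW
    induction e with
    | _ x y =>
      rcases exists_point x with ⟨b, rfl⟩ | ⟨q, rfl⟩ <;>
        rcases exists_point y with ⟨b', rfl⟩ | ⟨q', rfl⟩
      · have hb : b' = b := by
          cases b <;> cases b' <;> simp at he ⊢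
        subst hb
        refine ⟨Function.update n b' (n b' + 1), C, W', ?_⟩
        cases b' <;> simp [Multiset.replicate_succ]
      · obtain ⟨C', hC'⟩ := hstar b q'
        refine ⟨n, C', W', ?_⟩
        rw [hC', ← Multiset.singleton_add]
        abel
      · obtain ⟨C', hC'⟩ := hstar b' q
        refine ⟨n, C', W', ?_⟩
        rw [hC', ← Multiset.singleton_add, Sym2.eq_swap]
        abel
      · refine ⟨n, C, s(q, q') ::ₘ W', ?_⟩
        rw [embed_cons]
        simp only [← Multiset.singleton_add]
        abel

/-- The condition on wire counts says that the two multisets of neighbours coincide. It says nothing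
about loops, so these are taken away before the merge. -/
theorem Eqv.twins_merge {c : Colour} (hE : SupplementarityFor E c) {J : Type}
    (d : Bool → Real.Angle) (hd : d false = d true + (π : ℝ)) (l : J → Node)
    (W : Multiset (Sym2 ((Bool ⊕ J) ⊕ (I ⊕ O))))
    (hW : s(.inl (.inl true), .inl (.inl false)) ∉ W)
    (hcount : ∀ q : J ⊕ (I ⊕ O), wireCount W (.inl (.inl true)) (Sum.map .inr id q) =
      wireCount W (.inl (.inl false)) (Sum.map .inr id q))
    (hWF : Net.WF ⟨Bool ⊕ J, Sum.elim (fun b => .dot c (d b)) l, W⟩) :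
    Eqv E ⟨Bool ⊕ J, Sum.elim (fun b => .dot c (d b)) l, W⟩
      ⟨Unit ⊕ J, Sum.elim (fun _ => .dot c (d true + d false)) l,
        W.map (Sym2.map (Sum.map (Sum.map (fun _ => ()) id) id))⟩ := by
  classical
  obtain ⟨n, C, W, rfl⟩ := exists_wires_eq W hW
  have hC : C false = C true := by
    ext q
    have h := hcount q
    have hne : ∀ b, (.inl (.inl b) : (Bool ⊕ J) ⊕ (I ⊕ O)) ≠ Sum.map .inr id q := by
      rcases q with q | q <;> simp
    have hinj : (Sum.map .inr id : J ⊕ (I ⊕ O) → (Bool ⊕ J) ⊕ (I ⊕ O)).Injective :=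
      Sum.inr_injective.sumMap Function.injective_id
    have hself : ∀ b, wireCount (star (.inl b) .inr (C b) : Multiset (Sym2 ((Bool ⊕ J) ⊕ (I ⊕ O))))
        (.inl (.inl b)) (Sum.map .inr id q) = (C b).count q := fun b =>
      wireCount_map_pair hinj (C b) _ q
    have hstar : ∀ b b', b ≠ b' →
        wireCount (star (.inl b) .inr (C b) : Multiset (Sym2 ((Bool ⊕ J) ⊕ (I ⊕ O))))
          (.inl (.inl b')) (Sum.map .inr id q) = 0 := by
      intro b b' hb
      refine wireCount_eq_zero fun h => ?_
      obtain ⟨x, -, hx⟩ := Multiset.mem_map.1 h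
      rcases x with x | x <;> rcases q with q | q <;> simp [hb] at hx
    have hembed : ∀ b, wireCount (embed .inr W : Multiset (Sym2 ((Bool ⊕ J) ⊕ (I ⊕ O))))
        (.inl (.inl b)) (Sum.map .inr id q) = 0 := by
      intro b
      refine wireCount_eq_zero fun h => ?_
      obtain ⟨x, -, hx⟩ := Multiset.mem_map.1 h
      have : (.inl (.inl b) : (Bool ⊕ J) ⊕ (I ⊕ O)) ∈ Sym2.map (Sum.map .inr id) x := by
        rw [hx]; simp
      obtain ⟨y, -, hy⟩ := Sym2.mem_map.1 this
      rcases y with y | y <;> simp at hy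
    have hrep : ∀ b b' k, wireCount (Multiset.replicate k s(.inl (.inl b), .inl (.inl b)) : Multiset (Sym2 ((Bool ⊕ J) ⊕ (I ⊕ O))))
        (.inl (.inl b')) (Sum.map .inr id q) = 0 := by
      intro b b' k
      refine wireCount_eq_zero fun h => ?_
      have hx := Multiset.eq_of_mem_replicate h
      rcases q with q | q <;> simp at hx
    simpa [wireCount_add, hrep, hembed, hself, hstar] using h.symm
  rw [hC] at hWF ⊢
  have h1 := Eqv.remove_loops (E := E) (l := Sum.elim (fun b => .dot c (d b)) l) (u := .inl true) rfl
    (n true) (Multiset.replicate (n false) s(.inl (.inl false), .inl (.inl false)) +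
        (pairNet c d true false l (C true) W).wires)
  have h2 := Eqv.remove_loops (E := E) (l := Sum.elim (fun b => .dot c (d b)) l) (u := .inl false) rfl
    (n false) (pairNet c d true false l (C true) W).wires
  have h12 := h1.trans h2
  refine h12.trans ((Eqv.pair_merge hE d hd l _ _ (h12.1.1 hWF)).trans ?_)
  -- Merging keeps the loops of both twins, so all of them are put back on the merged dot.
  refine Eqv.trans (Eqv.remove_loops (l := Sum.elim (fun _ => .dot c (d true + d false)) l)
    (u := .inl ()) rfl (n true + n false) _).symm (Eqv.of_wires_eq ?_)
  simp [map_star, map_embed, Multiset.replicate_add, add_assoc]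

theorem Supplementarity.all_colours (hE : Supplementarity E) : ∀ c, SupplementarityFor E c
  | Z => fun α => Eqv.of_derivable_dots (hE α)
  | X => supplementarity_red fun α => Eqv.of_derivable_dots (hE α)

theorem wireCount_pos {P : Type} {W : Multiset (Sym2 P)} {x y : P} (h : s(x, y) ∈ W) :
    1 ≤ wireCount W x y := by
  classical
  exact Multiset.one_le_count_iff_mem.2 h

theorem wireCount_eq_count {P : Type} [DecidableEq P] (W : Multiset (Sym2 P)) (x y : P) :
    wireCount W x y = W.count s(x, y) := by
  unfold wireCount
  congr

/-- The identification of `v` with `u` on nodes. -/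
noncomputable def mergeNode {V : Type} {u v : V} (h : u ≠ v) (w : V) : {w : V // w ≠ v} := by
  classical exact if hw : w = v then ⟨u, h⟩ else ⟨w, hw⟩

theorem mergeNode_right {V : Type} {u v : V} (h : u ≠ v) : mergeNode h v = ⟨u, h⟩ := by
  simp [mergeNode]

theorem mergeNode_of_ne {V : Type} {u v w : V} (h : u ≠ v) (hw : w ≠ v) :
    mergeNode h w = ⟨w, hw⟩ := by
  simp [mergeNode, hw]

theorem mergePoint_eq {V P : Type} {u v : V} (h : u ≠ v) :
    (mergePoint h : V ⊕ P → _) = Sum.map (mergeNode h) id := by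
  funext x
  rcases x with x | x
  · simp only [mergePoint, mergeNode, Sum.map_inl]
    split_ifs <;> rfl
  · rfl

theorem merge_wires (D : Diagram I O) {u v : D.V} (h : u ≠ v) (c : Colour) (γ : Real.Angle) :
    (D.merge h c γ).wires = (by classical exact D.wires.filter (· ≠ s(.inl u, .inl v)) :
      Multiset (Sym2 (D.V ⊕ (I ⊕ O)))).map (Sym2.map (Sum.map (mergeNode h) id)) := by
  rw [← mergePoint_eq h]
  rfl

theorem merge_wires_of_notMem (D : Diagram I O) {u v : D.V} (h : u ≠ v) (c : Colour)
    (γ : Real.Angle) (huv : s(.inl u, .inl v) ∉ D.wires) :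
    (D.merge h c γ).wires = D.wires.map (Sym2.map (Sum.map (mergeNode h) id)) := by
  classical
  have hW : D.wires.filter (· ≠ s(.inl u, .inl v)) = D.wires :=
    Multiset.filter_eq_self.2 fun e he hu => huv (hu ▸ he)
  rw [merge_wires, hW]

theorem merge_label_left (D : Diagram I O) {u v : D.V} (h : u ≠ v) (c : Colour) (γ : Real.Angle) :
    (D.merge h c γ).label ⟨u, h⟩ = .dot c γ := by
  simp [Diagram.merge]

theorem merge_label_of_ne (D : Diagram I O) {u v w : D.V} (h : u ≠ v) (c : Colour) (γ : Real.Angle)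
    (hu : w ≠ u) (hv : w ≠ v) : (D.merge h c γ).label ⟨w, hv⟩ = D.label w := by
  simp [Diagram.merge, hu]

theorem replicate_add_filter_ne {P : Type} [DecidableEq P] (W : Multiset (Sym2 P)) (x y : P) :
    W = Multiset.replicate (wireCount W x y) s(x, y) + W.filter (· ≠ s(x, y)) := by
  rw [wireCount_eq_count, ← Multiset.filter_eq', Multiset.filter_add_not]

/-- A wire between the twins makes the merge an instance of fusion; otherwise the twins are
separated from the remaining nodes and the pair argument applies. -/
theorem Eqv.merge_twins (hE : ∀ c, SupplementarityFor E c) (D : Diagram I O) {u v : D.V}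
    {c : Colour} {α β : Real.Angle} (h : AntiphaseTwins D u v c α β) :
    Eqv E D.net (D.merge h.ne c (α + β)).net := by
  classical
  have hlu : (D.merge h.ne c (α + β)).label (mergeNode h.ne u) = .dot c (α + β) :=
    (congrArg _ (mergeNode_of_ne h.ne h.ne)).trans (merge_label_left D h.ne c (α + β))
  have hl : ∀ w, w ≠ u → w ≠ v →
      (D.merge h.ne c (α + β)).label (mergeNode h.ne w) = D.label w :=
    fun w hu hv =>
      (congrArg _ (mergeNode_of_ne h.ne hv)).trans (merge_label_of_ne D h.ne c (α + β) hu hv)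
  by_cases hk : 1 ≤ wireCount D.wires (.inl u) (.inl v)
  · refine Eqv.fuse (mergeNode h.ne) u v _ _ hk h.ne h.label_left h.label_right ?_ ?_ ?_ hlu hl
      (replicate_add_filter_ne D.wires _ _) ?_
    · exact (mergeNode_right h.ne).trans (mergeNode_of_ne h.ne h.ne).symm
    · exact fun w => ⟨w.1, mergeNode_of_ne h.ne w.2⟩
    · intro x y hx hy hxy
      exact congrArg Subtype.val
        ((mergeNode_of_ne h.ne hx).symm.trans (hxy.trans (mergeNode_of_ne h.ne hy)))
    · exact merge_wires D h.ne c (α + β)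
  · have huv : s(.inl u, .inl v) ∉ D.wires := fun hm =>
      hk (wireCount_pos hm)
    let J := {w // w ≠ u ∧ w ≠ v}
    let e : Bool ⊕ J ≃ D.V := Equiv.ofBijective
        (Sum.elim (fun b => bif b then u else v) Subtype.val) (by
      constructor
      · rintro ((_ | _) | ⟨x, hx⟩) ((_ | _) | ⟨y, hy⟩) hxy
        · rfl
        · exact absurd hxy.symm h.ne
        · exact absurd hxy.symm hy.2
        · exact absurd hxy h.ne
        · rfl
        · exact absurd hxy.symm hy.1
        · exact absurd hxy hx.2
        · exact absurd hxy hx.1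
        · exact congrArg Sum.inr (Subtype.ext hxy)
      · intro w
        by_cases hu : w = u
        · exact ⟨.inl true, hu.symm⟩
        · by_cases hv : w = v
          · exact ⟨.inl false, hv.symm⟩
          · exact ⟨.inr ⟨w, hu, hv⟩, rfl⟩)
    let g : Unit ⊕ J ≃ {w // w ≠ v} := Equiv.ofBijective
        (Sum.elim (fun _ => ⟨u, h.ne⟩) fun w => ⟨w.1, w.2.2⟩) (by
      constructor
      · rintro (_ | ⟨x, hx⟩) (_ | ⟨y, hy⟩) hxy
        · rfl
        · exact absurd (congrArg Subtype.val hxy).symm hy.1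
        · exact absurd (congrArg Subtype.val hxy) hx.1
        · exact congrArg Sum.inr (Subtype.ext (by simpa using hxy))
      · rintro ⟨w, hw⟩
        by_cases hu : w = u
        · exact ⟨.inl (), by simp [hu]⟩
        · exact ⟨.inr ⟨w, hu, hw⟩, rfl⟩)
    let d : Bool → Real.Angle := fun b => bif b then α else β
    let W := D.wires.map (Sym2.map (Sum.map e.symm id))
    have hW : D.wires = W.map (Sym2.map (Sum.map e id)) := by
      rw [map_sym2_comp]
      refine Eq.trans (Multiset.map_id' _).symm ?_
      refine Multiset.map_congr rfl fun z _ => ?_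
      induction z with
      | _ x y => rcases x with x | x <;> rcases y with y | y <;> simp
    have hcount : ∀ x y, wireCount W x y = wireCount D.wires (Sum.map e id x) (Sum.map e id y) := by
      intro x y
      have hinj : (Sum.map e (id : I ⊕ O → I ⊕ O)).Injective :=
        e.injective.sumMap Function.injective_id
      rw [hW]
      exact (wireCount_map hinj W x y).symm
    have h1 : Eqv E ⟨Bool ⊕ J, Sum.elim (fun b => .dot c (d b)) fun j => D.label j.1, W⟩ D.net := by
      refine Eqv.iso e ?_ hW
      rintro ((_ | _) | j)
      exacts [h.label_right, h.label_left, rfl]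
    refine h1.symm.trans ((Eqv.twins_merge (hE c) d ?_ _ W ?_ ?_ (h1.1.2 D.net_wf)).trans
      (Eqv.iso g ?_ ?_))
    -- `true` stands for `u` and `false` for `v`, which matches the sign in the antiphase condition.
    · exact (eq_add_of_sub_eq' h.antiphase)
    · intro hm
      have : s(Sum.map e id (.inl (.inl true)), Sum.map e id (.inl (.inl false))) ∈ D.wires := by
        rw [hW]
        exact Multiset.mem_map_of_mem (Sym2.map (Sum.map e id)) hm
      exact huv this
    · intro q
      rw [hcount, hcount]
      refine h.same_neighbourhood _ ?_ ?_ <;> rcases q with ⟨w, hw⟩ | q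
      · exact fun hq => hw.1 (Sum.inl_injective hq)
      · simp
      · exact fun hq => hw.2 (Sum.inl_injective hq)
      · simp
    · rintro (_ | j)
      · refine Eq.trans ?_ hlu
        rw [mergeNode_of_ne h.ne h.ne]
        rfl
      · refine Eq.trans ?_ (hl j.1 j.2.1 j.2.2)
        rw [mergeNode_of_ne h.ne j.2.2]
        rfl
    · change (D.merge h.ne c (α + β)).wires = _
      refine (merge_wires_of_notMem D h.ne c (α + β) huv).trans (((congrArg _ hW).trans (map_sym2_comp _ _ W)).trans
        (Eq.trans (map_sym2_congr (fun x => ?_) W) (map_sym2_comp _ _ W).symm))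
      rcases x with ((_ | _) | ⟨w, hw⟩) | x
      · exact congrArg Sum.inl (mergeNode_right h.ne)
      · exact congrArg Sum.inl (mergeNode_of_ne h.ne h.ne)
      · exact congrArg Sum.inl (mergeNode_of_ne h.ne hw.2)
      · rfl

theorem Supplementarity.antiphaseTwinsMerge (hE : Supplementarity E) : AntiphaseTwinsMerge E :=
  fun _ _ D _ _ _ _ _ h => (Eqv.merge_twins hE.all_colours D h).derivable

/-! ### Supplementarity as a merge of twins. -/

theorem suppLeft_wires (α : Real.Angle) : (suppLeft α).wires =
    ({s(.inl 0, .inl 2), s(.inl 1, .inl 2), s(.inl 2, .inr (.inr 0))} :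
      Multiset (Sym2 (Fin 3 ⊕ (Fin 0 ⊕ Fin 1)))) := by
  simp [suppLeft, ofDots]

theorem suppLeft_twins (α : Real.Angle) :
    AntiphaseTwins (suppLeft α) (0 : Fin 3) (1 : Fin 3) Z α (α + (π : ℝ)) where
  label_left := rfl
  label_right := rfl
  antiphase := by simp
  same_neighbourhood w h0 h1 := by
    rw [suppLeft_wires]
    change Fin 3 ⊕ (Fin 0 ⊕ Fin 1) at w
    refine (wireCount_eq_count (P := Fin 3 ⊕ (Fin 0 ⊕ Fin 1)) _ _ _).trans
      (Eq.trans ?_ (wireCount_eq_count (P := Fin 3 ⊕ (Fin 0 ⊕ Fin 1)) _ _ _).symm)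
    have key : ∀ w : Fin 3 ⊕ (Fin 0 ⊕ Fin 1), w ≠ .inl 0 → w ≠ .inl 1 →
        Multiset.count s(.inl 0, w) {s(.inl 0, .inl 2), s(.inl 1, .inl 2), s(.inl 2, .inr (.inr 0))} =
        Multiset.count s(.inl 1, w)
          {s(.inl 0, .inl 2), s(.inl 1, .inl 2), s(.inl 2, .inr (.inr 0))} := by
      decide
    exact key w h0 h1

/-- The green dots on the left of supplementarity have the red dot as their only neighbour. Their
merge has angle `α + (α + π)` and keeps both wires to the red dot. -/
theorem AntiphaseTwinsMerge.supplementarity (h : AntiphaseTwinsMerge E) : Supplementarity E := by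
  intro α
  refine (h _ _ (suppLeft α) _ _ _ _ _ (suppLeft_twins α)).trans (.iso ?_)
  have h20 : (2 : Fin 3) ≠ 0 := by decide
  have hne : (0 : Fin 3) ≠ 1 := by decide
  -- The entry at the deleted node `1` does not affect `f`; it is chosen so that the same vector
  -- describes `f` after the identification of `1` with `0`.
  let f : {w : Fin 3 // w ≠ 1} ≃ Fin 2 := Equiv.ofBijective (fun w => ![0, 0, 1] w.1) (by decide)
  have hf : ∀ w, f (mergeNode hne w) = (![0, 0, 1] : Fin 3 → Fin 2) w := by
    intro w
    by_cases hw : w = 1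
    · rw [hw, mergeNode_right]
      rfl
    · rw [mergeNode_of_ne _ hw]
      rfl
  refine ⟨f, ?_, ?_⟩
  · rintro ⟨w, hw⟩
    change Fin 3 at w
    fin_cases w
    · refine Eq.trans ?_ (merge_label_left (suppLeft α) hne Z (α + (α + (π : ℝ)))).symm
      rw [← add_assoc]
      rfl
    · exact absurd rfl hw
    · exact (merge_label_of_ne (suppLeft α) hne Z _ (w := (2 : Fin 3)) h20 hw).symm
  · have huv : (s(.inl 0, .inl 1) : Sym2 (Fin 3 ⊕ (Fin 0 ⊕ Fin 1))) ∉ (suppLeft α).wires := by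
      rw [suppLeft_wires]
      exact (by decide : (s(.inl 0, .inl 1) : Sym2 (Fin 3 ⊕ (Fin 0 ⊕ Fin 1))) ∉
        ({s(.inl 0, .inl 2), s(.inl 1, .inl 2), s(.inl 2, .inr (.inr 0))} : Multiset _))
    rw [merge_wires_of_notMem _ _ _ _ huv]
    refine Eq.trans ?_ (map_sym2_comp (Sum.map f id) (Sum.map (mergeNode hne) id) _).symm
    refine Eq.trans ?_ (map_sym2_congr (f := Sum.map (![0, 0, 1] : Fin 3 → Fin 2) id) (fun x => ?_) _)
    · rw [suppLeft_wires]
      simp [suppRight, ofDots]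
    · rcases x with x | x
      · exact congrArg Sum.inl (hf x).symm
      · rfl

end ZX

theorem mainTheorem3 (E : ZX.Equations) :
    ZX.AntiphaseTwinsMerge E ↔ ZX.Supplementarity E :=
  ⟨fun h => h.supplementarity, fun h => h.antiphaseTwinsMerge⟩
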